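/- **Homotopy transfer theorem.** Work over $\mathbb{Q}$ with unbounded chain complexes (homological grading, differentials of degree $-1$, Koszul sign rule). Let $\mathcal{C}$ be a (symmetric) dg cooperad that is connected, i.e. $\mathcal{C}(0)=0$ and $\mathcal{C}(1)=\mathbb{Q}$ (via the counit), and let $\mathcal{P}_\infty=\Omega\mathcal{C}$ be its cobar construction. For a chain complex $A$ let $$\mathcal{C}(A)=\bigoplus_{n\ge 0}\mathcal{C}(n)\otimes_{\Sigma_n}A^{\otimes n}$$ be the cofree conilpotent $\mathcal{C}$-coalgebra on $A$, with the internal differential $d$ induced by those of $\mathcal{C}$ and $A$; its $n$-th summand is the part of weight $n$. Here a $\mathcal{P}_\infty$-algebra structure on $A$ is understood through its standard description as a coderivation $b$ of the $\mathcal{C}$-coalgebra $\mathcal{C}(A)$ of degree $-1$ such that $(d+b)^2=0$ and $b$ decreases weight (it maps weight $w$ into the sum of the weights $<w$). An $\infty$-morphism $(A,b)\rightsquigarrow(A',b')$ is a morphism of dg $\mathcal{C}$-coalgebras $(\mathcal{C}(A),d+b)\to(\mathcal{C}(A'),d+b')$; its linear part is the induced map $A=\mathcal{C}(1)\otimes A\to\mathcal{C}(1)\otimes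 A'=A'$ from weight one to weight one, and it is an $\infty$-quasi-isomorphism if its linear part is a quasi-isomorphism of chain complexes. Let $A$ and $B$ be chain complexes and let $f\colon A\to B$, $g\colon B\to A$, $h\colon A\to A$ be a contraction, i.e. $f$ and $g$ are chain maps of degree $0$, $h$ is a map of degree $1$, and $$fg=\mathrm{id}_B,\qquad gf=\mathrm{id}_A+dh+hd,\qquad fh=0,\qquad hg=0,\qquad h^2=0.$$ Then for every $\mathcal{P}_\infty$-algebra structure $b$ on $A$ there are a $\mathcal{P}_\infty$-algebra structure $b'$ on $B$ and $\infty$-quasi-isomorphisms $F\colon(A,b)\rightsquigarrow(B,b')$ and $G\colon(B,b')\rightsquigarrow(A,b)$ that extend $f$ and $g$, i.e. whose linear parts are $f$ and $g$. -/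

import Mathlib

open scoped TensorProduct

universe u v w

/-- A chain complex of rational vector spaces in homological grading: a `ℤ`-graded vector space
`V = ⨁ Vᵢ` together with a linear map `d : V → V` of degree `-1` such that `d² = 0`. -/
structure DGModule : Type (u + 1) where
  carrier : Type u
  [addCommGroup : AddCommGroup carrier]
  [module : Module ℚ carrier]
  /-- The homogeneous components. -/
  deg : ℤ → Submodule ℚ carrier
  isInternal : DirectSum.IsInternal deg
  /-- The differential. -/
  d : carrier →ₗ[ℚ] carrier
  d_mem : ∀ (i : ℤ) (x : carrier), x ∈ deg i → d x ∈ deg (i - 1)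
  d_d : ∀ x : carrier, d (d x) = 0

namespace DGModule

instance : CoeSort DGModule.{u} (Type u) := ⟨DGModule.carrier⟩

attribute [instance] DGModule.addCommGroup DGModule.module

noncomputable section

/-- The projection of `M` onto its even (`e = 0`) or odd (`e = 1`) part. -/
def par (M : DGModule.{u}) (e : ZMod 2) : M →ₗ[ℚ] M :=
  (DirectSum.toModule ℚ ℤ M fun i => if (i : ZMod 2) = e then (M.deg i).subtype else 0) ∘ₗ
    (LinearEquiv.ofBijective (DirectSum.coeLinearMap M.deg) M.isInternal).symm.toLinearMap

/-- The grading involution `x ↦ (-1)^|x| x`. -/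
def eps (M : DGModule.{u}) : M →ₗ[ℚ] M := M.par 0 - M.par 1

theorem par_of_mem (M : DGModule.{u}) (e : ZMod 2) {i : ℤ} {x : M} (hx : x ∈ M.deg i) :
    M.par e x = if (i : ZMod 2) = e then x else 0 := by
  have h : (LinearEquiv.ofBijective (DirectSum.coeLinearMap M.deg) M.isInternal).symm x
      = DirectSum.lof ℚ ℤ (fun i => M.deg i) i ⟨x, hx⟩ := by
    rw [LinearEquiv.symm_apply_eq]
    exact (DirectSum.coeLinearMap_lof M.deg i ⟨x, hx⟩).symm
  simp only [par, LinearMap.comp_apply, LinearEquiv.coe_coe, h, DirectSum.toModule_lof]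
  split_ifs <;> simp

theorem hom_ext {M : DGModule.{u}} {W : Type*} [AddCommGroup W] [Module ℚ W]
    {φ ψ : M →ₗ[ℚ] W} (h : ∀ (i : ℤ) (x : M), x ∈ M.deg i → φ x = ψ x) : φ = ψ := by
  have ht : (⊤ : Submodule ℚ M) ≤ LinearMap.eqLocus φ ψ := by
    rw [← M.isInternal.submodule_iSup_eq_top]
    exact iSup_le fun i x hx => h i x hx
  exact LinearMap.ext fun x => ht (Submodule.mem_top : x ∈ ⊤)

theorem par_zero_add_par_one (M : DGModule.{u}) : M.par 0 + M.par 1 = LinearMap.id := by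
  apply hom_ext
  intro i x hx
  simp only [LinearMap.add_apply, par_of_mem M _ hx, LinearMap.id_apply]
  have h : ∀ p : ZMod 2, p = 0 ∧ p ≠ 1 ∨ p ≠ 0 ∧ p = 1 := by decide
  rcases h i with ⟨h0, h1⟩ | ⟨h0, h1⟩ <;> simp [h0, h1]

theorem sum_par (M : DGModule.{u}) (x : M) : ∑ e : ZMod 2, M.par e x = x := by
  have := LinearMap.congr_fun M.par_zero_add_par_one x
  exact (Fin.sum_univ_two (fun e : Fin 2 => M.par e x)).trans this

theorem par_par (M : DGModule.{u}) (e e' : ZMod 2) (x : M) :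
    M.par e (M.par e' x) = if e = e' then M.par e' x else 0 := by
  have : M.par e ∘ₗ M.par e' = if e = e' then M.par e' else 0 := by
    apply hom_ext
    intro i x hx
    rw [LinearMap.comp_apply, par_of_mem M _ hx]
    by_cases h1 : (i : ZMod 2) = e'
    · rw [if_pos h1, par_of_mem M _ hx, h1]
      by_cases h2 : e = e'
      · rw [if_pos h2, if_pos h2.symm, par_of_mem M _ hx, if_pos h1]
      · rw [if_neg h2, if_neg (Ne.symm h2), LinearMap.zero_apply]
    · rw [if_neg h1, map_zero]
      split_ifs
      · rw [par_of_mem M _ hx, if_neg h1]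
      · rfl
  have h := LinearMap.congr_fun this x
  rw [LinearMap.comp_apply] at h
  rw [h]
  split_ifs <;> rfl

theorem d_par (M : DGModule.{u}) (e : ZMod 2) (x : M) :
    M.par (e + 1) (M.d x) = M.d (M.par e x) := by
  have : M.par (e + 1) ∘ₗ M.d = M.d ∘ₗ M.par e := by
    apply hom_ext
    intro i x hx
    simp only [LinearMap.comp_apply, par_of_mem M _ hx, par_of_mem M _ (M.d_mem i x hx)]
    have : (((i - 1 : ℤ) : ZMod 2) = e + 1) ↔ ((i : ℤ) : ZMod 2) = e := by
      push_cast
      generalize (i : ZMod 2) = p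
      revert p e; decide
    simp only [this]
    split_ifs <;> simp
  exact LinearMap.congr_fun this x

theorem par_hom {M N : DGModule.{u}} (φ : M →ₗ[ℚ] N)
    (hφ : ∀ (i : ℤ) (x : M), x ∈ M.deg i → φ x ∈ N.deg i) (e : ZMod 2) (x : M) :
    N.par e (φ x) = φ (M.par e x) := by
  have : N.par e ∘ₗ φ = φ ∘ₗ M.par e := by
    apply hom_ext
    intro i x hx
    simp only [LinearMap.comp_apply, par_of_mem M _ hx, par_of_mem N _ (hφ i x hx)]
    split_ifs <;> simp
  exact LinearMap.congr_fun this x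

end

end DGModule

/-! ### Fibres of maps between standard finite sets -/

section Fibres

variable {n n' k k' m : ℕ}

/-- The number of elements of the fibre `f⁻¹(i)`. -/
def fiberCard (f : Fin n → Fin k) (i : Fin k) : ℕ := Fintype.card {s : Fin n // f s = i}

/-- The order preserving enumeration of the fibre `f⁻¹(i)`. -/
def fiberIso (f : Fin n → Fin k) (i : Fin k) : Fin (fiberCard f i) ≃o {s : Fin n // f s = i} :=
  Fintype.orderIsoFinOfCardEq _ rfl

/-- The `v`-th element of the fibre `f⁻¹(i)`. -/
def fiberEmb (f : Fin n → Fin k) (i : Fin k) (v : Fin (fiberCard f i)) : Fin n :=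
  (fiberIso f i v).1

/-- A finite set is the disjoint union of the fibres of a map out of it. -/
def fiberSigma (f : Fin n → Fin k) : (Σ i, Fin (fiberCard f i)) ≃ Fin n :=
  (Equiv.sigmaCongrRight fun i => (fiberIso f i).toEquiv).trans (Equiv.sigmaFiberEquiv f)

/-- If `f' ∘ e = t ∘ f` for bijections `e` and `t`, then `e` restricts to a bijection from
`f⁻¹(i)` to `f'⁻¹(t(i))`. -/
def fiberCongr (e : Fin n ≃ Fin n') (t : Fin k ≃ Fin k') (f : Fin n → Fin k)
    (f' : Fin n' → Fin k') (h : ∀ s, f' (e s) = t (f s)) (i : Fin k) :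
    Fin (fiberCard f i) ≃ Fin (fiberCard f' (t i)) :=
  ((fiberIso f i).toEquiv.trans
    (e.subtypeEquiv (p := fun s => f s = i) (q := fun s => f' s = t i) fun s => by
      rw [h, t.apply_eq_iff_eq])).trans (fiberIso f' (t i)).symm.toEquiv

/-- The restriction `(g ∘ f)⁻¹(u) → g⁻¹(u)` of `f`. -/
def fiberRestrict (f : Fin n → Fin k) (g : Fin k → Fin m) (u : Fin m) :
    Fin (fiberCard (g ∘ f) u) → Fin (fiberCard g u) :=
  fun s => (fiberIso g u).symm ⟨f (fiberEmb (g ∘ f) u s), (fiberIso (g ∘ f) u s).2⟩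

theorem fiberEmb_fiberRestrict (f : Fin n → Fin k) (g : Fin k → Fin m) (u : Fin m)
    (s : Fin (fiberCard (g ∘ f) u)) :
    fiberEmb g u (fiberRestrict f g u s) = f (fiberEmb (g ∘ f) u s) := by
  simp [fiberEmb, fiberRestrict]

theorem fiberEmb_injective (f : Fin n → Fin k) (i : Fin k) :
    Function.Injective (fiberEmb f i) := fun _ _ h =>
  (fiberIso f i).injective (Subtype.ext h)

/-- The fibre of `(g ∘ f)⁻¹(u) → g⁻¹(u)` over an element `t` of `g⁻¹(u)` is `f⁻¹(t)`. -/
theorem fiberCard_fiberRestrict (f : Fin n → Fin k) (g : Fin k → Fin m) (u : Fin m)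
    (v : Fin (fiberCard g u)) :
    fiberCard (fiberRestrict f g u) v = fiberCard f (fiberEmb g u v) := by
  refine Fintype.card_congr
    { toFun := fun s => ⟨fiberEmb (g ∘ f) u s.1, by
        have h := fiberEmb_fiberRestrict f g u s.1
        rw [s.2] at h
        exact h.symm⟩
      invFun := fun s => ⟨(fiberIso (g ∘ f) u).symm ⟨s.1, by
        rw [Function.comp_apply, s.2]; exact (fiberIso g u v).2⟩, by
          apply fiberEmb_injective g u
          rw [fiberEmb_fiberRestrict]
          simpa [fiberEmb] using s.2⟩
      left_inv := fun s => by
        apply Subtype.ext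
        apply fiberEmb_injective (g ∘ f) u
        simp [fiberEmb]
      right_inv := fun s => by
        apply Subtype.ext
        simp [fiberEmb] }

theorem fiberCard_id (i : Fin n) : fiberCard (id : Fin n → Fin n) i = 1 := by
  simp [fiberCard]

theorem fiberCard_const (n : ℕ) : fiberCard (fun _ : Fin n => (0 : Fin 1)) 0 = n := by
  simp [fiberCard]

end Fibres

/-! ### Tensor products of families with Koszul signs -/

noncomputable section Koszul

open DGModule

variable {n k m : ℕ}

/-- The sign `(-1)^{xy}`. -/
def ksgn (x y : ZMod 2) : ℚ := if x = 1 ∧ y = 1 then -1 else 1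

/-- The Koszul sign of permuting factors of parities `e` by `σ`: a factor `(-1)^{|xᵢ||xⱼ|}` for
every pair `i < j` such that `σ j < σ i`. -/
def permSign {n' : ℕ} (σ : Fin n ≃ Fin n') (e : Fin n → ZMod 2) : ℚ :=
  ∏ i, ∏ j, if i < j ∧ σ j < σ i then ksgn (e i) (e j) else 1

/-- The signed permutation of tensor factors: the factor in position `i` is moved to position
`σ i`, that is, `⨂ᵢ y (σ i) ↦ ± ⨂ⱼ y j`. -/
def permTensor {n' : ℕ} (M : Fin n' → DGModule.{u}) (σ : Fin n ≃ Fin n') :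
    (⨂[ℚ] i, M (σ i)) →ₗ[ℚ] ⨂[ℚ] j, M j :=
  (PiTensorProduct.reindex ℚ (fun j => (M j : Type u)) σ.symm).symm.toLinearMap ∘ₗ
    ∑ e : Fin n → ZMod 2, permSign σ e • PiTensorProduct.map fun i => (M (σ i)).par (e i)

/-- The canonical map `⨂ₜ yₜ ↦ ⨂ᵢ ⨂_{t ∈ g⁻¹(i)} yₜ`, without signs. -/
def splitTensor (g : Fin k → Fin m) (N : Fin k → DGModule.{v}) :
    (⨂[ℚ] t, N t) →ₗ[ℚ] ⨂[ℚ] i, ⨂[ℚ] t : Fin (fiberCard g i), N (fiberEmb g i t) :=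
  PiTensorProduct.lift (MultilinearMap.compMultilinearMap
      (PiTensorProduct.tprod ℚ (s := fun i : Fin m =>
        ⨂[ℚ] t : Fin (fiberCard g i), N (fiberEmb g i t)))
      (fun i => PiTensorProduct.tprod ℚ
        (s := fun t : Fin (fiberCard g i) => (N (fiberEmb g i t) : Type v)))) ∘ₗ
    (PiTensorProduct.reindex ℚ (fun t => (N t : Type v)) (fiberSigma g).symm).toLinearMap

/-- The canonical map `(⨂ᵢ xᵢ) ⊗ (⨂ₜ yₜ) ↦ ⨂ᵢ (xᵢ ⊗ ⨂_{t ∈ g⁻¹(i)} yₜ)`, without signs. -/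
def regroup (g : Fin k → Fin m) (M : Fin m → DGModule.{u}) (N : Fin k → DGModule.{v}) :
    ((⨂[ℚ] i, M i) ⊗[ℚ] (⨂[ℚ] t, N t)) →ₗ[ℚ]
      ⨂[ℚ] i, (M i ⊗[ℚ] (⨂[ℚ] t : Fin (fiberCard g i), N (fiberEmb g i t))) :=
  TensorProduct.lift (PiTensorProduct.map₂ fun i => TensorProduct.mk ℚ (M i)
      (⨂[ℚ] t : Fin (fiberCard g i), N (fiberEmb g i t))) ∘ₗ
    LinearMap.lTensor _ (splitTensor g N)

/-- The Koszul sign of the regrouping: a factor `(-1)^{|yₛ||yₜ|}` for every pair `s < t` with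
`g t < g s`, and a factor `(-1)^{|xᵢ||yₛ|}` for every pair with `g s < i`. -/
def regroupSign (g : Fin k → Fin m) (x : Fin m → ZMod 2) (y : Fin k → ZMod 2) : ℚ :=
  (∏ s, ∏ t, if s < t ∧ g t < g s then ksgn (y s) (y t) else 1) *
    ∏ i, ∏ s, if g s < i then ksgn (x i) (y s) else 1

/-- The signed regrouping `(⨂ᵢ xᵢ) ⊗ (⨂ₜ yₜ) ↦ ± ⨂ᵢ (xᵢ ⊗ ⨂_{t ∈ g⁻¹(i)} yₜ)`. -/
def koszulRegroup (g : Fin k → Fin m) (M : Fin m → DGModule.{u}) (N : Fin k → DGModule.{v}) :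
    ((⨂[ℚ] i, M i) ⊗[ℚ] (⨂[ℚ] t, N t)) →ₗ[ℚ]
      ⨂[ℚ] i, (M i ⊗[ℚ] (⨂[ℚ] t : Fin (fiberCard g i), N (fiberEmb g i t))) :=
  regroup g M N ∘ₗ ∑ x : Fin m → ZMod 2, ∑ y : Fin k → ZMod 2, regroupSign g x y •
    TensorProduct.map (PiTensorProduct.map fun i => (M i).par (x i))
      (PiTensorProduct.map fun t => (N t).par (y t))

/-- The derivation extension `∑ᵢ ε ⊗ ⋯ ⊗ ε ⊗ φ ⊗ 1 ⊗ ⋯ ⊗ 1` of a family of maps `φᵢ` of odd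
degree, where `ε x = (-1)^|x| x`. -/
def tensorDer {k : ℕ} {V : Fin k → Type v} [∀ i, AddCommMonoid (V i)] [∀ i, Module ℚ (V i)]
    (ε φ : ∀ i, V i →ₗ[ℚ] V i) : (⨂[ℚ] i, V i) →ₗ[ℚ] ⨂[ℚ] i, V i :=
  ∑ i, PiTensorProduct.map fun j => if j < i then ε j else if j = i then φ j else LinearMap.id

/-- The differential of `V ⊗ M₁ ⊗ ⋯ ⊗ Mₙ`. -/
def tensorD (V : DGModule.{u}) (M : Fin n → DGModule.{v}) :
    (V ⊗[ℚ] (⨂[ℚ] i, M i)) →ₗ[ℚ] V ⊗[ℚ] (⨂[ℚ] i, M i) :=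
  TensorProduct.map V.d LinearMap.id +
    TensorProduct.map V.eps (tensorDer (fun i => (M i).eps) fun i => (M i).d)

/-- The part of degree `i` of `V ⊗ M₁ ⊗ ⋯ ⊗ Mₙ`. -/
def tensorDeg (V : DGModule.{u}) (M : Fin n → DGModule.{v}) (i : ℤ) :
    Submodule ℚ (V ⊗[ℚ] (⨂[ℚ] j, M j)) :=
  Submodule.span ℚ {z | ∃ (p : ℤ) (q : Fin n → ℤ) (c : V) (x : ∀ j, M j), c ∈ V.deg p ∧
    (∀ j, x j ∈ (M j).deg (q j)) ∧ p + ∑ j, q j = i ∧ z = c ⊗ₜ PiTensorProduct.tprod ℚ x}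

end Koszul

/-- A symmetric dg cooperad. The underlying symmetric sequence is a functor on the groupoid of
standard finite sets and bijections, i.e. a chain complex `C(n)` with an action of `Σₙ` for every
`n`. The decomposition maps are indexed by maps `f : {1,…,n} → {1,…,k}`. -/
structure DGCooperad : Type (u + 1) where
  /-- The chain complexes `C(n)`. -/
  obj : ℕ → DGModule.{u}
  /-- The (left) action of bijections; `map σ` for `σ : Equiv.Perm (Fin n)` is the action of
  `Σₙ` on `C(n)`. -/
  map : ∀ {n m : ℕ}, (Fin n ≃ Fin m) → (obj n →ₗ[ℚ] obj m)
  map_refl : ∀ (n : ℕ) (c : obj n), map (Equiv.refl (Fin n)) c = c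
  map_trans : ∀ {n m l : ℕ} (σ : Fin n ≃ Fin m) (τ : Fin m ≃ Fin l) (c : obj n),
    map (σ.trans τ) c = map τ (map σ c)
  map_deg : ∀ {n m : ℕ} (σ : Fin n ≃ Fin m) (i : ℤ) (c : obj n),
    c ∈ (obj n).deg i → map σ c ∈ (obj m).deg i
  map_d : ∀ {n m : ℕ} (σ : Fin n ≃ Fin m) (c : obj n), map σ ((obj n).d c) = (obj m).d (map σ c)
  /-- The decomposition maps `C(n) → C(k) ⊗ C(f⁻¹(1)) ⊗ ⋯ ⊗ C(f⁻¹(k))`. -/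
  decomp : ∀ {n k : ℕ} (f : Fin n → Fin k),
    obj n →ₗ[ℚ] obj k ⊗[ℚ] (⨂[ℚ] i, obj (fiberCard f i))
  decomp_deg : ∀ {n k : ℕ} (f : Fin n → Fin k) (i : ℤ) (c : obj n),
    c ∈ (obj n).deg i → decomp f c ∈ tensorDeg (obj k) (fun j => obj (fiberCard f j)) i
  decomp_d : ∀ {n k : ℕ} (f : Fin n → Fin k) (c : obj n),
    decomp f ((obj n).d c) = tensorD (obj k) (fun j => obj (fiberCard f j)) (decomp f c)
  /-- Equivariance of the decomposition maps. -/
  decomp_map : ∀ {n n' k k' : ℕ} (e : Fin n ≃ Fin n') (t : Fin k ≃ Fin k') (f : Fin n → Fin k)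
    (f' : Fin n' → Fin k') (h : ∀ s, f' (e s) = t (f s)) (c : obj n),
    decomp f' (map e c) =
      TensorProduct.map (map t)
        (permTensor (fun j => obj (fiberCard f' j)) t ∘ₗ
          PiTensorProduct.map fun i => map (fiberCongr e t f f' h i))
        (decomp f c)
  /-- Coassociativity: decomposing along `g ∘ f` and then decomposing each `C((g ∘ f)⁻¹(u))`
  along `(g ∘ f)⁻¹(u) → g⁻¹(u)` is the same as decomposing along `f` and then decomposing `C(k)`
  along `g`. -/
  coassoc : ∀ {n k m : ℕ} (f : Fin n → Fin k) (g : Fin k → Fin m) (c : obj n),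
    LinearMap.lTensor (obj m)
        (PiTensorProduct.map fun u => LinearMap.lTensor (obj (fiberCard g u))
            (PiTensorProduct.map fun v => map (finCongr (fiberCard_fiberRestrict f g u v))) ∘ₗ
          decomp (fiberRestrict f g u))
        (decomp (g ∘ f) c) =
      LinearMap.lTensor (obj m)
        (koszulRegroup g (fun u => obj (fiberCard g u)) fun t => obj (fiberCard f t))
        (TensorProduct.assoc ℚ _ _ _ (LinearMap.rTensor _ (decomp g) (decomp f c)))
  /-- The counit. -/
  counit : obj 1 →ₗ[ℚ] ℚ
  counit_deg : ∀ (i : ℤ) (c : obj 1), i ≠ 0 → c ∈ (obj 1).deg i → counit c = 0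
  counit_d : ∀ c : obj 1, counit ((obj 1).d c) = 0
  counit_left : ∀ (n : ℕ) (c : obj n),
    map (finCongr (fiberCard_const n))
      (PiTensorProduct.subsingletonEquiv (R := ℚ) (0 : Fin 1)
        (TensorProduct.lid ℚ _
          (LinearMap.rTensor _ counit (decomp (fun _ : Fin n => (0 : Fin 1)) c)))) = c
  counit_right : ∀ (n : ℕ) (c : obj n),
    TensorProduct.rid ℚ _
      (LinearMap.lTensor (obj n)
        (PiTensorProduct.lift ((MultilinearMap.mkPiAlgebra ℚ (Fin n) ℚ).compLinearMap
          fun i => counit ∘ₗ map (finCongr (fiberCard_id i))))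
        (decomp (id : Fin n → Fin n) c)) = c

/-! ### Auxiliary facts on Koszul signs -/

section KoszulFacts

open DGModule

variable {n k m : ℕ}

theorem ksgn_comm (x y : ZMod 2) : ksgn x y = ksgn y x := by
  simp only [ksgn, and_comm]

theorem ksgn_add_one_left (x y : ZMod 2) : ksgn (x + 1) y = ksgn x y * ksgn 1 y := by
  have h : ∀ x y : ZMod 2, (y = 1 ∧ x = 1 ∧ x + 1 ≠ 1) ∨ (y = 1 ∧ x ≠ 1 ∧ x + 1 = 1) ∨ y ≠ 1 := by
    decide
  rcases h x y with ⟨h1, h2, h3⟩ | ⟨h1, h2, h3⟩ | h1 <;> simp_all [ksgn]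

theorem ksgn_mul_self (x y : ZMod 2) : ksgn x y * ksgn x y = 1 := by
  unfold ksgn; split_ifs <;> norm_num

theorem eps_eq_smul (M : DGModule.{u}) {e : ZMod 2} {x : M} (hx : M.par e x = x) :
    M.eps x = ksgn 1 e • x := by
  have h : ∀ e : ZMod 2, e = 0 ∨ e = 1 := by decide
  have h01 : (0 : ZMod 2) ≠ 1 := by decide
  rw [← hx]
  rcases h e with rfl | rfl
  · simp [eps, par_par, ksgn]
  · simp [eps, par_par, ksgn]

theorem piTensor_ext_par {M : Fin n → DGModule.{u}} {W : Type*} [AddCommMonoid W] [Module ℚ W]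
    {φ ψ : (⨂[ℚ] i, M i) →ₗ[ℚ] W}
    (h : ∀ (e : Fin n → ZMod 2) (x : ∀ i, M i), (∀ i, (M i).par (e i) (x i) = x i) →
      φ (PiTensorProduct.tprod ℚ x) = ψ (PiTensorProduct.tprod ℚ x)) : φ = ψ := by
  apply PiTensorProduct.ext
  ext x
  have hx : x = fun i => ∑ e : ZMod 2, (M i).par e (x i) := by
    funext i; exact ((M i).sum_par (x i)).symm
  rw [hx, MultilinearMap.map_sum, MultilinearMap.map_sum]
  refine Finset.sum_congr rfl fun e _ => ?_
  exact h e _ fun i => by rw [par_par, if_pos rfl]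

theorem map_par_tprod {M : Fin n → DGModule.{u}} (e : Fin n → ZMod 2) (x : ∀ i, M i)
    (hx : ∀ i, (M i).par (e i) (x i) = x i) (e' : Fin n → ZMod 2) :
    PiTensorProduct.map (fun i => (M i).par (e' i)) (PiTensorProduct.tprod ℚ x) =
      if e' = e then PiTensorProduct.tprod ℚ x else 0 := by
  rw [PiTensorProduct.map_tprod]
  split_ifs with h
  · subst h; congr 1; funext i; exact hx i
  · obtain ⟨i, hi⟩ := Function.ne_iff.mp h
    apply MultilinearMap.map_coord_zero _ i
    rw [← hx i, par_par, if_neg hi]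

theorem permTensor_tprod {n' : ℕ} (M : Fin n' → DGModule.{u}) (σ : Fin n ≃ Fin n')
    (f : Fin n' → ZMod 2) (y : ∀ j, M j) (hy : ∀ j, (M j).par (f j) (y j) = y j) :
    permTensor M σ (PiTensorProduct.tprod ℚ fun i => y (σ i)) =
      permSign σ (fun i => f (σ i)) • PiTensorProduct.tprod ℚ y := by
  have key : (PiTensorProduct.reindex ℚ (fun j => (M j : Type u)) σ.symm)
      (PiTensorProduct.tprod ℚ y) = PiTensorProduct.tprod ℚ fun i => y (σ i) :=
    PiTensorProduct.reindex_tprod _ _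
  simp only [permTensor, LinearMap.comp_apply, LinearMap.sum_apply, LinearMap.smul_apply]
  rw [Finset.sum_eq_single (fun i => f (σ i))]
  · rw [map_par_tprod (M := fun i => M (σ i)) (fun i => f (σ i)) (fun i => y (σ i))
      (fun i => hy (σ i)), if_pos rfl, map_smul]
    congr 1
    rw [LinearEquiv.coe_coe, LinearEquiv.symm_apply_eq]
    exact key.symm
  · intro e _ he
    rw [map_par_tprod (M := fun i => M (σ i)) (fun i => f (σ i)) (fun i => y (σ i))
      (fun i => hy (σ i)), if_neg he, smul_zero]
  · simp

theorem permSign_refl (e : Fin n → ZMod 2) : permSign (Equiv.refl (Fin n)) e = 1 := by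
  unfold permSign
  refine Finset.prod_eq_one fun i _ => Finset.prod_eq_one fun j _ => if_neg ?_
  simp only [Equiv.refl_apply, not_and, not_lt]
  exact le_of_lt

theorem permTensor_refl (M : Fin n → DGModule.{u}) :
    permTensor M (Equiv.refl (Fin n)) = LinearMap.id := by
  apply piTensor_ext_par (M := M)
  intro e x hx
  have := permTensor_tprod M (Equiv.refl (Fin n)) e x hx
  rw [permSign_refl, one_smul] at this
  exact this

theorem splitTensor_tprod (g : Fin k → Fin m) (N : Fin k → DGModule.{v}) (y : ∀ t, N t) :
    splitTensor g N (PiTensorProduct.tprod ℚ y) =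
      PiTensorProduct.tprod ℚ fun i => PiTensorProduct.tprod ℚ fun t => y (fiberEmb g i t) := by
  have key : (PiTensorProduct.reindex ℚ (fun t => (N t : Type v)) (fiberSigma g).symm)
      (PiTensorProduct.tprod ℚ y) = PiTensorProduct.tprod ℚ fun p => y (fiberSigma g p) :=
    PiTensorProduct.reindex_tprod _ _
  refine (congrArg (PiTensorProduct.lift _) key).trans ?_
  exact PiTensorProduct.lift.tprod _

theorem regroup_tprod (g : Fin k → Fin m) (M : Fin m → DGModule.{u}) (N : Fin k → DGModule.{v})
    (x : ∀ i, M i) (y : ∀ t, N t) :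
    regroup g M N (PiTensorProduct.tprod ℚ x ⊗ₜ PiTensorProduct.tprod ℚ y) =
      PiTensorProduct.tprod ℚ fun i =>
        x i ⊗ₜ[ℚ] PiTensorProduct.tprod ℚ fun t => y (fiberEmb g i t) := by
  rw [regroup, LinearMap.comp_apply, LinearMap.lTensor_tmul, splitTensor_tprod,
    TensorProduct.lift.tmul, PiTensorProduct.map₂_tprod_tprod]
  rfl

theorem koszulRegroup_tprod (g : Fin k → Fin m) (M : Fin m → DGModule.{u}) (N : Fin k → DGModule.{v})
    (ξ : Fin m → ZMod 2) (η : Fin k → ZMod 2) (x : ∀ i, M i) (y : ∀ t, N t)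
    (hx : ∀ i, (M i).par (ξ i) (x i) = x i) (hy : ∀ t, (N t).par (η t) (y t) = y t) :
    koszulRegroup g M N (PiTensorProduct.tprod ℚ x ⊗ₜ PiTensorProduct.tprod ℚ y) =
      regroupSign g ξ η • PiTensorProduct.tprod ℚ fun i =>
        x i ⊗ₜ[ℚ] PiTensorProduct.tprod ℚ fun t => y (fiberEmb g i t) := by
  simp only [koszulRegroup, LinearMap.comp_apply, LinearMap.sum_apply, LinearMap.smul_apply,
    TensorProduct.map_tmul]
  rw [Finset.sum_eq_single ξ, Finset.sum_eq_single η]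
  · rw [map_par_tprod ξ x hx, if_pos rfl, map_par_tprod η y hy, if_pos rfl, map_smul,
      regroup_tprod]
  · intro e _ he
    rw [map_par_tprod η y hy, if_neg he, TensorProduct.tmul_zero, smul_zero]
  · simp
  · intro e _ he
    rw [map_par_tprod ξ x hx, if_neg he]
    simp
  · simp

theorem tensorDer_tprod (M : Fin n → DGModule.{u}) (e : Fin n → ZMod 2) (x : ∀ i, M i)
    (hx : ∀ i, (M i).par (e i) (x i) = x i) :
    tensorDer (fun i => (M i).eps) (fun i => (M i).d) (PiTensorProduct.tprod ℚ x) =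
      ∑ i, (∏ j, if j < i then ksgn 1 (e j) else 1) •
        PiTensorProduct.tprod ℚ (Function.update x i ((M i).d (x i))) := by
  simp only [tensorDer, LinearMap.sum_apply, PiTensorProduct.map_tprod]
  refine Finset.sum_congr rfl fun i _ => ?_
  rw [← MultilinearMap.map_smul_univ]
  congr 1
  funext j
  by_cases h1 : j < i
  · rw [if_pos h1, if_pos h1, eps_eq_smul _ (hx j), Function.update_of_ne h1.ne]
  · rw [if_neg h1, if_neg h1, one_smul]
    by_cases h2 : j = i
    · subst h2; simp
    · rw [if_neg h2, Function.update_of_ne h2]; rfl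

theorem permSign_update {n' : ℕ} (σ : Fin n ≃ Fin n') (e : Fin n → ZMod 2) (i : Fin n) :
    (∏ j, if j < i then ksgn 1 (e j) else 1) * permSign σ (Function.update e i (e i + 1)) =
      permSign σ e * ∏ j, if σ j < σ i then ksgn 1 (e j) else 1 := by
  have h1 : permSign σ (Function.update e i (e i + 1)) = permSign σ e *
      ((∏ b, if i < b ∧ σ b < σ i then ksgn 1 (e b) else 1) *
        ∏ a, if a < i ∧ σ i < σ a then ksgn 1 (e a) else 1) := by
    have e1 : (∏ b, if i < b ∧ σ b < σ i then ksgn 1 (e b) else 1) =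
        ∏ a, ∏ b, if a = i then (if i < b ∧ σ b < σ i then ksgn 1 (e b) else 1) else 1 := by
      symm
      rw [Finset.prod_eq_single i]
      · simp
      · intro a _ ha; simp [ha]
      · simp
    have e2 : (∏ a, if a < i ∧ σ i < σ a then ksgn 1 (e a) else 1) =
        ∏ a, ∏ b, if b = i then (if a < i ∧ σ i < σ a then ksgn 1 (e a) else 1) else 1 := by
      refine Finset.prod_congr rfl fun a _ => ?_
      rw [Finset.prod_eq_single i]
      · simp
      · intro b _ hb; simp [hb]
      · simp
    rw [e1, e2]
    unfold permSign
    rw [← Finset.prod_mul_distrib, ← Finset.prod_mul_distrib]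
    refine Finset.prod_congr rfl fun a _ => ?_
    rw [← Finset.prod_mul_distrib, ← Finset.prod_mul_distrib]
    refine Finset.prod_congr rfl fun b _ => ?_
    by_cases hab : a < b ∧ σ b < σ a
    · rw [if_pos hab, if_pos hab]
      by_cases ha : a = i
      · subst ha
        rw [if_pos rfl, if_pos hab, if_neg hab.1.ne', Function.update_self,
          Function.update_of_ne hab.1.ne', ksgn_add_one_left, mul_one]
      · rw [if_neg ha, Function.update_of_ne ha]
        by_cases hb : b = i
        · subst hb
          rw [if_pos rfl, if_pos hab, Function.update_self, ksgn_comm, ksgn_add_one_left,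
            ksgn_comm (e b), one_mul]
        · rw [if_neg hb, Function.update_of_ne hb, one_mul, mul_one]
    · rw [if_neg hab, if_neg hab, one_mul]
      by_cases ha : a = i
      · subst ha
        rw [if_pos rfl, if_neg hab]
        split_ifs with hb hc
        · exact absurd (hb ▸ hc.1) (lt_irrefl _)
        · simp
        · simp
      · rw [if_neg ha]
        by_cases hb : b = i
        · subst hb
          rw [if_pos rfl, if_neg hab, one_mul]
        · rw [if_neg hb, one_mul]
  rw [h1, mul_left_comm]
  congr 1
  rw [← Finset.prod_mul_distrib, ← Finset.prod_mul_distrib]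
  refine Finset.prod_congr rfl fun j _ => ?_
  rcases lt_trichotomy j i with h | h | h
  · have hne : σ j ≠ σ i := fun h' => h.ne (σ.injective h')
    rcases lt_or_gt_of_ne hne with h' | h'
    · simp [h, h', not_lt_of_gt h, not_lt_of_gt h']
    · simp [h, h', not_lt_of_gt h, not_lt_of_gt h', ksgn_mul_self]
  · subst h; simp
  · have hne : σ j ≠ σ i := fun h' => h.ne (σ.injective h').symm
    rcases lt_or_gt_of_ne hne with h' | h'
    · simp [h, h', not_lt_of_gt h, not_lt_of_gt h']
    · simp [h, h', not_lt_of_gt h, not_lt_of_gt h']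

theorem permTensor_tensorDer {n' : ℕ} (A : DGModule.{u}) (σ : Fin n ≃ Fin n') :
    permTensor (fun _ => A) σ ∘ₗ tensorDer (fun _ : Fin n => A.eps) (fun _ => A.d) =
      tensorDer (fun _ : Fin n' => A.eps) (fun _ => A.d) ∘ₗ permTensor (fun _ => A) σ := by
  apply piTensor_ext_par (M := fun _ : Fin n => A)
  intro e x hx
  obtain ⟨y, rfl⟩ : ∃ y : Fin n' → A, x = fun i => y (σ i) :=
    ⟨fun j => x (σ.symm j), by funext i; simp⟩
  obtain ⟨f, rfl⟩ : ∃ f : Fin n' → ZMod 2, e = fun i => f (σ i) :=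
    ⟨fun j => e (σ.symm j), by funext i; simp⟩
  have hy : ∀ j, A.par (f j) (y j) = y j := fun j => by
    have := hx (σ.symm j); simpa using this
  rw [LinearMap.comp_apply, LinearMap.comp_apply, permTensor_tprod (fun _ => A) σ f y hy,
    tensorDer_tprod (fun _ => A) _ _ hx, map_smul, tensorDer_tprod (fun _ => A) _ _ hy,
    map_sum, Finset.smul_sum, ← Equiv.sum_comp σ]
  refine Finset.sum_congr rfl fun i _ => ?_
  have hup : (Function.update (fun i => y (σ i)) i (A.d (y (σ i))) : Fin n → A) =
      fun j => Function.update y (σ i) (A.d (y (σ i))) (σ j) := by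
    funext j
    by_cases h : j = i
    · subst h; simp
    · rw [Function.update_of_ne h, Function.update_of_ne (fun h' => h (σ.injective h'))]
  have hup' : (fun j => Function.update f (σ i) (f (σ i) + 1) (σ j)) =
      Function.update (fun i => f (σ i)) i (f (σ i) + 1) := by
    funext j
    by_cases h : j = i
    · subst h; simp
    · rw [Function.update_of_ne h, Function.update_of_ne (fun h' => h (σ.injective h'))]
  have hp := permTensor_tprod (fun _ => A) σ (Function.update f (σ i) (f (σ i) + 1))
    (Function.update y (σ i) (A.d (y (σ i)))) (fun j => by
      by_cases h : j = σ i
      · subst h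
        rw [Function.update_self, Function.update_self, d_par, hy]
      · rw [Function.update_of_ne h, Function.update_of_ne h, hy])
  rw [map_smul, hup, hp, hup', smul_smul, smul_smul, permSign_update]
  congr 2
  exact Equiv.prod_comp σ fun j => if j < σ i then ksgn 1 (f j) else 1

theorem permTensor_map {n' : ℕ} (A : DGModule.{u}) (σ : Fin n ≃ Fin n') (φ : A →ₗ[ℚ] A)
    (hφ : ∀ e x, A.par e (φ x) = φ (A.par e x)) :
    permTensor (fun _ => A) σ ∘ₗ PiTensorProduct.map (fun _ : Fin n => φ) =
      PiTensorProduct.map (fun _ : Fin n' => φ) ∘ₗ permTensor (fun _ => A) σ := by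
  apply piTensor_ext_par (M := fun _ : Fin n => A)
  intro e x hx
  obtain ⟨y, rfl⟩ : ∃ y : Fin n' → A, x = fun i => y (σ i) :=
    ⟨fun j => x (σ.symm j), by funext i; simp⟩
  obtain ⟨f, rfl⟩ : ∃ f : Fin n' → ZMod 2, e = fun i => f (σ i) :=
    ⟨fun j => e (σ.symm j), by funext i; simp⟩
  have hy : ∀ j, A.par (f j) (y j) = y j := fun j => by
    have := hx (σ.symm j); simpa using this
  rw [LinearMap.comp_apply, LinearMap.comp_apply, permTensor_tprod (fun _ => A) σ f y hy,
    PiTensorProduct.map_tprod, map_smul, PiTensorProduct.map_tprod]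
  exact permTensor_tprod (fun _ => A) σ f (fun j => φ (y j)) fun j => by rw [hφ, hy]

theorem par_eps (A : DGModule.{u}) (e : ZMod 2) (x : A) : A.par e (A.eps x) = A.eps (A.par e x) := by
  have h : ∀ e : ZMod 2, e = 0 ∧ e ≠ 1 ∨ e ≠ 0 ∧ e = 1 := by decide
  simp only [eps, LinearMap.sub_apply, map_sub, par_par]
  rcases h e with ⟨h0, h1⟩ | ⟨h0, h1⟩ <;> simp [h0, h1]

/-- The signs in the regrouping of a permuted tensor. -/
theorem permSign_mul_regroupSign {n' : ℕ} (σ : Fin n ≃ Fin n') (f : Fin n → Fin k)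
    (f' : Fin n' → Fin k) (h : ∀ s, f' (σ s) = f s) (ξ : Fin k → ZMod 2) (η : Fin n' → ZMod 2) :
    permSign σ (fun s => η (σ s)) * regroupSign f' ξ η =
      regroupSign f ξ (fun s => η (σ s)) *
        ∏ i, permSign (fiberCongr σ (Equiv.refl _) f f' h i)
          (fun v => η (σ (fiberEmb f i v))) := by
  have hprod : (∏ i, permSign (fiberCongr σ (Equiv.refl _) f f' h i)
      (fun v => η (σ (fiberEmb f i v)))) =
      ∏ s, ∏ t, if f s = f t ∧ s < t ∧ σ t < σ s then ksgn (η (σ s)) (η (σ t)) else 1 := by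
    have hlt : ∀ (i : Fin k) (v w : Fin (fiberCard f i)),
        (fiberCongr σ (Equiv.refl _) f f' h i v < fiberCongr σ (Equiv.refl _) f f' h i w) ↔
          σ (fiberEmb f i v) < σ (fiberEmb f i w) := by
      intro i v w
      simp only [fiberCongr, Equiv.trans_apply, RelIso.coe_fn_toEquiv, OrderIso.lt_iff_lt]
      rfl
    have hlt' : ∀ (i : Fin k) (v w : Fin (fiberCard f i)),
        v < w ↔ fiberEmb f i v < fiberEmb f i w := by
      intro i v w
      rw [← (fiberIso f i).lt_iff_lt]; rfl
    have hf : ∀ (i : Fin k) (v : Fin (fiberCard f i)), f (fiberEmb f i v) = i :=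
      fun i v => (fiberIso f i v).2
    have key : ∀ F : Fin n → ℚ, ∏ s, F s = ∏ i, ∏ v, F (fiberEmb f i v) := by
      intro F
      rw [← Equiv.prod_comp (fiberSigma f), Fintype.prod_sigma]
      rfl
    rw [key]
    refine Finset.prod_congr rfl fun i _ => ?_
    unfold permSign
    refine Finset.prod_congr rfl fun v _ => ?_
    rw [key, Finset.prod_eq_single i]
    · refine Finset.prod_congr rfl fun w _ => ?_
      simp only [hlt, hlt', hf, true_and]
    · intro j _ hj
      refine Finset.prod_eq_one fun w _ => if_neg ?_
      rw [hf, hf]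
      exact fun h => hj h.1.symm
    · simp
  rw [hprod]
  unfold regroupSign permSign
  have e1 : ∀ G : Fin n' → Fin n' → ℚ, (∏ s, ∏ t, G s t) = ∏ s, ∏ t, G (σ s) (σ t) := by
    intro G
    rw [← Equiv.prod_comp σ]
    exact Finset.prod_congr rfl fun s _ => (Equiv.prod_comp σ _).symm
  have e2 : (∏ i, ∏ s, if f' s < i then ksgn (ξ i) (η s) else 1) =
      ∏ i, ∏ s, if f s < i then ksgn (ξ i) (η (σ s)) else 1 := by
    refine Finset.prod_congr rfl fun i _ => ?_
    rw [← Equiv.prod_comp σ]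
    simp only [h]
  rw [e1 fun s t => if s < t ∧ f' t < f' s then ksgn (η s) (η t) else 1, e2, ← mul_assoc]
  conv_rhs => rw [mul_right_comm]
  congr 1
  simp only [h]
  -- compare the contributions of the unordered pairs
  have sym : ∀ G : Fin n → Fin n → ℚ, (∏ s, ∏ t, if s < t then G t s else 1) =
      ∏ s, ∏ t, if t < s then G s t else 1 := by
    intro G
    rw [Finset.prod_comm]
  have split : (∏ s, ∏ t, if σ s < σ t ∧ f t < f s then ksgn (η (σ s)) (η (σ t)) else 1) =
      ∏ s, ∏ t, if s < t then
        (if σ s < σ t ∧ f t < f s then ksgn (η (σ s)) (η (σ t)) else 1) *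
          (if σ t < σ s ∧ f s < f t then ksgn (η (σ t)) (η (σ s)) else 1) else 1 := by
    have : ∀ s t : Fin n, (if s < t then
        (if σ s < σ t ∧ f t < f s then ksgn (η (σ s)) (η (σ t)) else 1) *
          (if σ t < σ s ∧ f s < f t then ksgn (η (σ t)) (η (σ s)) else 1) else 1) =
        (if s < t then
          (if σ s < σ t ∧ f t < f s then ksgn (η (σ s)) (η (σ t)) else 1) else 1) *
        (if s < t then
          (if σ t < σ s ∧ f s < f t then ksgn (η (σ t)) (η (σ s)) else 1) else 1) := by
      intro s t; split_ifs <;> simp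
    simp only [this, Finset.prod_mul_distrib]
    rw [sym fun s t => if σ s < σ t ∧ f t < f s then ksgn (η (σ s)) (η (σ t)) else 1,
      ← Finset.prod_mul_distrib]
    refine Finset.prod_congr rfl fun s _ => ?_
    rw [← Finset.prod_mul_distrib]
    refine Finset.prod_congr rfl fun t _ => ?_
    rcases lt_trichotomy s t with h | h | h
    · simp [h, not_lt_of_gt h]
    · subst h; simp
    · simp [h, not_lt_of_gt h]
  rw [split, ← Finset.prod_mul_distrib, ← Finset.prod_mul_distrib]
  refine Finset.prod_congr rfl fun s _ => ?_
  rw [← Finset.prod_mul_distrib, ← Finset.prod_mul_distrib]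
  refine Finset.prod_congr rfl fun t _ => ?_
  by_cases hst : s < t
  · have hne : σ s ≠ σ t := fun h' => hst.ne (σ.injective h')
    rw [ksgn_comm (η (σ t)) (η (σ s))]
    have hk := ksgn_mul_self (η (σ s)) (η (σ t))
    rcases lt_or_gt_of_ne hne with h1 | h1 <;> rcases lt_trichotomy (f s) (f t) with h2 | h2 | h2
    · simp [hst, h1, not_lt_of_gt h1, not_lt_of_gt h2]
    · simp [hst, h1, h2, not_lt_of_gt h1]
    · simp [hst, h1, h2, not_lt_of_gt h1]
    · simp [hst, h1, h2, not_lt_of_gt h1, not_lt_of_gt h2, hk, h2.ne]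
    · simp [hst, h1, h2, not_lt_of_gt h1]
    · simp [hst, h1, h2, not_lt_of_gt h1, not_lt_of_gt h2, h2.ne']
  · simp [hst]

end KoszulFacts

/-! ### The cofree coalgebra -/

namespace DGCooperad

noncomputable section

variable (C : DGCooperad.{u}) (A : DGModule.{v})

/-- `C(n) ⊗ A^{⊗n}`. -/
abbrev Pre (n : ℕ) : Type (max u v) := C.obj n ⊗[ℚ] (⨂[ℚ] _i : Fin n, A)

/-- The diagonal action of a bijection `σ`, `C(n) ⊗ A^{⊗n} → C(m) ⊗ A^{⊗m}` (where `n = m`). -/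
def act {n m : ℕ} (σ : Fin n ≃ Fin m) : C.Pre A n →ₗ[ℚ] C.Pre A m :=
  TensorProduct.map (C.map σ) (permTensor (fun _ => A) σ)

/-- The subspace of `C(n) ⊗ A^{⊗n}` spanned by all `σ · x - x`. -/
def coinvKer (n : ℕ) : Submodule ℚ (C.Pre A n) :=
  Submodule.span ℚ
    (Set.range fun p : Equiv.Perm (Fin n) × C.Pre A n => C.act A p.1 p.2 - p.2)

/-- `C(n) ⊗_{Σₙ} A^{⊗n}`. -/
abbrev Coinv (n : ℕ) : Type (max u v) := C.Pre A n ⧸ C.coinvKer A n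

/-- The graded vector space `C(A) = ⨁ₙ C(n) ⊗_{Σₙ} A^{⊗n}` underlying the cofree conilpotent
`C`-coalgebra on `A`. -/
abbrev Cofree : Type (max u v) := DirectSum ℕ fun n => C.Coinv A n

/-- The canonical map `C(n) ⊗ A^{⊗n} → C(A)`. -/
def toCofree (n : ℕ) : C.Pre A n →ₗ[ℚ] C.Cofree A :=
  DirectSum.lof ℚ ℕ (fun n => C.Coinv A n) n ∘ₗ (C.coinvKer A n).mkQ

theorem toCofree_act {n m : ℕ} (σ : Fin n ≃ Fin m) (x : C.Pre A n) :
    C.toCofree A m (C.act A σ x) = C.toCofree A n x := by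
  obtain rfl : n = m := by simpa using Fintype.card_congr σ
  rw [toCofree, LinearMap.comp_apply, LinearMap.comp_apply]
  congr 1
  rw [Submodule.mkQ_apply, Submodule.mkQ_apply, Submodule.Quotient.eq]
  exact Submodule.subset_span ⟨(σ, x), rfl⟩

/-- An equivariant map descends to coinvariants. -/
theorem coinvKer_le_comap {n : ℕ} (φ : C.Pre A n →ₗ[ℚ] C.Pre A n)
    (h : ∀ σ : Equiv.Perm (Fin n), φ ∘ₗ C.act A σ = C.act A σ ∘ₗ φ) :
    C.coinvKer A n ≤ (C.coinvKer A n).comap φ := by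
  rw [coinvKer, Submodule.span_le]
  rintro _ ⟨⟨σ, x⟩, rfl⟩
  refine Submodule.subset_span ⟨(σ, φ x), ?_⟩
  have := LinearMap.congr_fun (h σ) x
  simp only [LinearMap.comp_apply] at this
  simp only [map_sub, this]

theorem map_eps {n m : ℕ} (σ : Fin n ≃ Fin m) (c : C.obj n) :
    (C.obj m).eps (C.map σ c) = C.map σ ((C.obj n).eps c) := by
  simp only [DGModule.eps, LinearMap.sub_apply, map_sub,
    DGModule.par_hom (C.map σ) (C.map_deg σ)]

theorem act_tensorD (n : ℕ) (σ : Equiv.Perm (Fin n)) :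
    tensorD (C.obj n) (fun _ => A) ∘ₗ C.act A σ = C.act A σ ∘ₗ tensorD (C.obj n) fun _ => A := by
  have h := permTensor_tensorDer A σ
  ext c a
  have h' := LinearMap.congr_fun h (PiTensorProduct.tprod ℚ a)
  simp only [LinearMap.comp_apply] at h'
  simp [act, tensorD, TensorProduct.map_tmul, map_eps, C.map_d, h']

/-- The internal differential `d` of `C(A)`, induced by those of `C` and `A`. -/
def cofreeD : C.Cofree A →ₗ[ℚ] C.Cofree A :=
  DirectSum.lmap fun n => (C.coinvKer A n).mapQ (C.coinvKer A n)
    (tensorD (C.obj n) fun _ => A) (C.coinvKer_le_comap A _ (C.act_tensorD A n))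

theorem act_eps (n : ℕ) (σ : Equiv.Perm (Fin n)) :
    TensorProduct.map (C.obj n).eps (PiTensorProduct.map fun _ : Fin n => A.eps) ∘ₗ C.act A σ =
      C.act A σ ∘ₗ
        TensorProduct.map (C.obj n).eps (PiTensorProduct.map fun _ : Fin n => A.eps) := by
  have h := permTensor_map A σ A.eps (par_eps A)
  ext c a
  have h' := LinearMap.congr_fun h (PiTensorProduct.tprod ℚ a)
  simp only [LinearMap.comp_apply] at h'
  simp only [act, LinearMap.comp_apply, TensorProduct.AlgebraTensorModule.curry_apply,
    TensorProduct.curry_apply, LinearMap.restrictScalars_self, LinearMap.compMultilinearMap_apply,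
    TensorProduct.map_tmul, map_eps, h']

/-- The grading involution `x ↦ (-1)^|x| x` of `C(A)`. -/
def cofreeEps : C.Cofree A →ₗ[ℚ] C.Cofree A :=
  DirectSum.lmap fun n => (C.coinvKer A n).mapQ (C.coinvKer A n)
    (TensorProduct.map (C.obj n).eps (PiTensorProduct.map fun _ : Fin n => A.eps))
    (C.coinvKer_le_comap A _ (C.act_eps A n))

/-- The homogeneous part of degree `i` of `C(A)`. -/
def cofreeDeg (i : ℤ) : Submodule ℚ (C.Cofree A) :=
  ⨆ n, (tensorDeg (C.obj n) (fun _ : Fin n => A) i).map (C.toCofree A n)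

/-- The component in `C(k) ⊗ C(A)^{⊗k}` of the structure map of `C(A)`, before passing to
coinvariants: the sum over all `f : {1,…,n} → {1,…,k}` of
`C(n) ⊗ A^{⊗n} → C(k) ⊗ ⨂ᵢ C(f⁻¹(i)) ⊗ A^{⊗n} → C(k) ⊗ ⨂ᵢ (C(f⁻¹(i)) ⊗ A^{⊗f⁻¹(i)})`. -/
def preCoaction (n k : ℕ) :
    C.Pre A n →ₗ[ℚ] C.obj k ⊗[ℚ] (⨂[ℚ] _i : Fin k, C.Cofree A) :=
  ∑ f : Fin n → Fin k,
    LinearMap.lTensor (C.obj k)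
        (PiTensorProduct.map (fun i => C.toCofree A (fiberCard f i)) ∘ₗ
          koszulRegroup f (fun i => C.obj (fiberCard f i)) fun _ => A) ∘ₗ
      (TensorProduct.assoc ℚ _ _ _).toLinearMap ∘ₗ LinearMap.rTensor _ (C.decomp f)

theorem preCoaction_act (n k : ℕ) (σ : Equiv.Perm (Fin n)) :
    C.preCoaction A n k ∘ₗ C.act A σ = C.preCoaction A n k := by
  suffices H : ∀ (c : C.obj n) (e : Fin n → ZMod 2) (x : Fin n → A),
      (∀ i, A.par (e i) (x i) = x i) →
      C.preCoaction A n k (C.act A σ (c ⊗ₜ PiTensorProduct.tprod ℚ x)) =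
        C.preCoaction A n k (c ⊗ₜ PiTensorProduct.tprod ℚ x) by
    apply TensorProduct.ext
    refine LinearMap.ext fun c => ?_
    exact piTensor_ext_par (M := fun _ : Fin n => A) fun e x hx => H c e x hx
  intro c e x hx
  obtain ⟨y, rfl⟩ : ∃ y : Fin n → A, x = fun i => y (σ i) :=
    ⟨fun j => x (σ.symm j), by funext i; simp⟩
  obtain ⟨η, rfl⟩ : ∃ f : Fin n → ZMod 2, e = fun i => f (σ i) :=
    ⟨fun j => e (σ.symm j), by funext i; simp⟩
  have hy : ∀ j, A.par (η j) (y j) = y j := fun j => by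
    have := hx (σ.symm j); simpa using this
  rw [act, TensorProduct.map_tmul, permTensor_tprod (fun _ => A) σ η y hy,
    TensorProduct.tmul_smul, map_smul, preCoaction, LinearMap.sum_apply, LinearMap.sum_apply,
    Finset.smul_sum]
  symm
  refine Fintype.sum_equiv (σ.arrowCongr (Equiv.refl (Fin k))) _ _ fun f => ?_
  set f' : Fin n → Fin k := σ.arrowCongr (Equiv.refl (Fin k)) f with hf'
  have h : ∀ s, f' (σ s) = (Equiv.refl (Fin k)) (f s) := fun s => by simp [hf']
  obtain ⟨E, hE⟩ : ∃ E : ∀ i, Fin (fiberCard f i) ≃ Fin (fiberCard f' i),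
      E = fiberCongr σ (Equiv.refl _) f f' h := ⟨_, rfl⟩
  have hemb : ∀ i v, σ (fiberEmb f i v) = fiberEmb f' i (E i v) := by
    intro i v
    rw [hE]
    exact (congrArg Subtype.val ((fiberIso f' i).apply_symm_apply
      ⟨σ (fiberEmb f i v), (h _).trans (fiberIso f i v).2⟩)).symm
  have hsgn : ∀ ξ, permSign σ (fun s => η (σ s)) * regroupSign f' ξ η = regroupSign f ξ (fun s => η (σ s)) *
      ∏ i, permSign (E i) (fun v => η (σ (fiberEmb f i v))) := fun ξ => by
    rw [hE]; exact permSign_mul_regroupSign σ f f' h ξ η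
  have hdec : C.decomp f' (C.map σ c) = LinearMap.lTensor (C.obj k)
      (PiTensorProduct.map fun i => C.map (E i)) (C.decomp f c) := by
    rw [C.decomp_map σ (Equiv.refl _) f f' h c]
    have h1 : C.map (Equiv.refl (Fin k)) = LinearMap.id := LinearMap.ext (C.map_refl k)
    have h2 := permTensor_refl fun j => C.obj (fiberCard f' j)
    rw [h1, hE]
    refine congrArg (fun φ => TensorProduct.map LinearMap.id φ (C.decomp f c)) ?_
    exact (congrArg (fun ψ => ψ ∘ₗ PiTensorProduct.map fun i =>
      C.map (fiberCongr σ (Equiv.refl _) f f' h i)) h2).trans (LinearMap.id_comp _)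
  clear hE
  simp only [LinearMap.comp_apply, LinearMap.rTensor_tmul, hdec]
  generalize C.decomp f c = z
  -- compare the two sides as linear maps in `z`
  let L₁ : (C.obj k ⊗[ℚ] (⨂[ℚ] i, C.obj (fiberCard f i))) →ₗ[ℚ]
      C.obj k ⊗[ℚ] (⨂[ℚ] _i : Fin k, C.Cofree A) :=
    LinearMap.lTensor (C.obj k)
      ((PiTensorProduct.map (fun i => C.toCofree A (fiberCard f i)) ∘ₗ
        koszulRegroup f (fun i => C.obj (fiberCard f i)) fun _ => A) ∘ₗ
        (TensorProduct.mk ℚ _ _).flip (PiTensorProduct.tprod ℚ fun i => y (σ i)))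
  let L₂ : (C.obj k ⊗[ℚ] (⨂[ℚ] i, C.obj (fiberCard f i))) →ₗ[ℚ]
      C.obj k ⊗[ℚ] (⨂[ℚ] _i : Fin k, C.Cofree A) :=
    LinearMap.lTensor (C.obj k)
      ((permSign σ fun i => η (σ i)) •
        (((PiTensorProduct.map (fun i => C.toCofree A (fiberCard f' i)) ∘ₗ
        koszulRegroup f' (fun i => C.obj (fiberCard f' i)) fun _ => A) ∘ₗ
        (TensorProduct.mk ℚ _ _).flip (PiTensorProduct.tprod ℚ y)) ∘ₗ
        (PiTensorProduct.map fun i => C.map (E i))))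
  have hL : L₁ = L₂ := by
    refine congrArg (LinearMap.lTensor (C.obj k)) ?_
    apply piTensor_ext_par (M := fun i => C.obj (fiberCard f i))
    intro ξ c' hc'
    simp only [LinearMap.comp_apply, LinearMap.smul_apply, LinearMap.flip_apply,
      TensorProduct.mk_apply, PiTensorProduct.map_tprod]
    rw [koszulRegroup_tprod f (fun i => C.obj (fiberCard f i)) (fun _ => A) ξ
        (fun i => η (σ i)) c' (fun i => y (σ i)) hc' hx]
    have hreg := koszulRegroup_tprod f' (fun i => C.obj (fiberCard f' i)) (fun _ => A) ξ η
      (fun i => C.map (E i) (c' i)) y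
      (fun i => by
        exact (DGModule.par_hom (C.map (E i))
          (C.map_deg _) (ξ i) (c' i)).trans (congrArg _ (hc' i))) hy
    refine Eq.trans ?_ (congrArg (fun w => (permSign σ fun i => η (σ i)) •
      PiTensorProduct.map (fun i => C.toCofree A (fiberCard f' i)) w) hreg).symm
    rw [map_smul, map_smul, smul_smul, PiTensorProduct.map_tprod, PiTensorProduct.map_tprod,
      hsgn, mul_smul, ← MultilinearMap.map_smul_univ]
    congr 2
    funext i
    rw [← C.toCofree_act A (E i), act, TensorProduct.map_tmul]
    have hp := permTensor_tprod (fun _ => A) (E i)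
      (fun v => η (fiberEmb f' i v)) (fun v => y (fiberEmb f' i v)) (fun v => hy _)
    simp only [hemb]
    erw [hp]
    rw [TensorProduct.tmul_smul, map_smul]
  have e₁ : ∀ z, L₁ z = (LinearMap.lTensor (C.obj k)
        (PiTensorProduct.map (fun i => C.toCofree A (fiberCard f i)) ∘ₗ
          koszulRegroup f (fun i => C.obj (fiberCard f i)) fun _ => A))
      ((TensorProduct.assoc ℚ _ _ _) (z ⊗ₜ PiTensorProduct.tprod ℚ fun i => y (σ i))) := by
    intro z
    induction z with
    | zero => simp
    | tmul a b => rfl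
    | add a b ha hb => rw [map_add, ha, hb, TensorProduct.add_tmul, map_add, map_add]
  have e₂ : ∀ z, L₂ z = (permSign σ fun i => η (σ i)) • (LinearMap.lTensor (C.obj k)
        (PiTensorProduct.map (fun i => C.toCofree A (fiberCard f' i)) ∘ₗ
          koszulRegroup f' (fun i => C.obj (fiberCard f' i)) fun _ => A))
      ((TensorProduct.assoc ℚ _ _ _) ((LinearMap.lTensor (C.obj k)
      (PiTensorProduct.map fun i => C.map (E i)) z) ⊗ₜ
        PiTensorProduct.tprod ℚ y)) := by
    intro z
    induction z with
    | zero => simp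
    | tmul a b =>
      simp only [L₂, LinearMap.lTensor_tmul, LinearMap.smul_apply, TensorProduct.tmul_smul]
      rfl
    | add a b ha hb =>
      rw [map_add, ha, hb, map_add, TensorProduct.add_tmul, map_add, map_add, smul_add]
  exact (e₁ z).symm.trans ((LinearMap.congr_fun hL z).trans (e₂ z))

/-- The structure maps `C(A) → C(k) ⊗ C(A)^{⊗k}` of the `C`-coalgebra `C(A)`. -/
def coaction (k : ℕ) : C.Cofree A →ₗ[ℚ] C.obj k ⊗[ℚ] (⨂[ℚ] _i : Fin k, C.Cofree A) :=
  DirectSum.toModule ℚ ℕ _ fun n => (C.coinvKer A n).liftQ (C.preCoaction A n k) <| by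
    rw [coinvKer, Submodule.span_le]
    rintro _ ⟨⟨σ, x⟩, rfl⟩
    have := LinearMap.congr_fun (C.preCoaction_act A n k σ) x
    simp only [LinearMap.comp_apply] at this
    simp [this]

end

end DGCooperad

/-! ### `P_∞`-algebras and `∞`-morphisms, where `P_∞ = ΩC` -/

namespace DGCooperad

noncomputable section

/-- `C` is connected: `C(0) = 0`, and `C(1) = ℚ` via the counit. -/
structure Connected (C : DGCooperad.{u}) : Prop where
  arity_zero : Subsingleton (C.obj 0)
  arity_one : Function.Bijective C.counit

/-- A `P_∞`-algebra structure, `P_∞ = ΩC`, on a chain complex `A`, as a coderivation differential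
on the cofree coalgebra `C(A)` with internal differential `d`: a coderivation `b` of `C(A)` of degree `-1` such that `(d + b)² = 0` and
such that `b` decreases weight, i.e. maps weight `w` into weights `< w`. -/
structure PInfty (C : DGCooperad.{u}) (A : DGModule.{v}) : Type (max u v) where
  b : C.Cofree A →ₗ[ℚ] C.Cofree A
  b_mem : ∀ (i : ℤ) (x : C.Cofree A), x ∈ C.cofreeDeg A i → b x ∈ C.cofreeDeg A (i - 1)
  coderivation : ∀ (k : ℕ) (x : C.Cofree A), C.coaction A k (b x) =
    TensorProduct.map (C.obj k).eps (tensorDer (fun _ => C.cofreeEps A) fun _ => b)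
      (C.coaction A k x)
  perturbation : (C.cofreeD A + b) ∘ₗ (C.cofreeD A + b) = 0
  decreases_weight : ∀ (w : ℕ) (x : C.Coinv A w) (v : ℕ), w ≤ v →
    b (DirectSum.lof ℚ ℕ (fun n => C.Coinv A n) w x) v = 0

variable {C : DGCooperad.{u}} {A : DGModule.{v}} {B : DGModule.{w}}

/-- An `∞`-morphism between `P_∞`-algebras: a morphism `(C(A), d + b) → (C(B), d + b')` of dg
`C`-coalgebras. -/
structure InftyMorphism (b : C.PInfty A) (b' : C.PInfty B) : Type (max u v w) where
  toFun : C.Cofree A →ₗ[ℚ] C.Cofree B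
  mem_deg : ∀ (i : ℤ) (x : C.Cofree A), x ∈ C.cofreeDeg A i → toFun x ∈ C.cofreeDeg B i
  comm_d : toFun ∘ₗ (C.cofreeD A + b.b) = (C.cofreeD B + b'.b) ∘ₗ toFun
  coaction : ∀ (k : ℕ) (x : C.Cofree A), C.coaction B k (toFun x) =
    LinearMap.lTensor (C.obj k) (PiTensorProduct.map fun _ => toFun) (C.coaction A k x)

variable (C A) in
/-- The inclusion `A ≅ C(1) ⊗ A ⊆ C(A)` of the weight one part. -/
def weightOneIncl (hC : C.Connected) : A →ₗ[ℚ] C.Cofree A :=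
  C.toCofree A 1 ∘ₗ
    TensorProduct.mk ℚ (C.obj 1) (⨂[ℚ] _i : Fin 1, A)
      ((LinearEquiv.ofBijective C.counit hC.arity_one).symm 1) ∘ₗ
    (PiTensorProduct.subsingletonEquiv (R := ℚ) (s := fun _ : Fin 1 => (A : Type v))
      0).symm.toLinearMap

variable (C A) in
/-- The projection `C(A) → C(1) ⊗ A → A` to the weight one part. -/
def weightOneProj : C.Cofree A →ₗ[ℚ] A :=
  ((C.coinvKer A 1).liftQ
    ((TensorProduct.lid ℚ A).toLinearMap ∘ₗ
      TensorProduct.map C.counit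
        (PiTensorProduct.subsingletonEquiv (R := ℚ) (s := fun _ : Fin 1 => (A : Type v))
          0).toLinearMap) <| by
      rw [coinvKer, Submodule.span_le]
      rintro _ ⟨⟨σ, x⟩, rfl⟩
      obtain rfl : σ = Equiv.refl (Fin 1) := Subsingleton.elim _ _
      have h1 : C.map (Equiv.refl (Fin 1)) = LinearMap.id := LinearMap.ext (C.map_refl 1)
      have h : C.act A (Equiv.refl (Fin 1)) = LinearMap.id := by
        rw [act, h1]
        refine (congrArg (TensorProduct.map LinearMap.id) (permTensor_refl fun _ => A)).trans ?_
        exact TensorProduct.map_id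
      simp [h]) ∘ₗ
    DirectSum.component ℚ ℕ (fun n => C.Coinv A n) 1

/-- The linear part `A → B` of an `∞`-morphism: its component from weight one to weight one. -/
def InftyMorphism.linearPart {b : C.PInfty A} {b' : C.PInfty B} (F : InftyMorphism b b')
    (hC : C.Connected) : A →ₗ[ℚ] B :=
  C.weightOneProj B ∘ₗ F.toFun ∘ₗ C.weightOneIncl A hC

end

end DGCooperad

/-- A quasi-isomorphism of chain complexes: a chain map (of degree `0`) inducing an injective and
surjective map on homology. -/
structure IsQuasiIso {A : DGModule.{v}} {B : DGModule.{w}} (φ : A →ₗ[ℚ] B) : Prop where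
  mem_deg : ∀ (i : ℤ) (x : A), x ∈ A.deg i → φ x ∈ B.deg i
  comm_d : ∀ x : A, φ (A.d x) = B.d (φ x)
  injective : ∀ x : A, A.d x = 0 → (∃ y : B, φ x = B.d y) → ∃ z : A, x = A.d z
  surjective : ∀ y : B, B.d y = 0 → ∃ x : A, A.d x = 0 ∧ ∃ z : B, y = φ x + B.d z

/-- An `∞`-quasi-isomorphism: an `∞`-morphism whose linear part is a quasi-isomorphism. -/
def DGCooperad.InftyMorphism.IsInftyQuasiIso {C : DGCooperad.{u}} {A : DGModule.{v}}
    {B : DGModule.{w}} {b : C.PInfty A} {b' : C.PInfty B} (F : InftyMorphism b b')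
    (hC : C.Connected) : Prop :=
  IsQuasiIso (F.linearPart hC)

/-- A contraction of chain complexes from `A` to `B`: chain maps `f : A → B` and `g : B → A` of
degree `0` and a map `h : A → A` of degree `1` such that `f g = 1`, `g f = 1 + d h + h d`,
`f h = 0`, `h g = 0` and `h² = 0`. -/
structure Contraction (A : DGModule.{v}) (B : DGModule.{w}) : Type (max v w) where
  f : A →ₗ[ℚ] B
  g : B →ₗ[ℚ] A
  h : A →ₗ[ℚ] A
  f_mem : ∀ (i : ℤ) (x : A), x ∈ A.deg i → f x ∈ B.deg i
  g_mem : ∀ (i : ℤ) (y : B), y ∈ B.deg i → g y ∈ A.deg i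
  h_mem : ∀ (i : ℤ) (x : A), x ∈ A.deg i → h x ∈ A.deg (i + 1)
  f_d : f ∘ₗ A.d = B.d ∘ₗ f
  g_d : g ∘ₗ B.d = A.d ∘ₗ g
  f_g : f ∘ₗ g = LinearMap.id
  g_f : g ∘ₗ f = LinearMap.id + (A.d ∘ₗ h + h ∘ₗ A.d)
  f_h : f ∘ₗ h = 0
  h_g : h ∘ₗ g = 0
  h_h : h ∘ₗ h = 0

/-! Write `d` for the internal differential of `C(A)`, `D = d + b`, `i = C(g)`, `p = C(f)`, and
again `h` for the coderivation of `C(A)` induced by the homotopy `h`. The transferred data come from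
homological perturbation of the contraction `(i, p)`. The difficulty is to see that the perturbed
maps respect the `C`-coalgebra structure.

The operator `N = -(dh + hd)` is the coderivation induced by `1 - gf`. Since `gf` is idempotent, `N`
is diagonalizable with eigenvalues in `ℕ`: the eigenvalue counts the tensor factors lying in the
kernel of `gf`, and `ip` is the projection to the eigenvalue `0`. Over `ℚ` it has a pseudo-inverse
`P` with `PN + ip = NP + ip = 1` and `Ph = hP`, and `hP` serves as the homotopy on `C(A)`. As `b`
lowers weight, `bhP` is locally nilpotent and `S = (1 - bhP)⁻¹` exists. Put `F = pS`, `G = i +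
hPSbi` and `b' = pSbi`.

The homotopy `hP` need not be a coderivation, but `h` is one. Hence `L = -(Dh + hD) = N - (bh + hb)`
is a coderivation of degree `0` (`coaction_perturbedN`), and it commutes with `D` because `D² = 0`.
It characterizes the perturbed maps, being a weight-lowering perturbation of `N`: - `C(A) = im i +
im L` (`exists_eq_add`), `Fi = 1` and `FL = 0` (`F_i`, `F_L`), so these two equations determine `F`;
- `ker L ∩ ker p = 0` (`eq_zero`), `pG = 1` and `LG = 0` (`p_G`, `L_G`), so these determine `G`.

Both chain map identities follow (`F_comm`, `G_comm`). The same characterizations, read in `C(k) ⊗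
C(A)^{⊗k}` with `L` replaced by its derivation extension, show that `F` and `G` are coalgebra
morphisms (`coaction_comp_of_comp_eq_zero`, `coaction_comp_of_section`); for `G` this requires the
analogue of `ker L ∩ ker p = 0` on tensor powers (`tensor_eq_zero_of_perturbation`). As `F` is a
surjective coalgebra morphism, `d + b'` inherits its square-zero property and its compatibility with
the coalgebra structure from `D`. Finally `b` vanishes in weight one because `C(0) = 0`, so the
linear parts stay `f` and `g`. -/

/-! ### Derivations of tensor products -/

section TensorDer

variable {k : ℕ}

/-- If a multilinear map sends families of elements of the sets `S i` into a submodule `p`, then it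
sends families of elements of their spans into `p`. -/
theorem MultilinearMap.apply_mem_of_mem_span {V : Fin k → Type*} [∀ i, AddCommMonoid (V i)]
    [∀ i, Module ℚ (V i)] {W : Type*} [AddCommMonoid W] [Module ℚ W] (f : MultilinearMap ℚ V W)
    (S : ∀ i, Set (V i)) (p : Submodule ℚ W) (h : ∀ s : ∀ i, V i, (∀ i, s i ∈ S i) → f s ∈ p)
    (x : ∀ i, V i) (hx : ∀ i, x i ∈ Submodule.span ℚ (S i)) : f x ∈ p := by
  -- Induction on the set `t` of positions where `x` is only known to lie in the span; in the other
  -- positions `x` already lies in `S`.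
  have key : ∀ t : Finset (Fin k), ∀ x : ∀ i, V i, (∀ i ∈ t, x i ∈ Submodule.span ℚ (S i)) →
      (∀ i, i ∉ t → x i ∈ S i) → f x ∈ p := by
    intro t
    induction t using Finset.induction_on with
    | empty => exact fun x _ h2 => h x fun i => h2 i (Finset.notMem_empty i)
    | insert a t ha ih =>
      intro x h1 h2
      have : ∀ y ∈ Submodule.span ℚ (S a), f (Function.update x a y) ∈ p := by
        intro y hy
        induction hy using Submodule.span_induction with
        | mem y hy =>
          refine ih _ (fun i hi => ?_) fun i hi => ?_
          · rw [Function.update_of_ne (by rintro rfl; exact ha hi)]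
            exact h1 i (Finset.mem_insert_of_mem hi)
          · by_cases hia : i = a
            · subst hia; rwa [Function.update_self]
            · rw [Function.update_of_ne hia]
              exact h2 i (by simp [hia, hi])
        | zero => rw [f.map_update_zero]; exact p.zero_mem
        | add y z _ _ hy hz => rw [f.map_update_add]; exact p.add_mem hy hz
        | smul c y _ hy => rw [f.map_update_smul]; exact p.smul_mem c hy
      have := this (x a) (h1 a (Finset.mem_insert_self a t))
      rwa [Function.update_eq_self] at this
  exact key Finset.univ x (fun i _ => hx i) fun i hi => absurd (Finset.mem_univ i) hi

section

variable {V : Fin k → Type v} [∀ i, AddCommMonoid (V i)] [∀ i, Module ℚ (V i)]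
  {W : Fin k → Type w} [∀ i, AddCommMonoid (W i)] [∀ i, Module ℚ (W i)]

theorem tensorDer_apply_tprod (ε φ : ∀ i, V i →ₗ[ℚ] V i) (x : ∀ i, V i) :
    tensorDer ε φ (PiTensorProduct.tprod ℚ x) = ∑ i, PiTensorProduct.tprod ℚ
      (Function.update (fun j => if j < i then ε j (x j) else x j) i (φ i (x i))) := by
  simp only [tensorDer, LinearMap.sum_apply, PiTensorProduct.map_tprod]
  refine Finset.sum_congr rfl fun i _ => congrArg _ (funext fun j => ?_)
  by_cases h2 : j = i
  · subst h2; simp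
  · rw [Function.update_of_ne h2, if_neg h2]
    split_ifs <;> rfl

theorem tensorDer_add (ε φ ψ : ∀ i, V i →ₗ[ℚ] V i) :
    tensorDer ε (fun i => φ i + ψ i) = tensorDer ε φ + tensorDer ε ψ := by
  apply PiTensorProduct.ext
  ext x
  simp [tensorDer_apply_tprod, ← Finset.sum_add_distrib]

theorem tensorDer_zero (ε : ∀ i, V i →ₗ[ℚ] V i) : tensorDer ε (fun _ => 0) = 0 := by
  apply PiTensorProduct.ext
  ext x
  simp [tensorDer_apply_tprod]

/-- Naturality of the derivation extension. Taking `φ = 0` or `φ' = 0`, together with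
`tensorDer_zero`, it turns the vanishing of a composite with an odd map into a vanishing statement
on tensor powers. -/
theorem map_comp_tensorDer (ε φ : ∀ i, V i →ₗ[ℚ] V i) (ε' φ' : ∀ i, W i →ₗ[ℚ] W i)
    (α : ∀ i, V i →ₗ[ℚ] W i) (hε : ∀ i, α i ∘ₗ ε i = ε' i ∘ₗ α i)
    (hφ : ∀ i, α i ∘ₗ φ i = φ' i ∘ₗ α i) :
    PiTensorProduct.map α ∘ₗ tensorDer ε φ = tensorDer ε' φ' ∘ₗ PiTensorProduct.map α := by
  refine LinearMap.ext fun z => ?_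
  simp only [tensorDer, LinearMap.comp_apply, LinearMap.sum_apply, map_sum]
  refine Finset.sum_congr rfl fun i _ => ?_
  rw [← LinearMap.comp_apply, ← LinearMap.comp_apply, ← PiTensorProduct.map_comp,
    ← PiTensorProduct.map_comp]
  refine congrArg (fun β => PiTensorProduct.map β z) (funext fun j => ?_)
  split_ifs
  · exact hε j
  · exact hφ j
  · rfl

end

variable {V : Fin k → Type v} [∀ i, AddCommGroup (V i)] [∀ i, Module ℚ (V i)]

theorem tensorDer_neg (ε φ : ∀ i, V i →ₗ[ℚ] V i) :
    tensorDer ε (fun i => -φ i) = -tensorDer ε φ := by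
  apply PiTensorProduct.ext
  ext x
  simp [tensorDer_apply_tprod, ← Finset.sum_neg_distrib, MultilinearMap.map_update_neg]

/-- The derivation extension of the anticommutator of odd maps. -/
theorem tensorDer_anticomm (ε φ ψ : ∀ i, V i →ₗ[ℚ] V i) (hε : ∀ i, ε i ∘ₗ ε i = LinearMap.id)
    (hφ : ∀ i, ε i ∘ₗ φ i = -(φ i ∘ₗ ε i)) (hψ : ∀ i, ε i ∘ₗ ψ i = -(ψ i ∘ₗ ε i)) :
    tensorDer ε φ ∘ₗ tensorDer ε ψ + tensorDer ε ψ ∘ₗ tensorDer ε φ =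
      tensorDer (fun _ => LinearMap.id) fun i => φ i ∘ₗ ψ i + ψ i ∘ₗ φ i := by
  set T : (∀ i, V i →ₗ[ℚ] V i) → Fin k → ∀ j, V j →ₗ[ℚ] V j := fun φ i j =>
    if j < i then ε j else if j = i then φ j else LinearMap.id with hT
  have hcomp : ∀ φ ψ : ∀ i, V i →ₗ[ℚ] V i, tensorDer ε φ ∘ₗ tensorDer ε ψ =
      ∑ i, ∑ j, PiTensorProduct.map (fun l => T φ i l ∘ₗ T ψ j l) := by
    intro φ ψ
    refine LinearMap.ext fun z => ?_
    simp only [tensorDer, LinearMap.comp_apply, LinearMap.sum_apply, map_sum,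
      PiTensorProduct.map_comp, T]
    rw [Finset.sum_comm]
  -- the contributions of two different positions cancel
  have hlt : ∀ φ ψ : ∀ i, V i →ₗ[ℚ] V i, (∀ i, ε i ∘ₗ φ i = -(φ i ∘ₗ ε i)) → ∀ i j, i < j →
      PiTensorProduct.map (fun l => T φ i l ∘ₗ T ψ j l) =
        -PiTensorProduct.map (fun l => T ψ j l ∘ₗ T φ i l) := by
    intro φ ψ hφ i j hij
    have h1 : (fun l => T ψ j l ∘ₗ T φ i l) =
        Function.update (fun l => T φ i l ∘ₗ T ψ j l) i
          ((-1 : ℚ) • (T φ i i ∘ₗ T ψ j i)) := by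
      funext l
      by_cases hl : l = i
      · subst hl
        rw [Function.update_self]
        simp [hT, hij, hφ]
      · rw [Function.update_of_ne hl]
        simp only [hT]
        rcases lt_or_gt_of_ne hl with h | h
        · simp [h, h.trans hij]
        · simp only [not_lt_of_gt h, if_false, hl, LinearMap.id_comp, LinearMap.comp_id]
    rw [h1, PiTensorProduct.map_update_smul, Function.update_eq_self]
    exact (neg_neg _).symm.trans (congrArg _ (neg_one_smul ℚ _).symm)
  rw [hcomp φ ψ, hcomp ψ φ, Finset.sum_comm (f := fun i j =>
    PiTensorProduct.map (fun l => T ψ i l ∘ₗ T φ j l)), ← Finset.sum_add_distrib]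
  refine Finset.sum_congr rfl fun i _ => ?_
  rw [← Finset.sum_add_distrib, Finset.sum_eq_single i]
  -- Only equal positions survive. To the left of `i` the factors are `ε ∘ ε = 1`, so the derivation
  -- extension of the anticommutator carries no signs.
  · have h1 : ∀ φ ψ : ∀ i, V i →ₗ[ℚ] V i, (fun l => T φ i l ∘ₗ T ψ i l) =
        Function.update (fun l => (LinearMap.id : V l →ₗ[ℚ] V l)) i (φ i ∘ₗ ψ i) := by
      intro φ ψ
      funext l
      by_cases hl : l = i
      · subst hl; simp [hT]
      · rw [Function.update_of_ne hl]
        simp only [hT, hl, if_false]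
        split_ifs
        · exact hε l
        · rfl
    rw [h1, h1, ← PiTensorProduct.map_update_add]
    congr 1
    funext l
    by_cases hl : l = i
    · subst hl; simp
    · simp [hl]
  · intro j _ hj
    rcases lt_or_gt_of_ne hj with h | h
    · rw [hlt ψ φ hψ j i h, add_neg_cancel]
    · rw [hlt φ ψ hφ i j h, neg_add_cancel]
  · simp

end TensorDer

/-! ### Odd maps of graded vector spaces -/

namespace DGModule

theorem par_odd {M N : DGModule.{u}} (φ : M →ₗ[ℚ] N) (r : ℤ) (hr : (r : ZMod 2) = 1)
    (hφ : ∀ (i : ℤ) (x : M), x ∈ M.deg i → φ x ∈ N.deg (i + r)) (e : ZMod 2) (x : M) :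
    N.par (e + 1) (φ x) = φ (M.par e x) := by
  have : N.par (e + 1) ∘ₗ φ = φ ∘ₗ M.par e := by
    apply hom_ext
    intro i x hx
    simp only [LinearMap.comp_apply, par_of_mem M _ hx, par_of_mem N _ (hφ i x hx)]
    have : (((i + r : ℤ) : ZMod 2) = e + 1) ↔ ((i : ℤ) : ZMod 2) = e := by
      push_cast
      rw [hr, add_left_inj]
    simp only [this]
    split_ifs <;> simp
  exact LinearMap.congr_fun this x

/-- The two complexes of a contraction lie in different universes, hence this variant of `par_hom`.
-/
theorem par_hom' {M : DGModule.{u}} {N : DGModule.{v}} (φ : M →ₗ[ℚ] N)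
    (hφ : ∀ (i : ℤ) (x : M), x ∈ M.deg i → φ x ∈ N.deg i) (e : ZMod 2) (x : M) :
    N.par e (φ x) = φ (M.par e x) := by
  have : N.par e ∘ₗ φ = φ ∘ₗ M.par e := by
    apply hom_ext
    intro i x hx
    simp only [LinearMap.comp_apply, par_of_mem M _ hx, par_of_mem N _ (hφ i x hx)]
    split_ifs <;> simp
  exact LinearMap.congr_fun this x

theorem eps_eps (M : DGModule.{u}) : M.eps ∘ₗ M.eps = LinearMap.id := by
  have h01 : (0 : ZMod 2) ≠ 1 := by decide
  rw [← M.par_zero_add_par_one]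
  ext x
  simp [eps, par_par, h01, h01.symm]

theorem eps_odd {M : DGModule.{u}} (φ : M →ₗ[ℚ] M)
    (hφ : ∀ (e : ZMod 2) (x : M), M.par (e + 1) (φ x) = φ (M.par e x)) :
    M.eps ∘ₗ φ = -(φ ∘ₗ M.eps) := by
  ext x
  have h0 := hφ 0 x
  have h1 := hφ 1 x
  rw [show (0 : ZMod 2) + 1 = 1 by decide] at h0
  rw [show (1 : ZMod 2) + 1 = 0 by decide] at h1
  simp [eps, h0, h1]

theorem eps_even {M : DGModule.{u}} {N : DGModule.{v}} (φ : M →ₗ[ℚ] N)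
    (hφ : ∀ (e : ZMod 2) (x : M), N.par e (φ x) = φ (M.par e x)) :
    φ ∘ₗ M.eps = N.eps ∘ₗ φ := by
  ext x
  simp [eps, hφ]

theorem eps_of_mem (M : DGModule.{u}) {i : ℤ} {x : M} (hx : x ∈ M.deg i) :
    M.eps x = ksgn 1 i • x :=
  eps_eq_smul M (by rw [par_of_mem M _ hx, if_pos rfl])

end DGModule

/-! ### Koszul signs and derivations -/

section KoszulDerivations

open DGModule

variable {n k m : ℕ}

/-- Collects the signs produced by an odd operator on its way to position `i`. The entry at `i` is
overwritten, so nothing is assumed there. -/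
theorem tprod_update_smul_lt {V : Fin n → Type v} [∀ i, AddCommMonoid (V i)] [∀ i, Module ℚ (V i)]
    (a : Fin n → ℚ) (z y : ∀ i, V i) (i : Fin n) (w : V i) (hy : ∀ j, j < i → y j = a j • z j)
    (hy' : ∀ j, i < j → y j = z j) :
    PiTensorProduct.tprod ℚ (Function.update y i w) =
      (∏ j, if j < i then a j else 1) • PiTensorProduct.tprod ℚ (Function.update z i w) := by
  rw [← MultilinearMap.map_smul_univ]
  congr 1
  funext j
  rcases lt_trichotomy j i with h | rfl | h
  · rw [Function.update_of_ne h.ne, Function.update_of_ne h.ne, if_pos h, hy j h]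
  · simp
  · rw [Function.update_of_ne h.ne', Function.update_of_ne h.ne', if_neg (not_lt_of_gt h),
      hy' j h, one_smul]

theorem tensorDer_eps_tprod (M : Fin n → DGModule.{u}) (φ : ∀ i, M i →ₗ[ℚ] M i)
    (e : Fin n → ZMod 2) (x : ∀ i, M i) (hx : ∀ i, (M i).par (e i) (x i) = x i) :
    tensorDer (fun i => (M i).eps) φ (PiTensorProduct.tprod ℚ x) =
      ∑ i, (∏ j, if j < i then ksgn 1 (e j) else 1) •
        PiTensorProduct.tprod ℚ (Function.update x i (φ i (x i))) := by
  rw [tensorDer_apply_tprod]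
  refine Finset.sum_congr rfl fun i _ => ?_
  refine tprod_update_smul_lt _ x _ i _ (fun j hj => ?_) fun j hj => ?_
  · rw [if_pos hj, eps_eq_smul _ (hx j)]
  · rw [if_neg (not_lt_of_gt hj)]

theorem map_eps_tprod (M : Fin n → DGModule.{u}) (e : Fin n → ZMod 2) (x : ∀ i, M i)
    (hx : ∀ i, (M i).par (e i) (x i) = x i) :
    PiTensorProduct.map (fun i => (M i).eps) (PiTensorProduct.tprod ℚ x) =
      (∏ j, ksgn 1 (e j)) • PiTensorProduct.tprod ℚ x := by
  rw [PiTensorProduct.map_tprod, ← MultilinearMap.map_smul_univ]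
  congr 1
  funext j
  exact eps_eq_smul _ (hx j)

/-- An odd map in one position keeps a tensor homogeneous and flips exactly one parity, so the
formulas for permuting and regrouping homogeneous tensors apply again. -/
theorem par_update {M : Fin n → DGModule.{u}} (φ : ∀ i, M i →ₗ[ℚ] M i)
    (hφ : ∀ i e x, (M i).par (e + 1) (φ i x) = φ i ((M i).par e x))
    (e : Fin n → ZMod 2) (x : ∀ i, M i) (hx : ∀ i, (M i).par (e i) (x i) = x i) (i j : Fin n) :
    (M j).par (Function.update e i (e i + 1) j) (Function.update x i (φ i (x i)) j) =
      Function.update x i (φ i (x i)) j := by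
  by_cases h : j = i
  · subst h
    rw [Function.update_self, Function.update_self, hφ, hx]
  · rw [Function.update_of_ne h, Function.update_of_ne h, hx]

/-- The argument for the differential uses only that it flips parity. This form is what lets the
homotopy, of degree `+1`, induce an operator on coinvariants. -/
theorem permTensor_tensorDer_of_odd {n' : ℕ} (A : DGModule.{u}) (σ : Fin n ≃ Fin n')
    (φ : A →ₗ[ℚ] A) (hφ : ∀ e x, A.par (e + 1) (φ x) = φ (A.par e x)) :
    permTensor (fun _ => A) σ ∘ₗ tensorDer (fun _ : Fin n => A.eps) (fun _ => φ) =
      tensorDer (fun _ : Fin n' => A.eps) (fun _ => φ) ∘ₗ permTensor (fun _ => A) σ := by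
  apply piTensor_ext_par (M := fun _ : Fin n => A)
  intro e x hx
  obtain ⟨y, rfl⟩ : ∃ y : Fin n' → A, x = fun i => y (σ i) :=
    ⟨fun j => x (σ.symm j), by funext i; simp⟩
  obtain ⟨f, rfl⟩ : ∃ f : Fin n' → ZMod 2, e = fun i => f (σ i) :=
    ⟨fun j => e (σ.symm j), by funext i; simp⟩
  have hy : ∀ j, A.par (f j) (y j) = y j := fun j => by
    have := hx (σ.symm j); simpa using this
  rw [LinearMap.comp_apply, LinearMap.comp_apply, permTensor_tprod (fun _ => A) σ f y hy,
    tensorDer_eps_tprod (fun _ => A) _ _ _ hx, map_smul, tensorDer_eps_tprod (fun _ => A) _ _ _ hy,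
    map_sum, Finset.smul_sum, ← Equiv.sum_comp σ]
  refine Finset.sum_congr rfl fun i _ => ?_
  have hup : (Function.update (fun i => y (σ i)) i (φ (y (σ i))) : Fin n → A) =
      fun j => Function.update y (σ i) (φ (y (σ i))) (σ j) :=
    (Function.update_comp_eq_of_injective y σ.injective i _).symm
  have hup' : (fun j => Function.update f (σ i) (f (σ i) + 1) (σ j)) =
      Function.update (fun i => f (σ i)) i (f (σ i) + 1) :=
    Function.update_comp_eq_of_injective f σ.injective i _
  have hp := permTensor_tprod (fun _ => A) σ (Function.update f (σ i) (f (σ i) + 1))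
    (Function.update y (σ i) (φ (y (σ i))))
    (par_update (M := fun _ => A) (fun _ => φ) (fun _ => hφ) f y hy (σ i))
  rw [map_smul, hup, hp, hup', smul_smul, smul_smul, permSign_update]
  congr 2
  exact Equiv.prod_comp σ fun j => if j < σ i then ksgn 1 (f j) else 1

theorem permTensor_map_hom {n' : ℕ} (A : DGModule.{u}) (B : DGModule.{v}) (σ : Fin n ≃ Fin n')
    (φ : A →ₗ[ℚ] B) (hφ : ∀ e x, B.par e (φ x) = φ (A.par e x)) :
    permTensor (fun _ => B) σ ∘ₗ PiTensorProduct.map (fun _ : Fin n => φ) =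
      PiTensorProduct.map (fun _ : Fin n' => φ) ∘ₗ permTensor (fun _ => A) σ := by
  apply piTensor_ext_par (M := fun _ : Fin n => A)
  intro e x hx
  obtain ⟨y, rfl⟩ : ∃ y : Fin n' → A, x = fun i => y (σ i) :=
    ⟨fun j => x (σ.symm j), by funext i; simp⟩
  obtain ⟨f, rfl⟩ : ∃ f : Fin n' → ZMod 2, e = fun i => f (σ i) :=
    ⟨fun j => e (σ.symm j), by funext i; simp⟩
  have hy : ∀ j, A.par (f j) (y j) = y j := fun j => by
    have := hx (σ.symm j); simpa using this
  rw [LinearMap.comp_apply, LinearMap.comp_apply, permTensor_tprod (fun _ => A) σ f y hy,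
    PiTensorProduct.map_tprod, map_smul, PiTensorProduct.map_tprod]
  exact permTensor_tprod (fun _ => B) σ f (fun j => φ (y j)) fun j => by rw [hφ, hy]

theorem prod_fiberEmb (g : Fin k → Fin m) (F : Fin k → ℚ) :
    ∏ s, F s = ∏ i, ∏ v, F (fiberEmb g i v) := by
  rw [← Equiv.prod_comp (fiberSigma g), Fintype.prod_sigma]
  rfl

theorem fiberEmb_mem (g : Fin k → Fin m) (i : Fin m) (v : Fin (fiberCard g i)) :
    g (fiberEmb g i v) = i :=
  (fiberIso g i v).2

theorem fiberEmb_lt (g : Fin k → Fin m) (i : Fin m) (v w : Fin (fiberCard g i)) :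
    fiberEmb g i v < fiberEmb g i w ↔ v < w := by
  rw [← (fiberIso g i).lt_iff_lt]; rfl

/-- The effect on a product of signs over pairs of changing one parity. -/
theorem prod_ksgn_update (R : Fin n → Fin n → Prop) [DecidableRel R] (hR : ∀ a, ¬ R a a)
    (e : Fin n → ZMod 2) (i : Fin n) :
    (∏ a, ∏ b, if R a b then ksgn (Function.update e i (e i + 1) a)
      (Function.update e i (e i + 1) b) else 1) = (∏ a, ∏ b, if R a b then ksgn (e a) (e b) else 1) *
      ∏ b, (if R i b then ksgn 1 (e b) else 1) * (if R b i then ksgn 1 (e b) else 1) := by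
  have e1 : (∏ b, if R i b then ksgn 1 (e b) else 1) =
      ∏ a, ∏ b, if a = i then (if R i b then ksgn 1 (e b) else 1) else 1 := by
    symm
    rw [Finset.prod_eq_single i]
    · simp
    · intro a _ ha; simp [ha]
    · simp
  have e2 : (∏ a, if R a i then ksgn 1 (e a) else 1) =
      ∏ a, ∏ b, if b = i then (if R a i then ksgn 1 (e a) else 1) else 1 := by
    refine Finset.prod_congr rfl fun a _ => ?_
    rw [Finset.prod_eq_single i]
    · simp
    · intro b _ hb; simp [hb]
    · simp
  rw [Finset.prod_mul_distrib, e1, e2, ← Finset.prod_mul_distrib, ← Finset.prod_mul_distrib]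
  refine Finset.prod_congr rfl fun a _ => ?_
  rw [← Finset.prod_mul_distrib, ← Finset.prod_mul_distrib]
  refine Finset.prod_congr rfl fun b _ => ?_
  by_cases ha : a = i
  · subst ha
    by_cases hb : b = a
    · subst hb; simp [hR]
    · simp only [Function.update_self, Function.update_of_ne hb, hb, if_true, if_false, mul_one,
        ksgn_add_one_left]
      split_ifs <;> simp
  · by_cases hb : b = i
    · subst hb
      simp only [Function.update_self, Function.update_of_ne ha, ha, if_true, if_false, one_mul,
        ksgn_comm (e a), ksgn_add_one_left]
      split_ifs <;> simp
    · simp [ha, hb]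

/-- Flipping the parity of `xᵢ` affects only the pairs `(xᵢ, yₛ)` that are interchanged by the
regrouping, namely those with `g s < i`. -/
theorem regroupSign_update_left (g : Fin k → Fin m) (ξ : Fin m → ZMod 2) (η : Fin k → ZMod 2)
    (i : Fin m) :
    regroupSign g (Function.update ξ i (ξ i + 1)) η =
      regroupSign g ξ η * ∏ s, if g s < i then ksgn 1 (η s) else 1 := by
  unfold regroupSign
  rw [mul_assoc]
  congr 1
  have e1 : (∏ s, if g s < i then ksgn 1 (η s) else 1) =
      ∏ a, ∏ s, if a = i then (if g s < i then ksgn 1 (η s) else 1) else 1 := by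
    symm
    rw [Finset.prod_eq_single i]
    · simp
    · intro a _ ha; simp [ha]
    · simp
  rw [e1, ← Finset.prod_mul_distrib]
  refine Finset.prod_congr rfl fun a _ => ?_
  rw [← Finset.prod_mul_distrib]
  refine Finset.prod_congr rfl fun s _ => ?_
  by_cases ha : a = i
  · subst ha
    simp only [Function.update_self, if_true, ksgn_add_one_left]
    split_ifs <;> simp
  · simp [ha]

/-- An odd operator can reach `yₜ` before or after the regrouping. Before, it passes all `xᵢ` and
the `yₛ` with `s < t`. Afterwards, it passes the blocks preceding `g t`, then the `x` of its own
block, then the earlier `y` of that block. The two signs agree once the change of parity of `yₜ` in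
the regrouping sign is counted, since the superfluous factors occur in pairs. -/
theorem regroupSign_update_right (g : Fin k → Fin m) (ξ : Fin m → ZMod 2) (η : Fin k → ZMod 2)
    (t : Fin k) :
    (∏ i, ksgn 1 (ξ i)) * (∏ s, if s < t then ksgn 1 (η s) else 1) *
        regroupSign g ξ (Function.update η t (η t + 1)) =
      regroupSign g ξ η * ((∏ i, if i < g t then ksgn 1 (ξ i) else 1) *
        (∏ s, if g s < g t then ksgn 1 (η s) else 1) * ksgn 1 (ξ (g t)) *
        ∏ s, if g s = g t ∧ s < t then ksgn 1 (η s) else 1) := by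
  have h2 : (∏ i, ∏ s, if g s < i then ksgn (ξ i) (Function.update η t (η t + 1) s) else 1) =
      (∏ i, ∏ s, if g s < i then ksgn (ξ i) (η s) else 1) *
        ∏ i, if g t < i then ksgn 1 (ξ i) else 1 := by
    rw [← Finset.prod_mul_distrib]
    refine Finset.prod_congr rfl fun i _ => ?_
    have e1 : (if g t < i then ksgn 1 (ξ i) else 1) =
        ∏ s, if s = t then (if g t < i then ksgn 1 (ξ i) else 1) else 1 := by simp
    rw [e1, ← Finset.prod_mul_distrib]
    refine Finset.prod_congr rfl fun s _ => ?_
    by_cases hs : s = t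
    · subst hs
      simp only [Function.update_self, if_true, ksgn_comm (ξ i), ksgn_add_one_left]
      split_ifs <;> simp
    · simp [hs]
  have h3 : ksgn 1 (ξ (g t)) = ∏ i, if i = g t then ksgn 1 (ξ i) else 1 := by simp
  -- The `xᵢ` with `i > g t` are passed once by the operator and once by the modified `yₜ`, so they
  -- cancel.
  have hξ : (∏ i, ksgn 1 (ξ i)) * (∏ i, if g t < i then ksgn 1 (ξ i) else 1) =
      (∏ i, if i < g t then ksgn 1 (ξ i) else 1) * ksgn 1 (ξ (g t)) := by
    rw [h3, ← Finset.prod_mul_distrib, ← Finset.prod_mul_distrib]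
    refine Finset.prod_congr rfl fun i _ => ?_
    rcases lt_trichotomy i (g t) with h | h | h
    · simp [h, h.ne, not_lt_of_gt h]
    · subst h; simp
    · simp [h, h.ne', not_lt_of_gt h, ksgn_mul_self]
  -- The same cancellation for the `yₛ` with `s < t` that are moved to a block after that of `yₜ`.
  have hη : (∏ s, if s < t then ksgn 1 (η s) else 1) *
      (∏ b, (if t < b ∧ g b < g t then ksgn 1 (η b) else 1) *
        (if b < t ∧ g t < g b then ksgn 1 (η b) else 1)) =
      (∏ s, if g s < g t then ksgn 1 (η s) else 1) *
        ∏ s, if g s = g t ∧ s < t then ksgn 1 (η s) else 1 := by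
    rw [← Finset.prod_mul_distrib, ← Finset.prod_mul_distrib]
    refine Finset.prod_congr rfl fun s _ => ?_
    have hk := ksgn_mul_self 1 (η s)
    rcases lt_trichotomy s t with h | h | h
    · rcases lt_trichotomy (g s) (g t) with h' | h' | h'
      · simp [h, h', h'.ne, not_lt_of_gt h, not_lt_of_gt h']
      · simp [h, h', not_lt_of_gt h]
      · simp [h, h', h'.ne', not_lt_of_gt h, not_lt_of_gt h', hk]
    · subst h; simp
    · simp [h, not_lt_of_gt h]
  unfold regroupSign
  rw [prod_ksgn_update (fun s t => s < t ∧ g t < g s) (fun a h => lt_irrefl _ h.1), h2]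
  linear_combination (∏ a, ∏ b, if a < b ∧ g b < g a then ksgn (η a) (η b) else 1) *
    (∏ i, ∏ s, if g s < i then ksgn (ξ i) (η s) else 1) *
    ((∏ i, ksgn 1 (ξ i)) * (∏ i, if g t < i then ksgn 1 (ξ i) else 1) * hη +
      (∏ s, if g s < g t then ksgn 1 (η s) else 1) *
        (∏ s, if g s = g t ∧ s < t then ksgn 1 (η s) else 1) * hξ)

variable (g : Fin k → Fin m) (M : Fin m → DGModule.{u}) (A : DGModule.{v})

theorem tensor_ext_par {W : Type*} [AddCommMonoid W] [Module ℚ W]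
    {α β : ((⨂[ℚ] i, M i) ⊗[ℚ] (⨂[ℚ] _t : Fin k, A)) →ₗ[ℚ] W}
    (h : ∀ (ξ : Fin m → ZMod 2) (η : Fin k → ZMod 2) (x : ∀ i, M i) (y : Fin k → A),
      (∀ i, (M i).par (ξ i) (x i) = x i) → (∀ t, A.par (η t) (y t) = y t) →
      α (PiTensorProduct.tprod ℚ x ⊗ₜ PiTensorProduct.tprod ℚ y) =
        β (PiTensorProduct.tprod ℚ x ⊗ₜ PiTensorProduct.tprod ℚ y)) : α = β := by
  apply TensorProduct.ext
  apply piTensor_ext_par (M := M)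
  intro ξ x hx
  apply piTensor_ext_par (M := fun _ => A)
  intro η y hy
  exact h ξ η x y hx hy

theorem koszulRegroup_map_right (B : DGModule.{w}) (φ : A →ₗ[ℚ] B)
    (hφ : ∀ e x, B.par e (φ x) = φ (A.par e x)) :
    koszulRegroup g M (fun _ => B) ∘ₗ
        LinearMap.lTensor _ (PiTensorProduct.map fun _ : Fin k => φ) =
      (PiTensorProduct.map fun i => LinearMap.lTensor (M i)
        (PiTensorProduct.map fun _ : Fin (fiberCard g i) => φ)) ∘ₗ
        koszulRegroup g M fun _ => A := by
  apply tensor_ext_par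
  intro ξ η x y hx hy
  simp only [LinearMap.comp_apply, LinearMap.lTensor_tmul, PiTensorProduct.map_tprod]
  rw [koszulRegroup_tprod g M (fun _ => A) ξ η x y hx hy,
    koszulRegroup_tprod g M (fun _ => B) ξ η x (fun t => φ (y t)) hx fun t => by rw [hφ, hy],
    map_smul, PiTensorProduct.map_tprod]
  simp only [LinearMap.lTensor_tmul, PiTensorProduct.map_tprod]

/-- The sign for passing an entire block is the product of the signs of its factors. -/
theorem eps_tmul_fibre (ξ : Fin m → ZMod 2) (η : Fin k → ZMod 2) (x : ∀ i, M i) (y : Fin k → A)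
    (hx : ∀ i, (M i).par (ξ i) (x i) = x i) (hy : ∀ t, A.par (η t) (y t) = y t) (i : Fin m) :
    TensorProduct.map (M i).eps (PiTensorProduct.map fun _ : Fin (fiberCard g i) => A.eps)
        (x i ⊗ₜ PiTensorProduct.tprod ℚ fun t => y (fiberEmb g i t)) =
      (ksgn 1 (ξ i) * ∏ t, ksgn 1 (η (fiberEmb g i t))) •
        (x i ⊗ₜ[ℚ] PiTensorProduct.tprod ℚ fun t => y (fiberEmb g i t)) := by
  rw [TensorProduct.map_tmul, eps_eq_smul _ (hx i), map_eps_tprod (fun _ => A)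
    (fun t => η (fiberEmb g i t)) (fun t => y (fiberEmb g i t)) fun t => hy _,
    TensorProduct.smul_tmul_smul]

theorem prod_lt_fibre (ξ : Fin m → ZMod 2) (η : Fin k → ZMod 2) (i : Fin m) :
    (∏ j, if j < i then ksgn 1 (ξ j) * ∏ t, ksgn 1 (η (fiberEmb g j t)) else 1) =
      (∏ j, if j < i then ksgn 1 (ξ j) else 1) * ∏ s, if g s < i then ksgn 1 (η s) else 1 := by
  rw [prod_fiberEmb g, ← Finset.prod_mul_distrib]
  refine Finset.prod_congr rfl fun j _ => ?_
  simp only [fiberEmb_mem]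
  split_ifs <;> simp

/-- Half of the Leibniz rule for the signed regrouping: an odd operator on the `x`-factors becomes a
derivation over the blocks. It is applied to the differential of the cooperad. -/
theorem koszulRegroup_tensorDer_left (ψ : ∀ i, M i →ₗ[ℚ] M i)
    (hψ : ∀ i e x, (M i).par (e + 1) (ψ i x) = ψ i ((M i).par e x)) :
    koszulRegroup g M (fun _ => A) ∘ₗ LinearMap.rTensor _ (tensorDer (fun i => (M i).eps) ψ) =
      tensorDer (fun i => TensorProduct.map (M i).eps
          (PiTensorProduct.map fun _ : Fin (fiberCard g i) => A.eps))
        (fun i => LinearMap.rTensor _ (ψ i)) ∘ₗ koszulRegroup g M fun _ => A := by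
  apply tensor_ext_par
  intro ξ η x y hx hy
  simp only [LinearMap.comp_apply, LinearMap.rTensor_tmul]
  rw [koszulRegroup_tprod g M (fun _ => A) ξ η x y hx hy, map_smul,
    tensorDer_eps_tprod M ψ ξ x hx, tensorDer_apply_tprod, TensorProduct.sum_tmul, map_sum, Finset.smul_sum]
  refine Finset.sum_congr rfl fun i _ => ?_
  rw [← TensorProduct.smul_tmul', map_smul, koszulRegroup_tprod g M (fun _ => A) _ η _ y
    (par_update ψ hψ ξ x hx i) hy,
    tprod_update_smul_lt (fun j => ksgn 1 (ξ j) * ∏ t, ksgn 1 (η (fiberEmb g j t)))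
      (fun j => x j ⊗ₜ[ℚ] PiTensorProduct.tprod ℚ fun t => y (fiberEmb g j t)) _ i _
      (fun j hj => by rw [if_pos hj]; exact eps_tmul_fibre g M A ξ η x y hx hy j)
      (fun j hj => by rw [if_neg (not_lt_of_gt hj)]),
    smul_smul, smul_smul, regroupSign_update_left, prod_lt_fibre]
  congr 1
  · ring
  · congr 1
    funext j
    by_cases h : j = i
    · subst h; simp
    · rw [Function.update_of_ne h, Function.update_of_ne h]

/-- The other half of the Leibniz rule, for an odd operator on the `y`-factors. Summing over `t`
amounts to summing over a block `i` and a position `v` in its fibre; the block operator carries `ε`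
on `xᵢ` because the operator first passes `xᵢ`. -/
theorem koszulRegroup_tensorDer_right (φ : A →ₗ[ℚ] A)
    (hφ : ∀ e x, A.par (e + 1) (φ x) = φ (A.par e x)) :
    koszulRegroup g M (fun _ => A) ∘ₗ TensorProduct.map (PiTensorProduct.map fun i => (M i).eps)
        (tensorDer (fun _ => A.eps) fun _ => φ) =
      tensorDer (fun i => TensorProduct.map (M i).eps
          (PiTensorProduct.map fun _ : Fin (fiberCard g i) => A.eps))
        (fun i => TensorProduct.map (M i).eps
          (tensorDer (fun _ : Fin (fiberCard g i) => A.eps) fun _ => φ)) ∘ₗ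
        koszulRegroup g M fun _ => A := by
  apply tensor_ext_par
  intro ξ η x y hx hy
  simp only [LinearMap.comp_apply, TensorProduct.map_tmul]
  rw [koszulRegroup_tprod g M (fun _ => A) ξ η x y hx hy, map_smul,
    tensorDer_eps_tprod (fun _ => A) (fun _ => φ) η y hy, tensorDer_apply_tprod, map_eps_tprod M ξ x hx,
    TensorProduct.tmul_sum, map_sum, Finset.smul_sum, ← Equiv.sum_comp (fiberSigma g),
    Fintype.sum_sigma]
  refine Finset.sum_congr rfl fun i _ => ?_
  rw [tprod_update_smul_lt (fun j => ksgn 1 (ξ j) * ∏ t, ksgn 1 (η (fiberEmb g j t)))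
      (fun j => x j ⊗ₜ[ℚ] PiTensorProduct.tprod ℚ fun t => y (fiberEmb g j t)) _ i _
      (fun j hj => by rw [if_pos hj]; exact eps_tmul_fibre g M A ξ η x y hx hy j)
      (fun j hj => by rw [if_neg (not_lt_of_gt hj)]), prod_lt_fibre,
    TensorProduct.map_tmul, eps_eq_smul _ (hx i),
    tensorDer_eps_tprod (fun _ => A) (fun _ => φ) (fun t => η (fiberEmb g i t))
      (fun t => y (fiberEmb g i t)) fun t => hy _, TensorProduct.tmul_sum,
    ← MultilinearMap.toLinearMap_apply, map_sum, Finset.smul_sum, Finset.smul_sum]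
  refine Finset.sum_congr rfl fun v _ => ?_
  have ht : fiberSigma g ⟨i, v⟩ = fiberEmb g i v := rfl
  have hgt := fiberEmb_mem g i v
  have hs := regroupSign_update_right g ξ η (fiberEmb g i v)
  have hv : (∏ s, if g s = g (fiberEmb g i v) ∧ s < fiberEmb g i v then ksgn 1 (η s) else 1) =
      ∏ t, if t < v then ksgn 1 (η (fiberEmb g i t)) else 1 := by
    rw [prod_fiberEmb g, Finset.prod_eq_single i]
    · simp [fiberEmb_mem, fiberEmb_lt]
    · intro j _ hj
      simp [fiberEmb_mem, hj]
    · simp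
  rw [hv, hgt] at hs
  rw [ht, TensorProduct.smul_tmul_smul, map_smul, koszulRegroup_tprod g M (fun _ => A) ξ _ x _ hx
    (par_update (M := fun _ => A) (fun _ => φ) (fun _ => hφ) η y hy (fiberEmb g i v)), smul_smul,
    hs, TensorProduct.smul_tmul_smul, map_smul, smul_smul, smul_smul,
    MultilinearMap.toLinearMap_apply]
  congr 1
  · ring
  · congr 1
    funext j
    by_cases h : j = i
    · subst h
      rw [Function.update_self]
      congr 2
      exact Function.update_comp_eq_of_injective y (fiberEmb_injective g j) v _
    · rw [Function.update_of_ne h]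
      congr 2
      funext t
      refine Function.update_of_ne (fun h' => h ?_) _ _
      rw [← fiberEmb_mem g j t, h', hgt]

end KoszulDerivations

/-! ### Maps and coderivations of cofree coalgebras -/

namespace DGCooperad

noncomputable section

variable (C : DGCooperad.{u}) {A : DGModule.{v}} {B : DGModule.{w}}

/-- The map `C(A) → C(B)` induced by equivariant maps `C(n) ⊗ A^{⊗n} → C(n) ⊗ B^{⊗n}`. -/
def cofreeLift (Φ : ∀ n, C.Pre A n →ₗ[ℚ] C.Pre B n)
    (h : ∀ (n : ℕ) (σ : Equiv.Perm (Fin n)), Φ n ∘ₗ C.act A σ = C.act B σ ∘ₗ Φ n) :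
    C.Cofree A →ₗ[ℚ] C.Cofree B :=
  DirectSum.lmap fun n => (C.coinvKer A n).mapQ (C.coinvKer B n) (Φ n) <| by
    rw [coinvKer, Submodule.span_le]
    rintro _ ⟨⟨σ, x⟩, rfl⟩
    refine Submodule.subset_span ⟨(σ, Φ n x), ?_⟩
    have := LinearMap.congr_fun (h n σ) x
    simp only [LinearMap.comp_apply] at this
    simp only [map_sub, this]

theorem cofreeLift_toCofree (Φ : ∀ n, C.Pre A n →ₗ[ℚ] C.Pre B n)
    (h : ∀ (n : ℕ) (σ : Equiv.Perm (Fin n)), Φ n ∘ₗ C.act A σ = C.act B σ ∘ₗ Φ n)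
    (n : ℕ) (x : C.Pre A n) :
    C.cofreeLift Φ h (C.toCofree A n x) = C.toCofree B n (Φ n x) := by
  simp [cofreeLift, toCofree]

theorem cofreeEps_toCofree (n : ℕ) (x : C.Pre A n) :
    C.cofreeEps A (C.toCofree A n x) = C.toCofree A n
      (TensorProduct.map (C.obj n).eps (PiTensorProduct.map fun _ : Fin n => A.eps) x) := by
  simp [cofreeEps, toCofree]

theorem cofreeD_toCofree (n : ℕ) (x : C.Pre A n) :
    C.cofreeD A (C.toCofree A n x) = C.toCofree A n (tensorD (C.obj n) (fun _ => A) x) := by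
  simp [cofreeD, toCofree]

theorem coaction_toCofree (n k : ℕ) (x : C.Pre A n) :
    C.coaction A k (C.toCofree A n x) = C.preCoaction A n k x := by
  simp [coaction, toCofree]

theorem cofree_ext {W : Type*} [AddCommMonoid W] [Module ℚ W] {α β : C.Cofree A →ₗ[ℚ] W}
    (h : ∀ n, α ∘ₗ C.toCofree A n = β ∘ₗ C.toCofree A n) : α = β := by
  refine DirectSum.linearMap_ext _ fun n => ?_
  refine LinearMap.ext fun x => ?_
  obtain ⟨z, rfl⟩ := Submodule.Quotient.mk_surjective _ x
  exact LinearMap.congr_fun (h n) z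

theorem exists_toCofree {n : ℕ} (x : C.Coinv A n) :
    ∃ z : C.Pre A n, C.toCofree A n z = DirectSum.lof ℚ ℕ (fun n => C.Coinv A n) n x := by
  obtain ⟨z, rfl⟩ := Submodule.Quotient.mk_surjective _ x
  exact ⟨z, rfl⟩

/-- The map `C(A) → C(B)` induced by a map `A → B` of degree zero. -/
def cofreeMap (φ : A →ₗ[ℚ] B) (hφ : ∀ e x, B.par e (φ x) = φ (A.par e x)) :
    C.Cofree A →ₗ[ℚ] C.Cofree B :=
  C.cofreeLift (fun n => LinearMap.lTensor (C.obj n) (PiTensorProduct.map fun _ : Fin n => φ)) <| by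
    intro n σ
    have h := permTensor_map_hom A B σ φ hφ
    rw [act, act, LinearMap.lTensor, ← TensorProduct.map_comp, ← TensorProduct.map_comp, h,
      LinearMap.id_comp, LinearMap.comp_id]

/-- The coderivation of `C(A)` induced by a map `A → A` of odd degree. -/
def cofreeDer (φ : A →ₗ[ℚ] A) (hφ : ∀ e x, A.par (e + 1) (φ x) = φ (A.par e x)) :
    C.Cofree A →ₗ[ℚ] C.Cofree A :=
  C.cofreeLift (fun n => TensorProduct.map (C.obj n).eps
    (tensorDer (fun _ : Fin n => A.eps) fun _ => φ)) <| by
    intro n σ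
    have h1 : (C.obj n).eps ∘ₗ C.map σ = C.map σ ∘ₗ (C.obj n).eps :=
      LinearMap.ext fun c => C.map_eps σ c
    rw [act, ← TensorProduct.map_comp, ← TensorProduct.map_comp, h1,
      permTensor_tensorDer_of_odd A σ φ hφ]

variable (A) in
/-- The differential of `C(A)` induced by that of `C`. -/
def cofreeInternal : C.Cofree A →ₗ[ℚ] C.Cofree A :=
  C.cofreeLift (fun n => LinearMap.rTensor _ (C.obj n).d) <| by
    intro n σ
    have h1 : (C.obj n).d ∘ₗ C.map σ = C.map σ ∘ₗ (C.obj n).d :=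
      LinearMap.ext fun c => (C.map_d σ c).symm
    rw [act, LinearMap.rTensor, ← TensorProduct.map_comp, ← TensorProduct.map_comp, h1,
      LinearMap.id_comp, LinearMap.comp_id]

theorem cofreeMap_toCofree (φ : A →ₗ[ℚ] B) (hφ : ∀ e x, B.par e (φ x) = φ (A.par e x)) (n : ℕ)
    (x : C.Pre A n) : C.cofreeMap φ hφ (C.toCofree A n x) = C.toCofree B n
      (LinearMap.lTensor (C.obj n) (PiTensorProduct.map fun _ : Fin n => φ) x) :=
  C.cofreeLift_toCofree _ _ n x

theorem cofreeDer_toCofree (φ : A →ₗ[ℚ] A) (hφ : ∀ e x, A.par (e + 1) (φ x) = φ (A.par e x))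
    (n : ℕ) (x : C.Pre A n) : C.cofreeDer φ hφ (C.toCofree A n x) = C.toCofree A n
      (TensorProduct.map (C.obj n).eps (tensorDer (fun _ : Fin n => A.eps) fun _ => φ) x) :=
  C.cofreeLift_toCofree _ _ n x

theorem cofreeInternal_toCofree (n : ℕ) (x : C.Pre A n) :
    C.cofreeInternal A (C.toCofree A n x) = C.toCofree A n (LinearMap.rTensor _ (C.obj n).d x) :=
  C.cofreeLift_toCofree _ _ n x

/-- Separating the two contributions makes the part coming from `A` an instance of the coderivations
`cofreeDer`, treated together with the one induced by `h`. -/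
theorem cofreeD_eq : C.cofreeD A = C.cofreeInternal A + C.cofreeDer A.d A.d_par := by
  apply cofree_ext
  intro n
  refine LinearMap.ext fun x => ?_
  simp only [LinearMap.comp_apply, LinearMap.add_apply]
  rw [cofreeD_toCofree, cofreeInternal_toCofree, cofreeDer_toCofree,
    ← map_add]
  rfl

/-! ### Compatibility with the structure maps -/

/-- The structure map first decomposes `C(n)` and then regroups. This reduces its compatibility with
operators to one commuting square for the regrouping, once the operators on `C(n)` have been carried
through the decomposition. -/
theorem lTensor_assoc_map {P P' M M' N N' Q Q' : Type*} [AddCommMonoid P] [Module ℚ P]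
    [AddCommMonoid P'] [Module ℚ P'] [AddCommMonoid M] [Module ℚ M] [AddCommMonoid M'] [Module ℚ M']
    [AddCommMonoid N] [Module ℚ N] [AddCommMonoid N'] [Module ℚ N'] [AddCommMonoid Q] [Module ℚ Q]
    [AddCommMonoid Q'] [Module ℚ Q'] (α : P →ₗ[ℚ] P') (E : M →ₗ[ℚ] M') (T : N →ₗ[ℚ] N')
    (K : M ⊗[ℚ] N →ₗ[ℚ] Q) (K' : M' ⊗[ℚ] N' →ₗ[ℚ] Q') (δ : Q →ₗ[ℚ] Q')
    (h : K' ∘ₗ TensorProduct.map E T = δ ∘ₗ K) (z : P ⊗[ℚ] M) (y : N) :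
    LinearMap.lTensor P' K' (TensorProduct.assoc ℚ _ _ _ (TensorProduct.map α E z ⊗ₜ T y)) =
      TensorProduct.map α δ (LinearMap.lTensor P K (TensorProduct.assoc ℚ _ _ _ (z ⊗ₜ y))) := by
  induction z with
  | zero => simp
  | tmul p m =>
    have := LinearMap.congr_fun h (m ⊗ₜ y)
    simp only [LinearMap.comp_apply, TensorProduct.map_tmul] at this
    simp [this]
  | add a b ha hb => simp only [map_add, TensorProduct.add_tmul, ha, hb]

variable (A) in
/-- The regrouping `(⨂ᵢ C(f⁻¹(i))) ⊗ A^{⊗n} → C(A)^{⊗k}`. -/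
def regroupCofree {n k : ℕ} (f : Fin n → Fin k) :
    ((⨂[ℚ] i, C.obj (fiberCard f i)) ⊗[ℚ] (⨂[ℚ] _t : Fin n, A)) →ₗ[ℚ]
      ⨂[ℚ] _i : Fin k, C.Cofree A :=
  PiTensorProduct.map (fun i => C.toCofree A (fiberCard f i)) ∘ₗ
    koszulRegroup f (fun i => C.obj (fiberCard f i)) fun _ => A

theorem preCoaction_tmul (n k : ℕ) (c : C.obj n) (a : ⨂[ℚ] _i : Fin n, A) :
    C.preCoaction A n k (c ⊗ₜ a) = ∑ f : Fin n → Fin k, LinearMap.lTensor (C.obj k)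
      (C.regroupCofree A f) (TensorProduct.assoc ℚ _ _ _ (C.decomp f c ⊗ₜ a)) := by
  simp only [preCoaction, LinearMap.sum_apply]
  rfl

/-- Decomposition preserves degree, and the sign of a total degree is the product of the signs of
the factors. This distributes the sign in front of a coderivation over `C(k)` and the fibres. -/
theorem decomp_eps {n k : ℕ} (f : Fin n → Fin k) (c : C.obj n) :
    C.decomp f ((C.obj n).eps c) = TensorProduct.map (C.obj k).eps
      (PiTensorProduct.map fun i => (C.obj (fiberCard f i)).eps) (C.decomp f c) := by
  have : C.decomp f ∘ₗ (C.obj n).eps = TensorProduct.map (C.obj k).eps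
      (PiTensorProduct.map fun i => (C.obj (fiberCard f i)).eps) ∘ₗ C.decomp f := by
    apply DGModule.hom_ext
    intro i c hc
    rw [LinearMap.comp_apply, LinearMap.comp_apply, DGModule.eps_of_mem _ hc, map_smul]
    have h := C.decomp_deg f i c hc
    clear hc
    generalize C.decomp f c = z at h
    induction h using Submodule.span_induction with
    | mem z hz =>
      obtain ⟨p, q, c, x, hc, hx, rfl, rfl⟩ := hz
      rw [TensorProduct.map_tmul, DGModule.eps_of_mem _ hc,
        map_eps_tprod (fun i => C.obj (fiberCard f i)) (fun j => (q j : ZMod 2)) x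
          (fun j => by rw [DGModule.par_of_mem _ _ (hx j), if_pos rfl]),
        TensorProduct.smul_tmul_smul]
      congr 1
      have hadd : ∀ a b : ZMod 2, ksgn 1 (a + b) = ksgn 1 a * ksgn 1 b := by
        have : ∀ a b : ZMod 2, (a = 0 ∨ a = 1) ∧ (b = 0 ∨ b = 1) := by decide
        intro a b
        have h11 : (1 : ZMod 2) + 1 = 0 := by decide
        obtain ⟨rfl | rfl, rfl | rfl⟩ := this a b <;> simp [ksgn, h11]
      have hsum : ∀ s : Finset (Fin k), ksgn 1 (∑ j ∈ s, (q j : ZMod 2)) =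
          ∏ j ∈ s, ksgn 1 (q j : ZMod 2) := by
        intro s
        induction s using Finset.induction_on with
        | empty => simp [ksgn]
        | insert a s ha ih => rw [Finset.sum_insert ha, Finset.prod_insert ha, hadd, ih]
      push_cast
      rw [hadd, hsum]
    | zero => simp
    | add a b _ _ ha hb => rw [smul_add, map_add, ha, hb]
    | smul r a _ ha => rw [map_smul, smul_comm, ha]
  exact LinearMap.congr_fun this c

theorem coaction_ext {W : Type*} [AddCommMonoid W] [Module ℚ W] {α β : C.Cofree A →ₗ[ℚ] W}
    (h : ∀ (n : ℕ) (c : C.obj n) (a : ⨂[ℚ] _i : Fin n, A),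
      α (C.toCofree A n (c ⊗ₜ a)) = β (C.toCofree A n (c ⊗ₜ a))) : α = β :=
  C.cofree_ext fun n => TensorProduct.ext' fun c a => h n c a

theorem coaction_cofreeMap (φ : A →ₗ[ℚ] B) (hφ : ∀ e x, B.par e (φ x) = φ (A.par e x)) (k : ℕ) :
    C.coaction B k ∘ₗ C.cofreeMap φ hφ = LinearMap.lTensor (C.obj k)
      (PiTensorProduct.map fun _ => C.cofreeMap φ hφ) ∘ₗ C.coaction A k := by
  apply coaction_ext
  intro n c a
  rw [LinearMap.comp_apply, LinearMap.comp_apply, cofreeMap_toCofree, coaction_toCofree,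
    coaction_toCofree, LinearMap.lTensor_tmul, preCoaction_tmul, preCoaction_tmul, map_sum]
  refine Finset.sum_congr rfl fun f _ => ?_
  have h := lTensor_assoc_map (LinearMap.id : C.obj k →ₗ[ℚ] C.obj k) LinearMap.id
    (PiTensorProduct.map fun _ : Fin n => φ) (C.regroupCofree A f) (C.regroupCofree B f)
    (PiTensorProduct.map fun _ => C.cofreeMap φ hφ) ?_ (C.decomp f c) a
  · rw [TensorProduct.map_id] at h
    exact h
  · have h1 := koszulRegroup_map_right f (fun i => C.obj (fiberCard f i)) A B φ hφ
    rw [regroupCofree, regroupCofree, LinearMap.comp_assoc]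
    refine (congrArg _ h1).trans ?_
    rw [← LinearMap.comp_assoc, ← LinearMap.comp_assoc, ← PiTensorProduct.map_comp,
      ← PiTensorProduct.map_comp]
    congr 2
    funext i
    exact LinearMap.ext fun z => (C.cofreeMap_toCofree φ hφ _ z).symm

/-- The sign `ε` on `C(n)` splits by `decomp_eps`: the part on `C(k)` is the sign in the
coderivation rule, and the parts on the fibres are what `koszulRegroup_tensorDer_right` requires. -/
theorem coaction_cofreeDer (φ : A →ₗ[ℚ] A) (hφ : ∀ e x, A.par (e + 1) (φ x) = φ (A.par e x))
    (k : ℕ) :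
    C.coaction A k ∘ₗ C.cofreeDer φ hφ = TensorProduct.map (C.obj k).eps
      (tensorDer (fun _ => C.cofreeEps A) fun _ => C.cofreeDer φ hφ) ∘ₗ C.coaction A k := by
  apply coaction_ext
  intro n c a
  rw [LinearMap.comp_apply, LinearMap.comp_apply, cofreeDer_toCofree, coaction_toCofree,
    coaction_toCofree, TensorProduct.map_tmul, preCoaction_tmul, preCoaction_tmul, map_sum]
  refine Finset.sum_congr rfl fun f _ => ?_
  rw [decomp_eps]
  refine lTensor_assoc_map (C.obj k).eps (PiTensorProduct.map fun i => (C.obj (fiberCard f i)).eps)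
    (tensorDer (fun _ : Fin n => A.eps) fun _ => φ) (C.regroupCofree A f) (C.regroupCofree A f)
    (tensorDer (fun _ => C.cofreeEps A) fun _ => C.cofreeDer φ hφ) ?_ (C.decomp f c) a
  have h1 := koszulRegroup_tensorDer_right f (fun i => C.obj (fiberCard f i)) A φ hφ
  rw [regroupCofree, LinearMap.comp_assoc, h1, ← LinearMap.comp_assoc, ← LinearMap.comp_assoc,
    map_comp_tensorDer _ _ (fun _ => C.cofreeEps A) (fun _ => C.cofreeDer φ hφ)]
  · intro i
    exact LinearMap.ext fun z => (C.cofreeEps_toCofree _ z).symm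
  · intro i
    exact LinearMap.ext fun z => (C.cofreeDer_toCofree φ hφ _ z).symm

/-- The two summands reflect those of the differential on `C(k) ⊗ ⨂ᵢ C(f⁻¹(i))`: one acts on `C(k)`,
the other on the fibres and is absorbed into the factors `C(A)`. -/
theorem coaction_cofreeInternal (k : ℕ) :
    C.coaction A k ∘ₗ C.cofreeInternal A = (LinearMap.rTensor _ (C.obj k).d +
      TensorProduct.map (C.obj k).eps
        (tensorDer (fun _ => C.cofreeEps A) fun _ => C.cofreeInternal A)) ∘ₗ C.coaction A k := by
  apply coaction_ext
  intro n c a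
  rw [LinearMap.comp_apply, LinearMap.comp_apply, cofreeInternal_toCofree,
    coaction_toCofree, coaction_toCofree, LinearMap.rTensor_tmul, preCoaction_tmul,
    preCoaction_tmul, map_sum]
  refine Finset.sum_congr rfl fun f _ => ?_
  rw [C.decomp_d, tensorD, LinearMap.add_apply, TensorProduct.add_tmul, map_add, map_add,
    LinearMap.add_apply]
  congr 1
  · have h := lTensor_assoc_map (C.obj k).d LinearMap.id LinearMap.id (C.regroupCofree A f)
      (C.regroupCofree A f) LinearMap.id
      (by rw [TensorProduct.map_id, LinearMap.id_comp, LinearMap.comp_id]) (C.decomp f c) a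
    exact h
  · refine lTensor_assoc_map (C.obj k).eps
      (tensorDer (fun i => (C.obj (fiberCard f i)).eps) fun i => (C.obj (fiberCard f i)).d)
      LinearMap.id (C.regroupCofree A f) (C.regroupCofree A f)
      (tensorDer (fun _ => C.cofreeEps A) fun _ => C.cofreeInternal A) ?_ (C.decomp f c) a
    have h1 := koszulRegroup_tensorDer_left f (fun i => C.obj (fiberCard f i)) A
      (fun i => (C.obj (fiberCard f i)).d) fun i => (C.obj (fiberCard f i)).d_par
    rw [regroupCofree, LinearMap.comp_assoc]
    refine (congrArg _ h1).trans ?_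
    rw [← LinearMap.comp_assoc, ← LinearMap.comp_assoc,
      map_comp_tensorDer _ _ (fun _ => C.cofreeEps A) (fun _ => C.cofreeInternal A)]
    · intro i
      exact LinearMap.ext fun z => (C.cofreeEps_toCofree _ z).symm
    · intro i
      exact LinearMap.ext fun z => (C.cofreeInternal_toCofree _ z).symm

theorem coaction_cofreeD (k : ℕ) :
    C.coaction A k ∘ₗ C.cofreeD A = (LinearMap.rTensor _ (C.obj k).d +
      TensorProduct.map (C.obj k).eps
        (tensorDer (fun _ => C.cofreeEps A) fun _ => C.cofreeD A)) ∘ₗ C.coaction A k := by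
  rw [cofreeD_eq, LinearMap.comp_add, coaction_cofreeInternal, coaction_cofreeDer, tensorDer_add,
    TensorProduct.map_add_right]
  simp only [LinearMap.add_comp, add_assoc]

end

end DGCooperad

/-! ### Degrees, weights and anticommutators on cofree coalgebras -/

namespace DGCooperad

noncomputable section

/-- The additive group `C(A)`, as an extension of its additive monoid structure. -/
scoped instance (C : DGCooperad.{u}) (A : DGModule.{v}) : AddCommGroup (C.Cofree A) :=
  Module.addCommMonoidToAddCommGroup ℚ

variable (C : DGCooperad.{u}) {A : DGModule.{v}} {B : DGModule.{w}}

theorem cofreeDeg_le {i : ℤ} {p : Submodule ℚ (C.Cofree A)}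
    (h : ∀ (n : ℕ) (r : ℤ) (q : Fin n → ℤ) (c : C.obj n) (x : Fin n → A), c ∈ (C.obj n).deg r →
      (∀ j, x j ∈ A.deg (q j)) → r + ∑ j, q j = i →
      C.toCofree A n (c ⊗ₜ PiTensorProduct.tprod ℚ x) ∈ p) : C.cofreeDeg A i ≤ p := by
  refine iSup_le fun n => ?_
  rw [Submodule.map_le_iff_le_comap, tensorDeg, Submodule.span_le]
  rintro _ ⟨r, q, c, x, hc, hx, hi, rfl⟩
  exact h n r q c x hc hx hi

theorem toCofree_mem_cofreeDeg {n : ℕ} {r i : ℤ} {q : Fin n → ℤ} {c : C.obj n} {x : Fin n → A}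
    (hc : c ∈ (C.obj n).deg r) (hx : ∀ j, x j ∈ A.deg (q j)) (hi : r + ∑ j, q j = i) :
    C.toCofree A n (c ⊗ₜ PiTensorProduct.tprod ℚ x) ∈ C.cofreeDeg A i :=
  Submodule.mem_iSup_of_mem n
    (Submodule.mem_map_of_mem (Submodule.subset_span ⟨r, q, c, x, hc, hx, hi, rfl⟩))

theorem span_homogeneous (A : DGModule.{v}) (x : A) :
    x ∈ Submodule.span ℚ {a : A | ∃ q, a ∈ A.deg q} := by
  have h : (⊤ : Submodule ℚ A) ≤ Submodule.span ℚ {a : A | ∃ q, a ∈ A.deg q} := by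
    rw [← A.isInternal.submodule_iSup_eq_top]
    exact iSup_le fun q a ha => Submodule.subset_span ⟨q, ha⟩
  exact h Submodule.mem_top

/-- A submodule containing all `c ⊗ a₁ ⊗ ⋯ ⊗ aₙ`, where `c` is homogeneous and the `aᵢ` belong to a
spanning set, contains everything of weight `n`. -/
theorem toCofree_mem_of_span {p : Submodule ℚ (C.Cofree A)} (S : Set A)
    (hS : ∀ x, x ∈ Submodule.span ℚ S) (n : ℕ)
    (h : ∀ (r : ℤ) (c : C.obj n) (x : Fin n → A), c ∈ (C.obj n).deg r → (∀ j, x j ∈ S) →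
      C.toCofree A n (c ⊗ₜ PiTensorProduct.tprod ℚ x) ∈ p) (z : C.Pre A n) :
    C.toCofree A n z ∈ p := by
  induction z using TensorProduct.induction_on with
  | zero => rw [map_zero]; exact p.zero_mem
  | add a b ha hb => rw [map_add]; exact p.add_mem ha hb
  | tmul c a =>
    have ha : a ∈ Submodule.span ℚ
        (Set.range (PiTensorProduct.tprod ℚ (s := fun _ : Fin n => (A : Type v)))) := by
      rw [PiTensorProduct.span_tprod_eq_top]; trivial
    induction ha using Submodule.span_induction with
    | zero => rw [TensorProduct.tmul_zero, map_zero]; exact p.zero_mem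
    | add a b _ _ ha hb => rw [TensorProduct.tmul_add, map_add]; exact p.add_mem ha hb
    | smul t a _ ha => rw [TensorProduct.tmul_smul, map_smul]; exact p.smul_mem t ha
    | mem a ha =>
      obtain ⟨x, rfl⟩ := ha
      induction span_homogeneous (C.obj n) c using Submodule.span_induction with
      | zero => rw [TensorProduct.zero_tmul, map_zero]; exact p.zero_mem
      | add a b _ _ ha hb => rw [TensorProduct.add_tmul, map_add]; exact p.add_mem ha hb
      | smul t a _ ha =>
        rw [← TensorProduct.smul_tmul', map_smul]; exact p.smul_mem t ha
      | mem c hc =>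
        obtain ⟨r, hr⟩ := hc
        exact MultilinearMap.apply_mem_of_mem_span
          ((C.toCofree A n ∘ₗ TensorProduct.mk ℚ (C.obj n) _ c).compMultilinearMap
            (PiTensorProduct.tprod ℚ)) (fun _ => S) p (fun s hs => h r c s hr hs) x fun i => hS _

theorem cofree_hom_ext {W : Type*} [AddCommMonoid W] [Module ℚ W] {α β : C.Cofree A →ₗ[ℚ] W}
    (h : ∀ (i : ℤ) (x : C.Cofree A), x ∈ C.cofreeDeg A i → α x = β x) : α = β := by
  refine C.cofree_ext fun n => LinearMap.ext fun z => ?_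
  refine C.toCofree_mem_of_span (p := LinearMap.eqLocus α β) {a : A | ∃ q, a ∈ A.deg q}
    (span_homogeneous A) n (fun r c x hc hx => ?_) z
  choose q hq using hx
  exact h _ _ (C.toCofree_mem_cofreeDeg hc hq rfl)

theorem ksgn_one_add (a b : ZMod 2) : ksgn 1 (a + b) = ksgn 1 a * ksgn 1 b := by
  have : ∀ a b : ZMod 2, (a = 0 ∨ a = 1) ∧ (b = 0 ∨ b = 1) := by decide
  have h11 : (1 : ZMod 2) + 1 = 0 := by decide
  obtain ⟨rfl | rfl, rfl | rfl⟩ := this a b <;> simp [ksgn, h11]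

theorem ksgn_one_sum {k : ℕ} (q : Fin k → ZMod 2) : ksgn 1 (∑ j, q j) = ∏ j, ksgn 1 (q j) := by
  have hsum : ∀ s : Finset (Fin k), ksgn 1 (∑ j ∈ s, q j) = ∏ j ∈ s, ksgn 1 (q j) := by
    intro s
    induction s using Finset.induction_on with
    | empty => simp [ksgn]
    | insert a s ha ih => rw [Finset.sum_insert ha, Finset.prod_insert ha, ksgn_one_add, ih]
  exact hsum Finset.univ

theorem cofreeEps_of_mem {i : ℤ} {x : C.Cofree A} (hx : x ∈ C.cofreeDeg A i) :
    C.cofreeEps A x = ksgn 1 i • x := by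
  refine C.cofreeDeg_le (p := LinearMap.eqLocus (C.cofreeEps A) (ksgn 1 i • LinearMap.id))
    (fun n r q c x hc hx hi => ?_) hx
  rw [LinearMap.mem_eqLocus, cofreeEps_toCofree, TensorProduct.map_tmul, DGModule.eps_of_mem _ hc,
    map_eps_tprod (fun _ => A) (fun j => (q j : ZMod 2)) x
      (fun j => by rw [DGModule.par_of_mem _ _ (hx j), if_pos rfl]),
    TensorProduct.smul_tmul_smul, map_smul, ← hi]
  push_cast
  rw [ksgn_one_add, ksgn_one_sum]
  rfl

theorem cofreeEps_cofreeEps : C.cofreeEps A ∘ₗ C.cofreeEps A = LinearMap.id := by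
  refine C.cofree_hom_ext fun i x hx => ?_
  rw [LinearMap.comp_apply, C.cofreeEps_of_mem hx, map_smul, C.cofreeEps_of_mem hx, smul_smul,
    ksgn_mul_self, one_smul, LinearMap.id_apply]

/-- Anticommutation with the grading involution is the form of oddness needed in
`tensorDer_anticomm`, applied with `V = C(A)`. -/
theorem cofreeEps_odd (φ : C.Cofree A →ₗ[ℚ] C.Cofree A) (r : ℤ) (hr : (r : ZMod 2) = 1)
    (hφ : ∀ (i : ℤ) (x : C.Cofree A), x ∈ C.cofreeDeg A i → φ x ∈ C.cofreeDeg A (i + r)) :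
    C.cofreeEps A ∘ₗ φ = -(φ ∘ₗ C.cofreeEps A) := by
  refine C.cofree_hom_ext fun i x hx => ?_
  have h1 : ksgn 1 1 = -1 := by simp [ksgn]
  rw [LinearMap.neg_apply, LinearMap.comp_apply, LinearMap.comp_apply, C.cofreeEps_of_mem hx,
    C.cofreeEps_of_mem (hφ i x hx), map_smul, Int.cast_add, hr, ksgn_one_add, h1]
  simp

theorem cofreeEps_even (φ : C.Cofree A →ₗ[ℚ] C.Cofree B)
    (hφ : ∀ (i : ℤ) (x : C.Cofree A), x ∈ C.cofreeDeg A i → φ x ∈ C.cofreeDeg B i) :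
    φ ∘ₗ C.cofreeEps A = C.cofreeEps B ∘ₗ φ := by
  refine C.cofree_hom_ext fun i x hx => ?_
  rw [LinearMap.comp_apply, LinearMap.comp_apply, C.cofreeEps_of_mem hx,
    C.cofreeEps_of_mem (hφ i x hx), map_smul]

theorem cofreeMap_mem (φ : A →ₗ[ℚ] B) (hφ : ∀ e x, B.par e (φ x) = φ (A.par e x))
    (hφ' : ∀ (i : ℤ) (x : A), x ∈ A.deg i → φ x ∈ B.deg i) {i : ℤ} {x : C.Cofree A}
    (hx : x ∈ C.cofreeDeg A i) : C.cofreeMap φ hφ x ∈ C.cofreeDeg B i := by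
  refine C.cofreeDeg_le (p := (C.cofreeDeg B i).comap (C.cofreeMap φ hφ))
    (fun n r q c x hc hx hi => ?_) hx
  rw [Submodule.mem_comap, cofreeMap_toCofree, LinearMap.lTensor_tmul, PiTensorProduct.map_tprod]
  exact C.toCofree_mem_cofreeDeg hc (fun j => hφ' _ _ (hx j)) hi

theorem cofreeDer_mem (φ : A →ₗ[ℚ] A) (hφ : ∀ e x, A.par (e + 1) (φ x) = φ (A.par e x)) (s : ℤ)
    (hφ' : ∀ (i : ℤ) (x : A), x ∈ A.deg i → φ x ∈ A.deg (i + s)) (i : ℤ) (x : C.Cofree A)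
    (hx : x ∈ C.cofreeDeg A i) : C.cofreeDer φ hφ x ∈ C.cofreeDeg A (i + s) := by
  refine C.cofreeDeg_le (p := (C.cofreeDeg A (i + s)).comap (C.cofreeDer φ hφ))
    (fun n r q c x hc hx hi => ?_) hx
  rw [Submodule.mem_comap, cofreeDer_toCofree, TensorProduct.map_tmul, DGModule.eps_of_mem _ hc,
    tensorDer_eps_tprod (fun _ => A) (fun _ => φ) (fun j => (q j : ZMod 2)) x
      (fun j => by rw [DGModule.par_of_mem _ _ (hx j), if_pos rfl]), TensorProduct.tmul_sum,
    map_sum]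
  refine Submodule.sum_mem _ fun l _ => ?_
  rw [TensorProduct.smul_tmul_smul, map_smul]
  refine Submodule.smul_mem _ _ (C.toCofree_mem_cofreeDeg (q := Function.update q l (q l + s)) hc
    (fun j => ?_) ?_)
  · by_cases h : j = l
    · subst h
      rw [Function.update_self, Function.update_self]
      exact hφ' _ _ (hx j)
    · rw [Function.update_of_ne h, Function.update_of_ne h]
      exact hx j
  · rw [Finset.sum_update_of_mem (Finset.mem_univ l), ← hi,
      ← Finset.add_sum_erase Finset.univ q (Finset.mem_univ l), Finset.sdiff_singleton_eq_erase]
    ring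

theorem cofreeD_mem (i : ℤ) (x : C.Cofree A) (hx : x ∈ C.cofreeDeg A i) :
    C.cofreeD A x ∈ C.cofreeDeg A (i + -1) := by
  rw [cofreeD_eq]
  refine Submodule.add_mem _ ?_ (C.cofreeDer_mem A.d _ (-1) A.d_mem i x hx)
  refine C.cofreeDeg_le (p := (C.cofreeDeg A (i + -1)).comap (C.cofreeInternal A))
    (fun n r q c x hc hx hi => ?_) hx
  rw [Submodule.mem_comap, cofreeInternal_toCofree, LinearMap.rTensor_tmul]
  exact C.toCofree_mem_cofreeDeg ((C.obj n).d_mem r c hc) hx (by rw [← hi]; ring)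

/-! ### Weights -/

variable (A) in
/-- The part of `C(A)` of weights `< w`. -/
def weightLT (w : ℕ) : Submodule ℚ (C.Cofree A) where
  carrier := {x | ∀ v, w ≤ v → x v = 0}
  zero_mem' := fun _ _ => rfl
  add_mem' := fun {x y} hx hy v hv => by
    rw [DirectSum.add_apply, hx v hv, hy v hv, add_zero]
  smul_mem' := fun c x hx v hv => by
    rw [DirectSum.smul_apply, hx v hv, smul_zero]

theorem toCofree_mem_weightLT {n w : ℕ} (h : n < w) (x : C.Pre A n) :
    C.toCofree A n x ∈ C.weightLT A w := fun v hv =>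
  DirectSum.of_eq_of_ne n v _ (by omega)

theorem weightLT_le {w : ℕ} {p : Submodule ℚ (C.Cofree A)}
    (h : ∀ n, n < w → ∀ x : C.Pre A n, C.toCofree A n x ∈ p) : C.weightLT A w ≤ p := by
  classical
  intro x hx
  rw [← DirectSum.sum_support_of x]
  refine Submodule.sum_mem _ fun n hn => ?_
  obtain ⟨z, hz⟩ := C.exists_toCofree (x n)
  have hz' : C.toCofree A n z = DirectSum.of (fun n => C.Coinv A n) n (x n) := hz
  rw [← hz']
  refine h n ?_ z
  by_contra hnw
  exact (DFinsupp.mem_support_iff.mp hn) (hx n (not_lt.mp hnw))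

theorem weightLT_mono {v w : ℕ} (h : v ≤ w) : C.weightLT A v ≤ C.weightLT A w :=
  fun _ hx n hn => hx n (h.trans hn)

theorem weightLT_zero {x : C.Cofree A} (hx : x ∈ C.weightLT A 0) : x = 0 :=
  DFinsupp.ext fun n => hx n (Nat.zero_le n)

theorem exists_mem_weightLT (x : C.Cofree A) : ∃ w, x ∈ C.weightLT A w := by
  classical
  refine ⟨(DFinsupp.support x).sup id + 1, fun v hv => ?_⟩
  by_contra h
  have := Finset.le_sup (f := id) (DFinsupp.mem_support_iff.mpr h)
  simp only [id] at this
  omega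

theorem lmap_mem_weightLT (Φ : ∀ n, C.Coinv A n →ₗ[ℚ] C.Coinv B n) {w : ℕ} {x : C.Cofree A}
    (hx : x ∈ C.weightLT A w) : DirectSum.lmap Φ x ∈ C.weightLT B w := fun v hv => by
  rw [DirectSum.lmap_apply, hx v hv, map_zero]

theorem cofreeMap_mem_weightLT (φ : A →ₗ[ℚ] B) (hφ : ∀ e x, B.par e (φ x) = φ (A.par e x))
    {w : ℕ} {x : C.Cofree A} (hx : x ∈ C.weightLT A w) : C.cofreeMap φ hφ x ∈ C.weightLT B w :=
  C.lmap_mem_weightLT _ hx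

theorem cofreeDer_mem_weightLT (φ : A →ₗ[ℚ] A) (hφ : ∀ e x, A.par (e + 1) (φ x) = φ (A.par e x))
    {w : ℕ} {x : C.Cofree A} (hx : x ∈ C.weightLT A w) : C.cofreeDer φ hφ x ∈ C.weightLT A w :=
  C.lmap_mem_weightLT _ hx

theorem lof_mem_weightLT (w : ℕ) (x : C.Coinv A w) :
    DirectSum.lof ℚ ℕ (fun n => C.Coinv A n) w x ∈ C.weightLT A (w + 1) := by
  obtain ⟨z, hz⟩ := C.exists_toCofree x
  rw [← hz]
  exact C.toCofree_mem_weightLT w.lt_succ_self z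

/-- In terms of the filtration by weights `< w`, lowering weight becomes a shift of the index by
one; with `weightLT_zero` this makes `b` locally nilpotent. -/
theorem PInfty.mem_weightLT {C : DGCooperad.{u}} (b : C.PInfty A) (w : ℕ) (x : C.Cofree A)
    (hx : x ∈ C.weightLT A (w + 1)) : b.b x ∈ C.weightLT A w := by
  refine C.weightLT_le (p := (C.weightLT A w).comap b.b) (fun n hn z v hv => ?_) hx
  exact b.decreases_weight n _ v ((Nat.lt_succ_iff.mp hn).trans hv)

/-! ### Identities between induced maps -/

theorem cofreeMap_comp_eq_zero_of_der (φ : A →ₗ[ℚ] B)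
    (hφ : ∀ e x, B.par e (φ x) = φ (A.par e x)) (h : A →ₗ[ℚ] A)
    (hh : ∀ e x, A.par (e + 1) (h x) = h (A.par e x)) (h0 : φ ∘ₗ h = 0) :
    C.cofreeMap φ hφ ∘ₗ C.cofreeDer h hh = 0 := by
  refine C.cofree_ext fun n => TensorProduct.ext' fun c a => ?_
  have h1 := LinearMap.congr_fun (map_comp_tensorDer (fun _ : Fin n => A.eps) (fun _ => h)
    (fun _ => B.eps) (fun _ => 0) (fun _ => φ) (fun _ => DGModule.eps_even φ hφ)
    (fun _ => by rw [h0, LinearMap.zero_comp])) a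
  rw [LinearMap.comp_apply, tensorDer_zero, LinearMap.zero_comp] at h1
  rw [LinearMap.comp_apply, LinearMap.comp_apply, cofreeDer_toCofree, cofreeMap_toCofree,
    TensorProduct.map_tmul, LinearMap.lTensor_tmul, h1]
  simp

theorem cofreeDer_comp_eq_zero_of_map (φ : B →ₗ[ℚ] A)
    (hφ : ∀ e x, A.par e (φ x) = φ (B.par e x)) (h : A →ₗ[ℚ] A)
    (hh : ∀ e x, A.par (e + 1) (h x) = h (A.par e x)) (h0 : h ∘ₗ φ = 0) :
    C.cofreeDer h hh ∘ₗ C.cofreeMap φ hφ = 0 := by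
  refine C.cofree_ext fun n => TensorProduct.ext' fun c a => ?_
  have h1 := LinearMap.congr_fun (map_comp_tensorDer (fun _ : Fin n => B.eps) (fun _ => 0)
    (fun _ => A.eps) (fun _ => h) (fun _ => φ) (fun _ => DGModule.eps_even φ hφ)
    (fun _ => by rw [h0, LinearMap.comp_zero])) a
  rw [tensorDer_zero, LinearMap.comp_zero, LinearMap.comp_apply] at h1
  rw [LinearMap.comp_apply, LinearMap.comp_apply, cofreeMap_toCofree, cofreeDer_toCofree,
    LinearMap.lTensor_tmul, TensorProduct.map_tmul, ← h1]
  simp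

theorem cofreeMap_comp_cofreeD (φ : A →ₗ[ℚ] B) (hφ : ∀ e x, B.par e (φ x) = φ (A.par e x))
    (hd : φ ∘ₗ A.d = B.d ∘ₗ φ) :
    C.cofreeMap φ hφ ∘ₗ C.cofreeD A = C.cofreeD B ∘ₗ C.cofreeMap φ hφ := by
  refine C.cofree_ext fun n => TensorProduct.ext' fun c a => ?_
  have h1 := LinearMap.congr_fun (map_comp_tensorDer (fun _ : Fin n => A.eps) (fun _ => A.d)
    (fun _ => B.eps) (fun _ => B.d) (fun _ => φ) (fun _ => DGModule.eps_even φ hφ)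
    (fun _ => hd)) a
  rw [LinearMap.comp_apply, LinearMap.comp_apply] at h1
  simp only [LinearMap.comp_apply, cofreeMap_toCofree, cofreeD_toCofree, tensorD,
    LinearMap.add_apply, LinearMap.lTensor_tmul, TensorProduct.map_tmul, LinearMap.id_apply,
    map_add, h1]

/-- The anticommutator of an odd derivation with itself is twice its square, and `2` is invertible
in `ℚ`. -/
theorem cofreeDer_comp_self (h : A →ₗ[ℚ] A) (hh : ∀ e x, A.par (e + 1) (h x) = h (A.par e x))
    (h0 : h ∘ₗ h = 0) : C.cofreeDer h hh ∘ₗ C.cofreeDer h hh = 0 := by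
  refine C.cofree_ext fun n => TensorProduct.ext' fun c a => ?_
  have h1 := LinearMap.congr_fun (tensorDer_anticomm (fun _ : Fin n => A.eps) (fun _ => h)
    (fun _ => h) (fun _ => A.eps_eps) (fun _ => DGModule.eps_odd h hh)
    (fun _ => DGModule.eps_odd h hh)) a
  simp only [h0, add_zero] at h1
  rw [tensorDer_zero, LinearMap.add_apply, LinearMap.comp_apply, ← two_smul ℚ] at h1
  have h2 := (smul_eq_zero.mp h1).resolve_left two_ne_zero
  rw [LinearMap.comp_apply, LinearMap.comp_apply, cofreeDer_toCofree, cofreeDer_toCofree,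
    TensorProduct.map_tmul, TensorProduct.map_tmul, h2]
  simp

/-- The anticommutator of the internal differential and an induced coderivation. -/
theorem cofreeD_anticomm (h : A →ₗ[ℚ] A) (hh : ∀ e x, A.par (e + 1) (h x) = h (A.par e x)) (n : ℕ)
    (c : C.obj n) (a : ⨂[ℚ] _i : Fin n, A) :
    C.cofreeD A (C.cofreeDer h hh (C.toCofree A n (c ⊗ₜ a))) +
        C.cofreeDer h hh (C.cofreeD A (C.toCofree A n (c ⊗ₜ a))) =
      C.toCofree A n (c ⊗ₜ tensorDer (fun _ : Fin n => LinearMap.id)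
        (fun _ => A.d ∘ₗ h + h ∘ₗ A.d) a) := by
  have h1 := LinearMap.congr_fun (tensorDer_anticomm (fun _ : Fin n => A.eps) (fun _ => A.d)
    (fun _ => h) (fun _ => A.eps_eps) (fun _ => DGModule.eps_odd A.d A.d_par)
    (fun _ => DGModule.eps_odd h hh)) a
  have h2 := LinearMap.congr_fun (DGModule.eps_odd (C.obj n).d (C.obj n).d_par) c
  have h3 : (C.obj n).eps ((C.obj n).eps c) = c := LinearMap.congr_fun (C.obj n).eps_eps c
  simp only [LinearMap.comp_apply, LinearMap.add_apply, LinearMap.neg_apply] at h1 h2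
  simp only [cofreeDer_toCofree, cofreeD_toCofree, tensorD, LinearMap.add_apply,
    TensorProduct.map_tmul, LinearMap.id_apply, map_add, h3, h2, TensorProduct.neg_tmul, map_neg]
  rw [← h1, TensorProduct.tmul_add, map_add]
  abel

end

end DGCooperad

/-! ### Perturbations of diagonalizable operators on filtered spaces -/

section Perturbation

variable {X : Type*} [AddCommGroup X] [Module ℚ X] {Y : Type*} [AddCommGroup Y] [Module ℚ Y]

/-- An operator whose eigenvectors with eigenvalues in `ℕ` span has a pseudo-inverse. -/
theorem exists_pseudoinverse (N : X →ₗ[ℚ] X)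
    (hN : ∀ x, x ∈ Submodule.span ℚ {y : X | ∃ j : ℕ, N y = (j : ℚ) • y}) :
    ∃ P : X →ₗ[ℚ] X, ∀ (j : ℕ) (x : X), N x = (j : ℚ) • x → P x = (j : ℚ)⁻¹ • x := by
  let E : ℕ → Submodule ℚ X := fun j => Module.End.eigenspace N (j : ℚ)
  have hind : iSupIndep E := (Module.End.eigenspaces_iSupIndep N).comp Nat.cast_injective
  have htop : iSup E = ⊤ := by
    rw [eq_top_iff]
    intro x _
    refine Submodule.span_le.mpr ?_ (hN x)
    rintro y ⟨j, hj⟩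
    exact Submodule.mem_iSup_of_mem j (Module.End.mem_eigenspace_iff.mpr hj)
  have hint := DirectSum.isInternal_submodule_of_iSupIndep_of_iSup_eq_top hind htop
  let e := LinearEquiv.ofBijective (DirectSum.coeLinearMap E) hint
  -- Since `0⁻¹ = 0` in `ℚ`, the same formula makes `P` vanish on the kernel of `N`.
  refine ⟨(DirectSum.toModule ℚ ℕ X fun j => (j : ℚ)⁻¹ • (E j).subtype) ∘ₗ e.symm.toLinearMap,
    fun j x hx => ?_⟩
  have hx' : x ∈ E j := Module.End.mem_eigenspace_iff.mpr hx
  have h : e.symm x = DirectSum.lof ℚ ℕ (fun j => E j) j ⟨x, hx'⟩ := by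
    rw [LinearEquiv.symm_apply_eq]
    exact (DirectSum.coeLinearMap_lof E j ⟨x, hx'⟩).symm
  simp [h]

variable {W : ℕ → Submodule ℚ X} (hW0 : ∀ x ∈ W 0, x = 0) (hW : ∀ x, ∃ w, x ∈ W w)

include hW0 hW

/-- If `T` is locally nilpotent, then `1 - T` has an inverse. -/
theorem exists_inverse_one_sub (T : X →ₗ[ℚ] X) (hT : ∀ w, ∀ x ∈ W (w + 1), T x ∈ W w) :
    ∃ S : X →ₗ[ℚ] X, (∀ x, S x = x + S (T x)) ∧ (∀ x, S x = x + T (S x)) ∧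
      ∀ U : Submodule ℚ X, (∀ x ∈ U, T x ∈ U) → ∀ x ∈ U, S x ∈ U := by
  have hinj : Function.Injective (LinearMap.id - T : X →ₗ[ℚ] X) := by
    rw [← LinearMap.ker_eq_bot, LinearMap.ker_eq_bot']
    intro x hx
    have hx' : x = T x := sub_eq_zero.mp hx
    have : ∀ w, x ∈ W w → x = 0 := by
      intro w
      induction w with
      | zero => exact hW0 x
      | succ w ih => exact fun h => ih (hx' ▸ hT w x h)
    obtain ⟨w, hw⟩ := hW x
    exact this w hw
  -- The geometric series, summed by induction on the filtration. Carrying an arbitrary invariant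
  -- subspace `U` along shows that the solution stays in `U`; this later gives that `S` respects
  -- degrees and weights.
  have hsurj : ∀ U : Submodule ℚ X, (∀ x ∈ U, T x ∈ U) → ∀ w, ∀ x ∈ W w, x ∈ U →
      ∃ y ∈ U, y - T y = x := by
    intro U hU w
    induction w with
    | zero => exact fun x hx _ => ⟨0, U.zero_mem, by rw [map_zero, sub_zero, hW0 x hx]⟩
    | succ w ih =>
      intro x hx hxU
      obtain ⟨y, hy, hyx⟩ := ih (T x) (hT w x hx) (hU x hxU)
      refine ⟨x + y, U.add_mem hxU hy, ?_⟩
      rw [map_add, ← hyx]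
      abel
  let e := LinearEquiv.ofBijective (LinearMap.id - T : X →ₗ[ℚ] X) ⟨hinj, fun x => by
    obtain ⟨w, hw⟩ := hW x
    obtain ⟨y, -, hy⟩ := hsurj ⊤ (fun _ _ => trivial) w x hw trivial
    exact ⟨y, hy⟩⟩
  have he : ∀ x, e x = x - T x := fun _ => rfl
  refine ⟨e.symm.toLinearMap, fun x => ?_, fun x => ?_, fun U hU x hx => ?_⟩
  · have h := e.symm_apply_apply x
    rw [he, map_sub] at h
    exact sub_eq_iff_eq_add.mp h
  · have h := e.apply_symm_apply x
    rw [he] at h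
    exact sub_eq_iff_eq_add.mp h
  · obtain ⟨w, hw⟩ := hW x
    obtain ⟨y, hy, hyx⟩ := hsurj U hU w x hw hx
    have : e.symm x = y := by rw [LinearEquiv.symm_apply_eq, he, hyx]
    exact this.symm ▸ hy

/-- A perturbation of an operator `N` by a locally nilpotent operator `Q` is injective on the
kernel of the projection to the kernel of `N`. -/
theorem eq_zero_of_perturbation (N P Q J : X →ₗ[ℚ] X) (hPN : ∀ x, P (N x) + J x = x)
    (hP : ∀ w, ∀ x ∈ W w, P x ∈ W w) (hQ : ∀ w, ∀ x ∈ W (w + 1), Q x ∈ W w) {z : X}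
    (hz : N z = Q z) (hJ : J z = 0) : z = 0 := by
  -- Here `z = P (Q z)`, and `PQ` strictly lowers the filtration, so `z` descends to `W 0`.
  have h := hPN z
  rw [hJ, add_zero, hz] at h
  have : ∀ w, z ∈ W w → z = 0 := by
    intro w
    induction w with
    | zero => exact hW0 z
    | succ w ih => exact fun hw => ih (h ▸ hP w _ (hQ w z hw))
  obtain ⟨w, hw⟩ := hW z
  exact this w hw

end Perturbation

/-! ### Perturbed derivations on tensor powers -/

section TensorKernel

/-- The derivation extension of `L = N - Q` to a tensor power, where `N` is spanned by eigenvectors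
with eigenvalues in `ℕ` and `Q` is locally nilpotent, is injective on the kernel of the projection
to the tensor power of the kernel of `N`. -/
theorem tensor_eq_zero_of_perturbation {V : Type*} [AddCommGroup V] [Module ℚ V] {X : Type*}
    [AddCommGroup X] [Module ℚ X] (W : ℕ → Submodule ℚ X) (hW0 : ∀ x ∈ W 0, x = 0)
    (hW : ∀ x, ∃ w, x ∈ W (w + 1)) (N Q L J : X →ₗ[ℚ] X) (hL : N = L + Q)
    (hE : ∀ w, ∀ x ∈ W w, x ∈ Submodule.span ℚ
      {y : X | y ∈ W w ∧ ∃ j : ℕ, N y = (j : ℚ) • y ∧ J y = if j = 0 then y else 0})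
    (hQ : ∀ w, ∀ x ∈ W (w + 1), Q x ∈ W w) (k : ℕ) (z : V ⊗[ℚ] (⨂[ℚ] _i : Fin k, X))
    (hz : LinearMap.lTensor V (tensorDer (fun _ : Fin k => LinearMap.id) fun _ => L) z = 0)
    (hJ : LinearMap.lTensor V (PiTensorProduct.map fun _ : Fin k => J) z = 0) : z = 0 := by
  set S : ℕ → Set X := fun w => {y : X | y ∈ W w ∧ ∃ j : ℕ, N y = (j : ℚ) • y ∧
    J y = if j = 0 then y else 0} with hS
  let NT : V ⊗[ℚ] (⨂[ℚ] _i : Fin k, X) →ₗ[ℚ] V ⊗[ℚ] (⨂[ℚ] _i : Fin k, X) :=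
    LinearMap.lTensor V (tensorDer (fun _ : Fin k => LinearMap.id) fun _ => N)
  let QT : V ⊗[ℚ] (⨂[ℚ] _i : Fin k, X) →ₗ[ℚ] V ⊗[ℚ] (⨂[ℚ] _i : Fin k, X) :=
    LinearMap.lTensor V (tensorDer (fun _ : Fin k => LinearMap.id) fun _ => Q)
  let JT : V ⊗[ℚ] (⨂[ℚ] _i : Fin k, X) →ₗ[ℚ] V ⊗[ℚ] (⨂[ℚ] _i : Fin k, X) :=
    LinearMap.lTensor V (PiTensorProduct.map fun _ : Fin k => J)
  -- The filtration level of a pure tensor is the sum of those of its factors, normalized by `u i +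
  -- 1` so that lowering a factor with `u i = 0` lands in `W 0` and gives zero. The strict
  -- inequality makes `G 0` empty.
  let G : ℕ → Set (V ⊗[ℚ] (⨂[ℚ] _i : Fin k, X)) := fun w =>
    {t | ∃ (v : V) (x : Fin k → X) (u : Fin k → ℕ), (∀ i, x i ∈ S (u i + 1)) ∧ ∑ i, u i < w ∧
      t = v ⊗ₜ PiTensorProduct.tprod ℚ x}
  -- Eigenvalues add up under the derivation extension. As they are natural numbers, the sum is zero
  -- only if all of them are, so `J^{⊗k}` is the projection to the eigenvalue `0` on the tensor
  -- power.
  have hG : ∀ w, ∀ t ∈ G w, ∃ j : ℕ, NT t = (j : ℚ) • t ∧ JT t = if j = 0 then t else 0 := by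
    rintro w _ ⟨v, x, u, hx, -, rfl⟩
    choose hx' j hN hJ using hx
    refine ⟨∑ i, j i, ?_, ?_⟩
    · simp only [NT, LinearMap.lTensor_tmul, tensorDer_apply_tprod, LinearMap.id_apply, ite_self,
        hN, MultilinearMap.map_update_smul, Function.update_eq_self, ← Finset.sum_smul]
      rw [TensorProduct.tmul_smul]
      push_cast
      rfl
    · simp only [JT, LinearMap.lTensor_tmul, PiTensorProduct.map_tprod, hJ]
      split_ifs with h
      · congr 2
        funext i
        rw [if_pos ((Finset.sum_eq_zero_iff.mp h) i (Finset.mem_univ i))]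
      · obtain ⟨i, -, hi⟩ := Finset.exists_ne_zero_of_sum_ne_zero h
        rw [MultilinearMap.map_coord_zero _ i (if_neg hi), TensorProduct.tmul_zero]
  have hmono : ∀ {w w'}, w ≤ w' → Submodule.span ℚ (G w) ≤ Submodule.span ℚ (G w') := by
    refine fun hw => Submodule.span_mono ?_
    rintro _ ⟨v, x, u, hx, hu, rfl⟩
    exact ⟨v, x, u, hx, hu.trans_le hw, rfl⟩
  have hex : ∀ t, ∃ w, t ∈ Submodule.span ℚ (G w) := by
    intro t
    induction t using TensorProduct.induction_on with
    | zero => exact ⟨0, Submodule.zero_mem _⟩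
    | add a b ha hb =>
      obtain ⟨w, hw⟩ := ha
      obtain ⟨w', hw'⟩ := hb
      exact ⟨max w w', Submodule.add_mem _ (hmono (le_max_left _ _) hw)
        (hmono (le_max_right _ _) hw')⟩
    | tmul v a =>
      have ha : a ∈ Submodule.span ℚ
          (Set.range (PiTensorProduct.tprod ℚ (s := fun _ : Fin k => X))) := by
        rw [PiTensorProduct.span_tprod_eq_top]; trivial
      induction ha using Submodule.span_induction with
      | zero => exact ⟨0, by rw [TensorProduct.tmul_zero]; exact Submodule.zero_mem _⟩
      | add a b _ _ ha hb =>
        obtain ⟨w, hw⟩ := ha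
        obtain ⟨w', hw'⟩ := hb
        rw [TensorProduct.tmul_add]
        exact ⟨max w w', Submodule.add_mem _ (hmono (le_max_left _ _) hw)
          (hmono (le_max_right _ _) hw')⟩
      | smul r a _ ha =>
        obtain ⟨w, hw⟩ := ha
        exact ⟨w, by rw [TensorProduct.tmul_smul]; exact Submodule.smul_mem _ _ hw⟩
      | mem a ha =>
        obtain ⟨x, rfl⟩ := ha
        choose u hu using fun i => hW (x i)
        refine ⟨∑ i, u i + 1, MultilinearMap.apply_mem_of_mem_span
          ((TensorProduct.mk ℚ V (⨂[ℚ] _i : Fin k, X) v).compMultilinearMap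
            (PiTensorProduct.tprod ℚ)) (fun i => S (u i + 1)) _ (fun s hs => ?_) x
          fun i => hE _ _ (hu i)⟩
        exact Submodule.subset_span ⟨v, s, u, hs, Nat.lt_succ_self _, rfl⟩
  obtain ⟨P, hP⟩ := exists_pseudoinverse NT fun t => by
    obtain ⟨w, hw⟩ := hex t
    refine Submodule.span_mono (fun s hs => ?_) hw
    obtain ⟨j, hj, -⟩ := hG w s hs
    exact ⟨j, hj⟩
  -- The tensor power, filtered by the spans of the `G w`, is now in the situation of a single
  -- perturbed operator.
  refine eq_zero_of_perturbation (W := fun w => Submodule.span ℚ (G w)) (fun t ht => ?_) hex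
    NT P QT JT (fun t => ?_) (fun w t ht => ?_) (fun w t ht => ?_) ?_ hJ
  · have : G 0 = ∅ := by
      refine Set.eq_empty_of_forall_notMem ?_
      rintro _ ⟨v, x, u, -, hu, -⟩
      exact Nat.not_lt_zero _ hu
    rw [this, Submodule.span_empty] at ht
    exact ht
  · obtain ⟨w, hw⟩ := hex t
    induction hw using Submodule.span_induction with
    | zero => simp
    | add a b _ _ ha hb =>
      rw [map_add, map_add, map_add, add_add_add_comm, ha, hb]
    | smul r a _ ha => rw [map_smul, map_smul, map_smul, ← smul_add, ha]
    | mem a ha =>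
      obtain ⟨j, hj, hj'⟩ := hG w a ha
      rw [hj, hj', map_smul, hP j a hj, smul_smul]
      split_ifs with h0
      · simp [h0]
      · rw [mul_inv_cancel₀ (by exact_mod_cast h0), one_smul, add_zero]
  · induction ht using Submodule.span_induction with
    | zero => rw [map_zero]; exact Submodule.zero_mem _
    | add a b _ _ ha hb => rw [map_add]; exact Submodule.add_mem _ ha hb
    | smul r a _ ha => rw [map_smul]; exact Submodule.smul_mem _ _ ha
    | mem a ha =>
      obtain ⟨j, hj, -⟩ := hG w a ha
      rw [hP j a hj]
      exact Submodule.smul_mem _ _ (Submodule.subset_span ha)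
  · induction ht using Submodule.span_induction with
    | zero => rw [map_zero]; exact Submodule.zero_mem _
    | add a b _ _ ha hb => rw [map_add]; exact Submodule.add_mem _ ha hb
    | smul r a _ ha => rw [map_smul]; exact Submodule.smul_mem _ _ ha
    | mem a ha =>
      obtain ⟨v, x, u, hx, hu, rfl⟩ := ha
      simp only [QT, LinearMap.lTensor_tmul, tensorDer_apply_tprod, LinearMap.id_apply, ite_self,
        TensorProduct.tmul_sum]
      refine Submodule.sum_mem _ fun l _ => ?_
      have hq := hQ _ _ (hx l).1
      rcases Nat.eq_zero_or_pos (u l) with h0 | h0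
      · rw [h0] at hq
        rw [hW0 _ hq, MultilinearMap.map_update_zero, TensorProduct.tmul_zero]
        exact Submodule.zero_mem _
      -- `Q (x l)` need not be an eigenvector, but it is a combination of eigenvectors in `W (u l)`.
      -- Inserting these in position `l` lowers the sum of the `u i` by one.
      · refine (Submodule.span_le (p := (Submodule.span ℚ (G w)).comap
          (TensorProduct.mk ℚ V (⨂[ℚ] _i : Fin k, X) v ∘ₗ
            (PiTensorProduct.tprod ℚ).toLinearMap x l))).mpr (fun y hy => ?_) (hE _ _ hq)
        refine Submodule.subset_span ⟨v, Function.update x l y, Function.update u l (u l - 1),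
          fun i => ?_, ?_, rfl⟩
        · by_cases h : i = l
          · subst h
            rw [Function.update_self, Function.update_self, Nat.sub_add_cancel h0]
            exact hy
          · rw [Function.update_of_ne h, Function.update_of_ne h]
            exact hx i
        · rw [Finset.sum_update_of_mem (Finset.mem_univ l), Finset.sdiff_singleton_eq_erase]
          rw [← Finset.add_sum_erase Finset.univ u (Finset.mem_univ l)] at hu
          omega
  · have h : NT = LinearMap.lTensor V (tensorDer (fun _ : Fin k => LinearMap.id) fun _ => L) +
        QT := by
      simp only [NT, QT, hL]
      rw [tensorDer_add, LinearMap.lTensor_add]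
    rw [h, LinearMap.add_apply, hz, zero_add]

end TensorKernel

/-! ### The perturbation lemma -/

section PerturbationLemma

variable {X : Type*} [AddCommGroup X] [Module ℚ X] {Y : Type*} [AddCommGroup Y] [Module ℚ Y]

/-- The data of a contraction of `(X, d)` to `(Y, d')` with projection `p`, inclusion `i` and
homotopy `h P`, where `h` is a square zero operator and `P` is a pseudo-inverse of the operator
`N = -(d h + h d)`, together with a filtration `W` and a perturbation `b` of `d` that is locally
nilpotent with respect to `W`. -/
structure PerturbationData (W : ℕ → Submodule ℚ X) (d b h N P : X →ₗ[ℚ] X) (d' : Y →ₗ[ℚ] Y)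
    (i : Y →ₗ[ℚ] X) (p : X →ₗ[ℚ] Y) : Prop where
  zero : ∀ x ∈ W 0, x = 0
  exhaustive : ∀ x, ∃ w, x ∈ W w
  h_mem : ∀ w, ∀ x ∈ W w, h x ∈ W w
  P_mem : ∀ w, ∀ x ∈ W w, P x ∈ W w
  b_mem : ∀ w, ∀ x ∈ W (w + 1), b x ∈ W w
  N_eq : ∀ x, N x = -(d (h x) + h (d x))
  p_i : ∀ y, p (i y) = y
  p_h : ∀ x, p (h x) = 0
  h_i : ∀ y, h (i y) = 0
  h_h : ∀ x, h (h x) = 0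
  d_i : ∀ y, d (i y) = i (d' y)
  p_d : ∀ x, p (d x) = d' (p x)
  P_N : ∀ x, P (N x) + i (p x) = x
  N_P : ∀ x, N (P x) + i (p x) = x
  P_h : ∀ x, P (h x) = h (P x)
  sq : ∀ x, d (d x + b x) + b (d x + b x) = 0

namespace PerturbationData

variable {W : ℕ → Submodule ℚ X} {d b h N P : X →ₗ[ℚ] X} {d' : Y →ₗ[ℚ] Y} {i : Y →ₗ[ℚ] X}
  {p : X →ₗ[ℚ] Y} (H : PerturbationData W d b h N P d' i p)

include H

/-- `S` is the inverse of `1 - bhP`, for the perturbation `b` and the homotopy `hP`. The invariance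
clause is stated for arbitrary subspaces so that it covers both degrees and weights. -/
theorem exists_inverse : ∃ S : X →ₗ[ℚ] X, (∀ x, S x = x + S (b (h (P x)))) ∧
    (∀ x, S x = x + b (h (P (S x)))) ∧
    ∀ U : Submodule ℚ X, (∀ x ∈ U, b (h (P x)) ∈ U) → ∀ x ∈ U, S x ∈ U :=
  exists_inverse_one_sub H.zero H.exhaustive (b ∘ₗ h ∘ₗ P)
    fun w _ hx => H.b_mem w _ (H.h_mem _ _ (H.P_mem _ _ hx))

theorem N_i (y : Y) : N (i y) = 0 := by
  rw [H.N_eq, H.h_i, H.d_i, H.h_i, map_zero, add_zero, neg_zero]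

theorem p_N (x : X) : p (N x) = 0 := by
  rw [H.N_eq, map_neg, map_add, H.p_d, H.p_h, H.p_h, map_zero, add_zero, neg_zero]

/-- The anticommutator `L = -((d + b) h + h (d + b))`. -/
theorem exists_eq_add (L : X →ₗ[ℚ] X)
    (hL : ∀ x, L x = -(d (h x) + b (h x) + h (d x + b x))) (x : X) : ∃ y z, x = i y + L z := by
  have : ∀ w, ∀ x ∈ W w, ∃ y z, x = i y + L z := by
    intro w
    induction w with
    | zero => exact fun x hx => ⟨0, 0, by rw [H.zero x hx]; simp⟩
    | succ w ih =>
      intro x hx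
      -- Because `L = N - (bh + hb)` and `NP + ip = 1`, the vector `i (p x) + L (P x)` differs from
      -- `x` only by `(bh + hb)(P x)`, which is of lower filtration and covered by induction.
      have hP := H.P_mem _ _ hx
      obtain ⟨y, z, hyz⟩ := ih (b (h (P x)) + h (b (P x))) (Submodule.add_mem _
        (H.b_mem w _ (H.h_mem _ _ hP)) (H.h_mem _ _ (H.b_mem w _ hP)))
      refine ⟨p x + y, P x + z, ?_⟩
      have h1 := H.N_P x
      rw [H.N_eq] at h1
      have h2 := hL (P x)
      rw [map_add h] at h2
      rw [map_add, map_add, h2]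
      nth_rewrite 1 [← h1]
      have : i (p x) + i y + (-(d (h (P x)) + b (h (P x)) + (h (d (P x)) + h (b (P x)))) + L z) =
          i (p x) + (-(d (h (P x)) + b (h (P x)) + (h (d (P x)) + h (b (P x)))) +
            (i y + L z)) := by abel
      rw [this, ← hyz]
      abel
  obtain ⟨w, hw⟩ := H.exhaustive x
  exact this w x hw

/-- `L` differs from `N` by the filtration-lowering operator `bh + hb`, and `N` is injective on the
kernel of `p`. -/
theorem eq_zero (L : X →ₗ[ℚ] X) (hL : ∀ x, L x = -(d (h x) + b (h x) + h (d x + b x))) {z : X}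
    (hz : L z = 0) (hp : p z = 0) : z = 0 := by
  refine eq_zero_of_perturbation H.zero H.exhaustive N P (b ∘ₗ h + h ∘ₗ b) (i ∘ₗ p) H.P_N H.P_mem
    (fun w x hx => ?_) ?_ ?_
  · exact Submodule.add_mem _ (H.b_mem w _ (H.h_mem _ _ hx)) (H.h_mem _ _ (H.b_mem w _ hx))
  · rw [H.N_eq]
    rw [hL, map_add h] at hz
    simp only [LinearMap.add_apply, LinearMap.comp_apply]
    rw [← sub_eq_zero, ← hz]
    abel
  · rw [LinearMap.comp_apply, hp, map_zero]

theorem p_G {S : X →ₗ[ℚ] X} (y : Y) : p (i y + h (P (S (b (i y))))) = y := by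
  rw [map_add, H.p_i, H.p_h, add_zero]

theorem h_G {S : X →ₗ[ℚ] X} (y : Y) : h (i y + h (P (S (b (i y))))) = 0 := by
  rw [map_add, H.h_i, H.h_h, add_zero]

variable {S : X →ₗ[ℚ] X} (hS : ∀ x, S x = x + S (b (h (P x))))
  (hS' : ∀ x, S x = x + b (h (P (S x))))

section Projection

include hS

theorem F_i (y : Y) : p (S (i y)) = y := by
  have h1 : h (P (i y)) = 0 := by rw [← H.P_h, H.h_i, map_zero]
  rw [hS, h1, map_zero, map_zero, add_zero, H.p_i]

theorem F_h (x : X) : p (S (h x)) = 0 := by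
  rw [hS, H.P_h, H.h_h, map_zero, map_zero, add_zero, H.p_h]

/-- From `hPN = h(1 - ip) = h` one gets `SN = N + Sbh`. Hence `SL = S(N - bh - hb) = N - Shb`, and
both `pN` and `pSh` vanish. -/
theorem F_L (x : X) : p (S (-(d (h x) + b (h x) + h (d x + b x)))) = 0 := by
  have h1 : -(d (h x) + b (h x) + h (d x + b x)) = N x - b (h x) - h (b x) := by
    rw [H.N_eq, map_add]; abel
  have h2 : h (P (N x)) = h x := by
    have := congrArg h (H.P_N x)
    rw [map_add, H.h_i, add_zero] at this
    exact this
  rw [h1, map_sub, map_sub, map_sub, map_sub, H.F_h hS, hS (N x), h2, map_add, H.p_N]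
  abel

theorem F_G (y : Y) : p (S (i y + h (P (S (b (i y)))))) = y := by
  rw [map_add, map_add, H.F_i hS, H.F_h hS, add_zero]

/-- The perturbed projection is a chain map for the perturbed differential on `Y`. -/
theorem F_comm (x : X) : p (S (d x + b x)) = d' (p (S x)) + p (S (b (i (p (S x))))) := by
  -- It suffices to treat the image of `i`, where the identity is the definition of the perturbed
  -- differential, and the image of `L`, where both sides vanish.
  obtain ⟨y, z, rfl⟩ := H.exists_eq_add
    (-(d ∘ₗ h + b ∘ₗ h + h ∘ₗ (d + b))) (fun _ => rfl) x
  have hL : ∀ z, (-(d ∘ₗ h + b ∘ₗ h + h ∘ₗ (d + b))) z =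
    -(d (h z) + b (h z) + h (d z + b z)) := fun _ => rfl
  have h1 : p (S ((-(d ∘ₗ h + b ∘ₗ h + h ∘ₗ (d + b))) z)) = 0 := H.F_L hS z
  -- With `D = d + b` and `D² = 0`, both `DL` and `LD` equal `-DhD`.
  have h2 : ∀ z, d (-(d (h z) + b (h z) + h (d z + b z))) +
      b (-(d (h z) + b (h z) + h (d z + b z))) =
      -(d (h (d z + b z)) + b (h (d z + b z)) + h (d (d z + b z) + b (d z + b z))) := by
    intro z
    have h3 := H.sq (h z)
    rw [H.sq z, map_zero, add_zero, map_neg, map_neg, map_add d, map_add b, ← neg_add,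
      add_add_add_comm, h3, zero_add]
  have h4 : p (S (d ((-(d ∘ₗ h + b ∘ₗ h + h ∘ₗ (d + b))) z) +
      b ((-(d ∘ₗ h + b ∘ₗ h + h ∘ₗ (d + b))) z))) = 0 := by
    rw [hL, h2]
    exact H.F_L hS (d z + b z)
  have h5 : p (S (i y + (-(d ∘ₗ h + b ∘ₗ h + h ∘ₗ (d + b))) z)) = y := by
    rw [map_add, map_add, h1, add_zero, H.F_i hS]
  rw [h5, map_add d, map_add b, add_add_add_comm, map_add S, map_add p, h4, add_zero, H.d_i,
    map_add S, map_add p, H.F_i hS]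

/-- Push `D² (i y) = 0` forward along the chain map `pS`, using `pSi = 1`. -/
theorem sq_perturbed (y : Y) :
    d' (d' y + p (S (b (i y)))) + p (S (b (i (d' y + p (S (b (i y))))))) = 0 := by
  have h1 := H.F_comm hS (d (i y) + b (i y))
  rw [H.sq, map_zero, map_zero, H.F_comm hS (i y), H.F_i hS] at h1
  exact h1.symm

end Projection

section Inclusion

include hS'

/-- The equation for `S` gives the fixed point form `z = i y + hPbz`. Applying `N`, with `NPh = h`
and `Ni = 0`, yields `Nz = hbz`. Since `hz = 0`, also `Nz = -hdz`, and therefore `Lz = -h(d + b)z =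
0`. -/
theorem L_G (y : Y) (z : X) (hz : z = i y + h (P (S (b (i y))))) :
    -(d (h z) + b (h z) + h (d z + b z)) = 0 := by
  have hG : z = i y + h (P (b z)) := by
    rw [hz, map_add b, ← hS']
  have h0 := H.h_G (S := S) y
  have h3 : N (h (P (b z))) = h (b z) := by
    have h4 := H.N_P (h (b z))
    rw [H.p_h, map_zero, add_zero, H.P_h] at h4
    exact h4
  rw [← hz] at h0
  have h1 : h (b z) = N z := by
    have h4 := congrArg N hG
    rw [map_add, H.N_i, h3, zero_add] at h4
    exact h4.symm
  rw [h0, map_add, h1, H.N_eq, h0]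
  simp

end Inclusion

include hS hS'

/-- The perturbed inclusion is a chain map for the perturbed differential on `Y`. -/
theorem G_comm (G : Y →ₗ[ℚ] X) (hG : ∀ y, G y = i y + h (P (S (b (i y))))) (y : Y) :
    G (d' y + p (S (b (i y)))) = d (G y) + b (G y) := by
  let L : X →ₗ[ℚ] X := -(d ∘ₗ h + b ∘ₗ h + h ∘ₗ (d + b))
  have hL : ∀ z, L z = -(d (h z) + b (h z) + h (d z + b z)) := fun _ => rfl
  have hLG : ∀ y, L (G y) = 0 := fun y => by rw [hL]; exact H.L_G hS' y _ (hG y)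
  have hpG : ∀ y, p (G y) = y := fun y => by rw [hG]; exact H.p_G y
  have hFG : ∀ y, p (S (G y)) = y := fun y => by rw [hG]; exact H.F_G hS y
  -- On the kernel of `L` one has `z = G (p z)`, since the difference is killed by both `L` and `p`.
  -- Therefore `F = pS` and `p` agree there; applied to `D (G y)`, this lets the chain map identity
  -- for `F` compute `p (D (G y))`.
  have hker : ∀ z, L z = 0 → p (S z) = p z := by
    intro z hz
    have : z - G (p z) = 0 := H.eq_zero L hL (by rw [map_sub, hz, hLG, sub_zero])
      (by rw [map_sub, hpG, sub_self])
    rw [sub_eq_zero] at this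
    conv_lhs => rw [this, hFG]
  have hLD : L (d (G y) + b (G y)) = 0 := by
    have h1 := H.sq (h (G y))
    have h2 : d (L (G y)) + b (L (G y)) = 0 := by rw [hLG, map_zero, map_zero, add_zero]
    rw [hL, map_neg, map_neg, map_add d, map_add b, ← neg_add, add_add_add_comm, h1, zero_add]
      at h2
    rw [hL, H.sq, map_zero, add_zero, h2]
  rw [← sub_eq_zero]
  refine H.eq_zero L hL (by rw [map_sub, hLG, hLD, sub_zero]) ?_
  rw [map_sub, hpG, ← hker _ hLD, H.F_comm hS, hFG, sub_self]

end PerturbationData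

end PerturbationLemma

open scoped DGCooperad

/-! ### Homotopy transfer -/

namespace DGCooperad

noncomputable section

variable (C : DGCooperad.{u}) {A : DGModule.{v}} {B : DGModule.{w}}

/-- In the anticommutator the terms with the differential of `C(k)` cancel, since `ε` anticommutes
with it, and the remaining signs square to `1`. What is left is the coderivation rule without signs.
-/
theorem coaction_anticomm (D h : C.Cofree A →ₗ[ℚ] C.Cofree A) (k : ℕ)
    (hD : C.cofreeEps A ∘ₗ D = -(D ∘ₗ C.cofreeEps A))
    (hh : C.cofreeEps A ∘ₗ h = -(h ∘ₗ C.cofreeEps A))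
    (hD' : C.coaction A k ∘ₗ D = (LinearMap.rTensor _ (C.obj k).d + TensorProduct.map (C.obj k).eps
      (tensorDer (fun _ => C.cofreeEps A) fun _ => D)) ∘ₗ C.coaction A k)
    (hh' : C.coaction A k ∘ₗ h = TensorProduct.map (C.obj k).eps
      (tensorDer (fun _ => C.cofreeEps A) fun _ => h) ∘ₗ C.coaction A k) :
    C.coaction A k ∘ₗ (D ∘ₗ h + h ∘ₗ D) = LinearMap.lTensor (C.obj k)
      (tensorDer (fun _ => LinearMap.id) fun _ => D ∘ₗ h + h ∘ₗ D) ∘ₗ C.coaction A k := by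
  have h1 := tensorDer_anticomm (fun _ : Fin k => C.cofreeEps A) (fun _ => D) (fun _ => h)
    (fun _ => C.cofreeEps_cofreeEps) (fun _ => hD) (fun _ => hh)
  have h2 := DGModule.eps_odd (C.obj k).d (C.obj k).d_par
  have key : ∀ z : C.obj k ⊗[ℚ] (⨂[ℚ] _i : Fin k, C.Cofree A),
      LinearMap.rTensor (⨂[ℚ] _i : Fin k, C.Cofree A) (C.obj k).d (TensorProduct.map (C.obj k).eps
          (tensorDer (fun _ => C.cofreeEps A) fun _ => h) z) +
        TensorProduct.map (C.obj k).eps (tensorDer (fun _ => C.cofreeEps A) fun _ => D)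
          (TensorProduct.map (C.obj k).eps (tensorDer (fun _ => C.cofreeEps A) fun _ => h) z) +
      TensorProduct.map (C.obj k).eps (tensorDer (fun _ => C.cofreeEps A) fun _ => h)
        (LinearMap.rTensor (⨂[ℚ] _i : Fin k, C.Cofree A) (C.obj k).d z +
          TensorProduct.map (C.obj k).eps (tensorDer (fun _ => C.cofreeEps A) fun _ => D) z) =
      LinearMap.lTensor (C.obj k)
        (tensorDer (fun _ => LinearMap.id) fun _ => D ∘ₗ h + h ∘ₗ D) z := by
    intro z
    induction z using TensorProduct.induction_on with
    | zero => simp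
    | add a b ha hb =>
      rw [map_add (LinearMap.lTensor _ _), ← ha, ← hb]
      simp only [map_add]
      abel
    | tmul c t =>
      have h2' := LinearMap.congr_fun h2 c
      have h3 : (C.obj k).eps ((C.obj k).eps c) = c := LinearMap.congr_fun (C.obj k).eps_eps c
      simp only [LinearMap.comp_apply, LinearMap.neg_apply] at h2'
      rw [← h1]
      simp only [LinearMap.add_apply, LinearMap.rTensor_tmul, LinearMap.lTensor_tmul,
        TensorProduct.map_tmul, map_add, h3, h2', LinearMap.comp_apply, TensorProduct.neg_tmul,
        TensorProduct.tmul_add]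
      abel
  refine LinearMap.ext fun x => ?_
  have hDx : ∀ x, _ := fun x => LinearMap.congr_fun hD' x
  have hhx : ∀ x, _ := fun x => LinearMap.congr_fun hh' x
  simp only [LinearMap.comp_apply] at hDx hhx
  rw [LinearMap.comp_apply, LinearMap.comp_apply, ← key, LinearMap.add_apply, map_add,
    LinearMap.comp_apply, LinearMap.comp_apply, hDx, hhx, hhx, hDx]
  rfl

theorem map_comp_tensorDer_eq_zero {k : ℕ} {X : Type v} [AddCommMonoid X] [Module ℚ X]
    {Y : Type w} [AddCommMonoid Y] [Module ℚ Y] (F : X →ₗ[ℚ] Y) (L : X →ₗ[ℚ] X)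
    (h : F ∘ₗ L = 0) : PiTensorProduct.map (fun _ : Fin k => F) ∘ₗ
      tensorDer (fun _ => LinearMap.id) (fun _ => L) = 0 := by
  rw [map_comp_tensorDer (fun _ => LinearMap.id) (fun _ => L) (fun _ => LinearMap.id)
    (fun _ => 0) (fun _ => F) (fun _ => rfl) (fun _ => by rw [h, LinearMap.zero_comp]), tensorDer_zero, LinearMap.zero_comp]

theorem tensorDer_comp_map_eq_zero {k : ℕ} {X : Type v} [AddCommMonoid X] [Module ℚ X]
    {Y : Type w} [AddCommMonoid Y] [Module ℚ Y] (G : Y →ₗ[ℚ] X) (L : X →ₗ[ℚ] X)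
    (h : L ∘ₗ G = 0) : tensorDer (fun _ => LinearMap.id) (fun _ => L) ∘ₗ
      PiTensorProduct.map (fun _ : Fin k => G) = 0 := by
  rw [← map_comp_tensorDer (fun _ => LinearMap.id) (fun _ => 0) (fun _ => LinearMap.id)
    (fun _ => L) (fun _ => G) (fun _ => rfl) (fun _ => by rw [h, LinearMap.comp_zero]), tensorDer_zero,
    LinearMap.comp_zero]

end

end DGCooperad

/-! ### The induced contraction of cofree coalgebras -/

namespace Contraction

noncomputable section

variable (C : DGCooperad.{u}) {A : DGModule.{v}} {B : DGModule.{w}} (K : Contraction A B)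

theorem f_par (e : ZMod 2) (x : A) : B.par e (K.f x) = K.f (A.par e x) :=
  DGModule.par_hom' K.f K.f_mem e x

theorem g_par (e : ZMod 2) (y : B) : A.par e (K.g y) = K.g (B.par e y) :=
  DGModule.par_hom' K.g K.g_mem e y

theorem h_par (e : ZMod 2) (x : A) : A.par (e + 1) (K.h x) = K.h (A.par e x) :=
  DGModule.par_odd K.h 1 (by simp) K.h_mem e x

/-- The map `C(f) : C(A) → C(B)`. -/
def cofreeF : C.Cofree A →ₗ[ℚ] C.Cofree B := C.cofreeMap K.f K.f_par

/-- The map `C(g) : C(B) → C(A)`. -/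
def cofreeG : C.Cofree B →ₗ[ℚ] C.Cofree A := C.cofreeMap K.g K.g_par

/-- The coderivation of `C(A)` induced by `h`. -/
def cofreeH : C.Cofree A →ₗ[ℚ] C.Cofree A := C.cofreeDer K.h K.h_par

/-- The coderivation of `C(A)` induced by `1 - g f`. -/
def cofreeN : C.Cofree A →ₗ[ℚ] C.Cofree A :=
  -(C.cofreeD A ∘ₗ K.cofreeH C + K.cofreeH C ∘ₗ C.cofreeD A)

/-- Eigenvectors of the coderivation induced by `1 - g f`. -/
def eigenvectors : Set (C.Cofree A) :=
  {z | ∃ j : ℕ, K.cofreeN C z = (j : ℚ) • z ∧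
    (K.cofreeG C ∘ₗ K.cofreeF C) z = if j = 0 then z else 0}

theorem toCofree_mem_eigenvectors {n : ℕ} (c : C.obj n) (x : Fin n → A) (e : Fin n → ℕ)
    (h1 : ∀ i, (A.d ∘ₗ K.h + K.h ∘ₗ A.d) (x i) = -((e i : ℚ) • x i))
    (h2 : ∀ i, K.g (K.f (x i)) = if e i = 0 then x i else 0) :
    C.toCofree A n (c ⊗ₜ PiTensorProduct.tprod ℚ x) ∈ K.eigenvectors C := by
  refine ⟨∑ i, e i, ?_, ?_⟩
  · have h := C.cofreeD_anticomm K.h K.h_par n c (PiTensorProduct.tprod ℚ x)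
    rw [cofreeN, LinearMap.neg_apply, neg_eq_iff_eq_neg]
    refine h.trans ?_
    rw [tensorDer_apply_tprod]
    simp only [h1, LinearMap.id_apply, ite_self, MultilinearMap.map_update_neg,
      MultilinearMap.map_update_smul, Function.update_eq_self]
    rw [Finset.sum_neg_distrib, ← Finset.sum_smul, TensorProduct.tmul_neg, TensorProduct.tmul_smul,
      map_neg, map_smul]
    push_cast
    rfl
  · rw [LinearMap.comp_apply, cofreeF, cofreeG, DGCooperad.cofreeMap_toCofree,
      DGCooperad.cofreeMap_toCofree, LinearMap.lTensor_tmul, LinearMap.lTensor_tmul,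
      PiTensorProduct.map_tprod, PiTensorProduct.map_tprod]
    simp only [h2]
    split_ifs with h
    · congr 3
      funext i
      rw [if_pos ((Finset.sum_eq_zero_iff.mp h) i (Finset.mem_univ i))]
    · obtain ⟨i, -, hi⟩ := Finset.exists_ne_zero_of_sum_ne_zero h
      rw [MultilinearMap.map_coord_zero _ i (if_neg hi), TensorProduct.tmul_zero, map_zero]

/-- `x = gf x + (x - gf x)` is the eigenvector decomposition for the idempotent `gf`, with values `e
= 0` and `e = 1`, and both summands keep the degree of `x`. -/
theorem span_eigenvectors_deg {q : ℤ} {x : A} (hx : x ∈ A.deg q) :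
    x ∈ Submodule.span ℚ {a : A | a ∈ A.deg q ∧ ∃ e : ℕ,
      (A.d ∘ₗ K.h + K.h ∘ₗ A.d) a = -((e : ℚ) • a) ∧ K.g (K.f a) = if e = 0 then a else 0} := by
  have hgf : ∀ a, (A.d ∘ₗ K.h + K.h ∘ₗ A.d) a = K.g (K.f a) - a := fun a => by
    have := LinearMap.congr_fun K.g_f a
    simp only [LinearMap.comp_apply, LinearMap.add_apply, LinearMap.id_apply] at this
    rw [this, LinearMap.add_apply, LinearMap.comp_apply, LinearMap.comp_apply]
    abel
  have hfg : ∀ y, K.f (K.g y) = y := fun y => LinearMap.congr_fun K.f_g y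
  have hm := K.g_mem _ _ (K.f_mem _ _ hx)
  rw [← add_sub_cancel (K.g (K.f x)) x]
  refine Submodule.add_mem _ (Submodule.subset_span ⟨hm, 0, ?_, ?_⟩)
    (Submodule.subset_span ⟨Submodule.sub_mem _ hx hm, 1, ?_, ?_⟩)
  · rw [hgf, hfg]; simp
  · rw [hfg]; simp
  · rw [hgf, map_sub, map_sub, hfg]; simp
  · rw [map_sub, map_sub, hfg]; simp

theorem cofreeDeg_le_span (i : ℤ) : C.cofreeDeg A i ≤
    Submodule.span ℚ {z | z ∈ C.cofreeDeg A i ∧ z ∈ K.eigenvectors C} := by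
  refine C.cofreeDeg_le fun n r q c x hc hx hi => ?_
  refine MultilinearMap.apply_mem_of_mem_span
    ((C.toCofree A n ∘ₗ TensorProduct.mk ℚ (C.obj n) _ c).compMultilinearMap
      (PiTensorProduct.tprod ℚ)) _ _ (fun s hs => ?_) x fun j => K.span_eigenvectors_deg (hx j)
  choose hs e he using hs
  exact Submodule.subset_span ⟨C.toCofree_mem_cofreeDeg hc hs hi,
    K.toCofree_mem_eigenvectors C c s e (fun i => (he i).1) fun i => (he i).2⟩

/-- Eigenvectors span each filtration step from within, so the pseudo-inverse, which only rescales
them, preserves the filtration. The analogue for degrees, `cofreeDeg_le_span`, has the same purpose.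
-/
theorem weightLT_le_span (w : ℕ) : C.weightLT A w ≤
    Submodule.span ℚ {z | z ∈ C.weightLT A w ∧ z ∈ K.eigenvectors C} := by
  refine C.weightLT_le fun n hn z => ?_
  refine C.toCofree_mem_of_span {a : A | ∃ e : ℕ,
    (A.d ∘ₗ K.h + K.h ∘ₗ A.d) a = -((e : ℚ) • a) ∧ K.g (K.f a) = if e = 0 then a else 0}
    (fun x => ?_) n (fun r c x _ hx => ?_) z
  · refine Submodule.span_le.mpr ?_ (DGCooperad.span_homogeneous A x)
    rintro a ⟨q, ha⟩
    exact Submodule.span_mono (fun s hs => hs.2) (K.span_eigenvectors_deg ha)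
  · choose e he using hx
    exact Submodule.subset_span ⟨C.toCofree_mem_weightLT hn _,
      K.toCofree_mem_eigenvectors C c x e (fun i => (he i).1) fun i => (he i).2⟩

theorem cofree_mem_span (z : C.Cofree A) : z ∈ Submodule.span ℚ (K.eigenvectors C) := by
  obtain ⟨w, hw⟩ := C.exists_mem_weightLT z
  exact Submodule.span_mono (fun s hs => hs.2) (K.weightLT_le_span C w hw)

theorem eigen_ext {W : Type*} [AddCommMonoid W] [Module ℚ W] {α β : C.Cofree A →ₗ[ℚ] W}
    (h : ∀ z ∈ K.eigenvectors C, α z = β z) (z : C.Cofree A) : α z = β z :=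
  (Submodule.span_le (p := LinearMap.eqLocus α β)).mpr h (K.cofree_mem_span C z)

/-- The perturbation data on `C(A)` associated with a `P_∞`-algebra structure on `A`. -/
theorem exists_perturbationData (b : C.PInfty A) : ∃ P : C.Cofree A →ₗ[ℚ] C.Cofree A,
    PerturbationData (C.weightLT A) (C.cofreeD A) b.b (K.cofreeH C) (K.cofreeN C) P (C.cofreeD B)
      (K.cofreeG C) (K.cofreeF C) ∧
    ∀ (i : ℤ) (x : C.Cofree A), x ∈ C.cofreeDeg A i → P x ∈ C.cofreeDeg A i := by
  obtain ⟨P, hP⟩ := exists_pseudoinverse (K.cofreeN C) fun z =>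
    Submodule.span_mono (fun s hs => hs.imp fun j hj => hj.1) (K.cofree_mem_span C z)
  have hhh := C.cofreeDer_comp_self K.h K.h_par K.h_h
  -- Since `h² = 0`, both composites equal `-hdh`.
  have hNh : ∀ z, K.cofreeN C (K.cofreeH C z) = K.cofreeH C (K.cofreeN C z) := by
    intro z
    have h0 : ∀ z, K.cofreeH C (K.cofreeH C z) = 0 := fun z => LinearMap.congr_fun hhh z
    simp only [cofreeN, LinearMap.neg_apply, LinearMap.add_apply, LinearMap.comp_apply, map_neg,
      map_add, h0, map_zero, zero_add, add_zero]
  have hmem : ∀ U : Submodule ℚ (C.Cofree A),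
      U ≤ Submodule.span ℚ {z | z ∈ U ∧ z ∈ K.eigenvectors C} → ∀ x ∈ U, P x ∈ U := by
    intro U hU x hx
    refine (Submodule.span_le (p := U.comap P)).mpr ?_ (hU hx)
    rintro z ⟨hz, j, hj, -⟩
    rw [SetLike.mem_coe, Submodule.mem_comap, hP j z hj]
    exact U.smul_mem _ hz
  -- The scalar `j * j⁻¹` is `0` for `j = 0` and `1` otherwise, complementary to the projection
  -- `ip`.
  have hPN : ∀ (j : ℕ) (z : C.Cofree A), (K.cofreeG C ∘ₗ K.cofreeF C) z = (if j = 0 then z else 0) →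
      ((j : ℚ) * (j : ℚ)⁻¹) • z + K.cofreeG C (K.cofreeF C z) = z := by
    intro j z hj
    rw [LinearMap.comp_apply] at hj
    rw [hj]
    split_ifs with h0
    · simp [h0]
    · rw [mul_inv_cancel₀ (by exact_mod_cast h0), one_smul, add_zero]
  refine ⟨P, ⟨fun x => C.weightLT_zero, C.exists_mem_weightLT,
    fun w x hx => C.cofreeDer_mem_weightLT _ _ hx, fun w => hmem _ (K.weightLT_le_span C w),
    fun w x hx => b.mem_weightLT w x hx, fun x => rfl, ?_,
    fun x => LinearMap.congr_fun (C.cofreeMap_comp_eq_zero_of_der _ K.f_par _ K.h_par K.f_h) x,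
    fun y => LinearMap.congr_fun (C.cofreeDer_comp_eq_zero_of_map _ K.g_par _ K.h_par K.h_g) y,
    fun x => LinearMap.congr_fun hhh x,
    fun y => (LinearMap.congr_fun (C.cofreeMap_comp_cofreeD K.g K.g_par K.g_d) y).symm,
    fun x => LinearMap.congr_fun (C.cofreeMap_comp_cofreeD K.f K.f_par K.f_d) x,
    ?_, ?_, ?_, fun x => LinearMap.congr_fun b.perturbation x⟩,
    fun i => hmem _ (K.cofreeDeg_le_span C i)⟩
  · refine LinearMap.congr_fun (f := K.cofreeF C ∘ₗ K.cofreeG C) (g := LinearMap.id)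
      (C.cofree_ext fun n => TensorProduct.ext' fun c a => ?_)
    rw [LinearMap.comp_apply, LinearMap.comp_apply, cofreeF, cofreeG,
      DGCooperad.cofreeMap_toCofree, DGCooperad.cofreeMap_toCofree, LinearMap.lTensor_tmul,
      LinearMap.lTensor_tmul, ← LinearMap.comp_apply (PiTensorProduct.map _),
      ← PiTensorProduct.map_comp, K.f_g, PiTensorProduct.map_id]
    rfl
  · refine K.eigen_ext C (α := P ∘ₗ K.cofreeN C + K.cofreeG C ∘ₗ K.cofreeF C) (β := LinearMap.id) ?_
    rintro z ⟨j, hj, hj'⟩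
    rw [LinearMap.add_apply, LinearMap.comp_apply, hj, map_smul, hP j z hj, smul_smul]
    exact hPN j z hj'
  · refine K.eigen_ext C (α := K.cofreeN C ∘ₗ P + K.cofreeG C ∘ₗ K.cofreeF C) (β := LinearMap.id) ?_
    rintro z ⟨j, hj, hj'⟩
    rw [LinearMap.add_apply, LinearMap.comp_apply, hP j z hj, map_smul, hj, smul_smul, mul_comm]
    exact hPN j z hj'
  -- As `h` commutes with `N`, it sends eigenvectors to eigenvectors with the same eigenvalue, so it
  -- commutes with `P`.
  · refine K.eigen_ext C (α := P ∘ₗ K.cofreeH C) (β := K.cofreeH C ∘ₗ P) ?_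
    rintro z ⟨j, hj, -⟩
    rw [LinearMap.comp_apply, LinearMap.comp_apply, hP j z hj, map_smul, hP j]
    rw [hNh, hj, map_smul]

end

end Contraction

/-! ### Weight one, and criteria for compatibility with the coalgebra structure -/

namespace DGCooperad

noncomputable section

variable {C : DGCooperad.{u}} {A : DGModule.{v}} {B : DGModule.{w}}

theorem weightOneIncl_mem (hC : C.Connected) (a : A) :
    C.weightOneIncl A hC a ∈ C.weightLT A 2 :=
  C.toCofree_mem_weightLT one_lt_two _

/-- This is where `C(0) = 0` enters: there is nothing in weight zero, so an operator lowering weight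
vanishes in weight one. -/
theorem eq_zero_of_mem_weightLT_one (hC : C.Connected) {x : C.Cofree A}
    (hx : x ∈ C.weightLT A 1) : x = 0 := by
  have := hC.arity_zero
  refine (C.weightLT_le (p := ⊥) (fun n hn z => ?_) hx)
  obtain rfl : n = 0 := Nat.lt_one_iff.mp hn
  have hz : z = 0 := by
    induction z using TensorProduct.induction_on with
    | zero => rfl
    | tmul c a => rw [Subsingleton.elim c 0, TensorProduct.zero_tmul]
    | add a b ha hb => rw [ha, hb, add_zero]
  rw [hz, map_zero]
  exact Submodule.zero_mem _

theorem weightOneProj_incl (hC : C.Connected) (a : A) :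
    C.weightOneProj A (C.weightOneIncl A hC a) = a := by
  have h : C.counit ((LinearEquiv.ofBijective C.counit hC.arity_one).symm 1) = 1 :=
    (LinearEquiv.ofBijective C.counit hC.arity_one).apply_symm_apply 1
  simp [weightOneProj, weightOneIncl, toCofree, DirectSum.component.lof_self, h]

theorem cofreeMap_weightOneIncl (hC : C.Connected) (φ : A →ₗ[ℚ] B)
    (hφ : ∀ e x, B.par e (φ x) = φ (A.par e x)) (a : A) :
    C.cofreeMap φ hφ (C.weightOneIncl A hC a) = C.weightOneIncl B hC (φ a) := by
  simp only [weightOneIncl, LinearMap.comp_apply, cofreeMap_toCofree, TensorProduct.mk_apply,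
    LinearMap.lTensor_tmul]
  congr 2
  rw [LinearEquiv.coe_coe, LinearEquiv.coe_coe, PiTensorProduct.subsingletonEquiv_symm_apply',
    PiTensorProduct.subsingletonEquiv_symm_apply']
  exact PiTensorProduct.map_tprod _ _

/-- A map that is determined by a morphism `ι` and vanishes on the image of a coderivation is
compatible with the structure maps. -/
theorem coaction_comp_of_comp_eq_zero (k : ℕ) (F : C.Cofree A →ₗ[ℚ] C.Cofree B)
    (ι : C.Cofree B →ₗ[ℚ] C.Cofree A) (L : C.Cofree A →ₗ[ℚ] C.Cofree A)
    (hFi : F ∘ₗ ι = LinearMap.id) (hFL : F ∘ₗ L = 0) (hx : ∀ x, ∃ y z, x = ι y + L z)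
    (hι : C.coaction A k ∘ₗ ι = LinearMap.lTensor (C.obj k)
      (PiTensorProduct.map fun _ => ι) ∘ₗ C.coaction B k)
    (hL : C.coaction A k ∘ₗ L = LinearMap.lTensor (C.obj k)
      (tensorDer (fun _ => LinearMap.id) fun _ => L) ∘ₗ C.coaction A k) :
    C.coaction B k ∘ₗ F = LinearMap.lTensor (C.obj k)
      (PiTensorProduct.map fun _ => F) ∘ₗ C.coaction A k := by
  refine LinearMap.ext fun x => ?_
  -- On the image of `ι` the two sides agree because `F ∘ ι = 1`, also on tensor powers. On the
  -- image of `L` both vanish: the derivation extension of `L` is killed by `F^{⊗k}`.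
  obtain ⟨y, z, rfl⟩ := hx x
  have h1 := LinearMap.congr_fun hFL z
  have h2 := LinearMap.congr_fun hL z
  have h3 := LinearMap.congr_fun hι y
  have h4 := LinearMap.congr_fun hFi y
  have h5 : (fun _ : Fin k => F ∘ₗ ι) = fun _ => LinearMap.id := funext fun _ => hFi
  simp only [LinearMap.comp_apply, LinearMap.zero_apply, LinearMap.id_apply] at h1 h2 h3 h4
  rw [LinearMap.comp_apply, LinearMap.comp_apply, map_add F, h1, add_zero, h4,
    map_add (C.coaction A k), h2, h3, map_add, ← LinearMap.lTensor_comp_apply,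
    ← LinearMap.lTensor_comp_apply, map_comp_tensorDer_eq_zero F L hFL,
    ← PiTensorProduct.map_comp, h5, PiTensorProduct.map_id, LinearMap.lTensor_id,
    LinearMap.lTensor_zero, LinearMap.zero_apply, add_zero, LinearMap.id_apply]

/-- A section of a morphism `π` that is annihilated by a coderivation is compatible with the
structure maps. -/
theorem coaction_comp_of_section (k : ℕ) (G : C.Cofree B →ₗ[ℚ] C.Cofree A)
    (π : C.Cofree A →ₗ[ℚ] C.Cofree B) (L : C.Cofree A →ₗ[ℚ] C.Cofree A)
    (hπG : π ∘ₗ G = LinearMap.id) (hLG : L ∘ₗ G = 0)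
    (hπ : C.coaction B k ∘ₗ π = LinearMap.lTensor (C.obj k)
      (PiTensorProduct.map fun _ => π) ∘ₗ C.coaction A k)
    (hL : C.coaction A k ∘ₗ L = LinearMap.lTensor (C.obj k)
      (tensorDer (fun _ => LinearMap.id) fun _ => L) ∘ₗ C.coaction A k)
    (hker : ∀ z : C.obj k ⊗[ℚ] (⨂[ℚ] _i : Fin k, C.Cofree A),
      LinearMap.lTensor (C.obj k) (tensorDer (fun _ => LinearMap.id) fun _ => L) z = 0 →
      LinearMap.lTensor (C.obj k) (PiTensorProduct.map fun _ => π) z = 0 → z = 0) :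
    C.coaction A k ∘ₗ G = LinearMap.lTensor (C.obj k)
      (PiTensorProduct.map fun _ => G) ∘ₗ C.coaction B k := by
  refine LinearMap.ext fun y => ?_
  have h1 := LinearMap.congr_fun hL (G y)
  have h2 := LinearMap.congr_fun hLG y
  have h3 := LinearMap.congr_fun hπ (G y)
  have h4 := LinearMap.congr_fun hπG y
  have h5 : (fun _ : Fin k => π ∘ₗ G) = fun _ => LinearMap.id := funext fun _ => hπG
  simp only [LinearMap.comp_apply, LinearMap.zero_apply, LinearMap.id_apply] at h1 h2 h3 h4
  rw [h2, map_zero] at h1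
  rw [h4] at h3
  rw [LinearMap.comp_apply, LinearMap.comp_apply, ← sub_eq_zero]
  -- The difference of the two sides is killed by the derivation extension of `L` and by `π^{⊗k}`.
  apply hker
  · rw [map_sub, ← h1, ← LinearMap.lTensor_comp_apply, tensorDer_comp_map_eq_zero G L hLG,
      LinearMap.lTensor_zero, LinearMap.zero_apply, sub_zero]
  · rw [map_sub, ← h3, ← LinearMap.lTensor_comp_apply, ← PiTensorProduct.map_comp, h5,
      PiTensorProduct.map_id, LinearMap.lTensor_id, LinearMap.id_apply, sub_self]

/-- Perturbed differentials descend along morphisms with a section. -/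
theorem coaction_perturbation_of_comm (k : ℕ) (F : C.Cofree A →ₗ[ℚ] C.Cofree B)
    (ι : C.Cofree B →ₗ[ℚ] C.Cofree A) (D : C.Cofree A →ₗ[ℚ] C.Cofree A)
    (β : C.Cofree B →ₗ[ℚ] C.Cofree B) (hFi : F ∘ₗ ι = LinearMap.id)
    (hFD : F ∘ₗ D = (C.cofreeD B + β) ∘ₗ F)
    (hε : F ∘ₗ C.cofreeEps A = C.cofreeEps B ∘ₗ F)
    (hF : C.coaction B k ∘ₗ F = LinearMap.lTensor (C.obj k)
      (PiTensorProduct.map fun _ => F) ∘ₗ C.coaction A k)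
    (hD : C.coaction A k ∘ₗ D = (LinearMap.rTensor _ (C.obj k).d +
      TensorProduct.map (C.obj k).eps (tensorDer (fun _ => C.cofreeEps A) fun _ => D)) ∘ₗ
        C.coaction A k) (y : C.Cofree B) :
    C.coaction B k (β y) = TensorProduct.map (C.obj k).eps
      (tensorDer (fun _ => C.cofreeEps B) fun _ => β) (C.coaction B k y) := by
  have e1 : LinearMap.lTensor (C.obj k) (PiTensorProduct.map fun _ : Fin k => F) ∘ₗ
      (LinearMap.rTensor _ (C.obj k).d +
        TensorProduct.map (C.obj k).eps (tensorDer (fun _ => C.cofreeEps A) fun _ => D)) =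
      (LinearMap.rTensor _ (C.obj k).d + TensorProduct.map (C.obj k).eps
        (tensorDer (fun _ => C.cofreeEps B) fun _ => C.cofreeD B + β)) ∘ₗ
      LinearMap.lTensor (C.obj k) (PiTensorProduct.map fun _ : Fin k => F) := by
    have e2 := map_comp_tensorDer (fun _ : Fin k => C.cofreeEps A) (fun _ => D)
      (fun _ => C.cofreeEps B) (fun _ => C.cofreeD B + β) (fun _ => F)
      (fun _ => hε) (fun _ => hFD)
    refine TensorProduct.ext' fun c t => ?_
    have e3 := LinearMap.congr_fun e2 t
    simp only [LinearMap.comp_apply] at e3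
    simp only [LinearMap.comp_apply, LinearMap.add_apply, LinearMap.rTensor_tmul,
      TensorProduct.map_tmul, LinearMap.lTensor_tmul, map_add, e3]
  -- The coderivation rule for the total differential on `C(B)` holds after precomposition with `F`;
  -- evaluating at `ι y` removes `F`. Subtracting the rule for the internal differential leaves the
  -- one for `β`.
  have e4 : C.coaction B k ∘ₗ (C.cofreeD B + β) ∘ₗ F = (LinearMap.rTensor _ (C.obj k).d +
      TensorProduct.map (C.obj k).eps
        (tensorDer (fun _ => C.cofreeEps B) fun _ => C.cofreeD B + β)) ∘ₗ
      C.coaction B k ∘ₗ F := by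
    rw [hF, ← hFD, ← LinearMap.comp_assoc, hF, LinearMap.comp_assoc, hD,
      ← LinearMap.comp_assoc, e1, LinearMap.comp_assoc]
  have e5 := LinearMap.congr_fun e4 (ι y)
  have e6 := LinearMap.congr_fun hFi y
  have e7 := LinearMap.congr_fun (C.coaction_cofreeD (A := B) k) y
  simp only [LinearMap.comp_apply, LinearMap.id_apply] at e5 e6 e7
  rw [e6, tensorDer_add, TensorProduct.map_add_right, ← add_assoc, LinearMap.add_apply,
    LinearMap.add_apply, ← e7, map_add] at e5
  exact add_left_cancel e5

end

end DGCooperad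

/-! ### The maps of a contraction are quasi-isomorphisms -/

theorem Contraction.f_isQuasiIso {A : DGModule.{v}} {B : DGModule.{w}} (K : Contraction A B) :
    IsQuasiIso K.f where
  mem_deg := K.f_mem
  comm_d := LinearMap.congr_fun K.f_d
  injective := by
    rintro x hx ⟨y, hy⟩
    have h1 := LinearMap.congr_fun K.g_f x
    have h2 := LinearMap.congr_fun K.g_d y
    simp only [LinearMap.comp_apply, LinearMap.add_apply, LinearMap.id_apply] at h1 h2
    rw [hx, map_zero, add_zero, hy, h2] at h1
    exact ⟨K.g y - K.h x, by rw [map_sub, h1, add_sub_cancel_right]⟩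
  surjective := by
    intro y hy
    have h1 := LinearMap.congr_fun K.f_g y
    have h2 := LinearMap.congr_fun K.g_d y
    simp only [LinearMap.comp_apply, LinearMap.id_apply] at h1 h2
    exact ⟨K.g y, by rw [← h2, hy, map_zero], 0, by rw [h1, map_zero, add_zero]⟩

theorem Contraction.g_isQuasiIso {A : DGModule.{v}} {B : DGModule.{w}} (K : Contraction A B) :
    IsQuasiIso K.g where
  mem_deg := K.g_mem
  comm_d := LinearMap.congr_fun K.g_d
  injective := by
    rintro y hy ⟨x, hx⟩
    have h1 := LinearMap.congr_fun K.f_g y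
    have h2 := LinearMap.congr_fun K.f_d x
    simp only [LinearMap.comp_apply, LinearMap.id_apply] at h1 h2
    exact ⟨K.f x, by rw [← h2, ← hx, h1]⟩
  surjective := by
    intro x hx
    have h1 := LinearMap.congr_fun K.g_f x
    have h2 := LinearMap.congr_fun K.f_d x
    simp only [LinearMap.comp_apply, LinearMap.add_apply, LinearMap.id_apply] at h1 h2
    rw [hx, map_zero, add_zero] at h1
    exact ⟨K.f x, by rw [← h2, hx, map_zero], -K.h x, by rw [h1, map_neg, add_neg_cancel_right]⟩

/-! ### The coderivation `L` attached to a `P_∞`-algebra structure -/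

namespace Contraction

noncomputable section

variable {C : DGCooperad.{u}} {A : DGModule.{v}} {B : DGModule.{w}}

theorem coaction_cofreeD_add (b : C.PInfty A) (k : ℕ) :
    C.coaction A k ∘ₗ (C.cofreeD A + b.b) = (LinearMap.rTensor _ (C.obj k).d +
      TensorProduct.map (C.obj k).eps
        (tensorDer (fun _ => C.cofreeEps A) fun _ => C.cofreeD A + b.b)) ∘ₗ C.coaction A k := by
  have h : C.coaction A k ∘ₗ b.b = TensorProduct.map (C.obj k).eps
      (tensorDer (fun _ => C.cofreeEps A) fun _ => b.b) ∘ₗ C.coaction A k :=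
    LinearMap.ext fun x => b.coderivation k x
  rw [LinearMap.comp_add, C.coaction_cofreeD, tensorDer_add, TensorProduct.map_add_right,
    ← add_assoc, h]
  rfl

variable (K : Contraction A B)

/-- The negative of the anticommutator of the perturbed differential of `C(A)` and the coderivation
induced by the homotopy. -/
def perturbedN (b : C.PInfty A) : C.Cofree A →ₗ[ℚ] C.Cofree A :=
  -((C.cofreeD A + b.b) ∘ₗ K.cofreeH C + K.cofreeH C ∘ₗ (C.cofreeD A + b.b))

theorem perturbedN_apply (b : C.PInfty A) (x : C.Cofree A) : K.perturbedN b x =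
    -(C.cofreeD A (K.cofreeH C x) + b.b (K.cofreeH C x) +
      K.cofreeH C (C.cofreeD A x + b.b x)) := rfl

theorem cofreeH_mem (j : ℤ) (x : C.Cofree A) (hx : x ∈ C.cofreeDeg A j) :
    K.cofreeH C x ∈ C.cofreeDeg A (j + 1) :=
  C.cofreeDer_mem K.h K.h_par 1 K.h_mem j x hx

/-- The source of all compatibility with the coalgebra structure: `L` is built from `d + b` and the
coderivation `h` alone, without the pseudo-inverse `P`, so it obeys the coderivation rule exactly.
-/
theorem coaction_perturbedN (b : C.PInfty A) (k : ℕ) :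
    C.coaction A k ∘ₗ K.perturbedN b = LinearMap.lTensor (C.obj k)
      (tensorDer (fun _ => LinearMap.id) fun _ => K.perturbedN b) ∘ₗ C.coaction A k := by
  have hD : C.cofreeEps A ∘ₗ (C.cofreeD A + b.b) = -((C.cofreeD A + b.b) ∘ₗ C.cofreeEps A) :=
    C.cofreeEps_odd _ (-1) (by simp) fun j x hx =>
      Submodule.add_mem _ (C.cofreeD_mem j x hx) (b.b_mem j x hx)
  have h := C.coaction_anticomm (C.cofreeD A + b.b) (K.cofreeH C) k hD
    (C.cofreeEps_odd _ 1 (by simp) K.cofreeH_mem) (coaction_cofreeD_add b k)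
    (C.coaction_cofreeDer K.h K.h_par k)
  unfold perturbedN
  generalize (C.cofreeD A + b.b) ∘ₗ K.cofreeH C + K.cofreeH C ∘ₗ (C.cofreeD A + b.b) = M at h ⊢
  rw [tensorDer_neg]
  refine LinearMap.ext fun x => ?_
  have hx := LinearMap.congr_fun h x
  simp only [LinearMap.comp_apply, LinearMap.neg_apply, map_neg] at hx ⊢
  rw [hx]
  generalize C.coaction A k x = z
  induction z using TensorProduct.induction_on with
  | zero => simp
  | tmul c t => simp
  | add a b ha hb => rw [map_add, map_add, neg_add, ha, hb]

/-- The tensor power analogue of `ker L ∩ ker p = 0`, needed to identify the two candidates for the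
coaction on the image of `G`. -/
theorem eq_zero_of_perturbedN (b : C.PInfty A) (k : ℕ)
    (z : C.obj k ⊗[ℚ] (⨂[ℚ] _i : Fin k, C.Cofree A))
    (hz : LinearMap.lTensor (C.obj k)
      (tensorDer (fun _ => LinearMap.id) fun _ => K.perturbedN b) z = 0)
    (hf : LinearMap.lTensor (C.obj k) (PiTensorProduct.map fun _ => K.cofreeF C) z = 0) :
    z = 0 := by
  have hH : ∀ w, ∀ x ∈ C.weightLT A w, K.cofreeH C x ∈ C.weightLT A w := fun w x hx =>
    C.cofreeDer_mem_weightLT _ _ hx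
  refine tensor_eq_zero_of_perturbation (C.weightLT A) (fun x => C.weightLT_zero) (fun x => ?_)
    (K.cofreeN C) (b.b ∘ₗ K.cofreeH C + K.cofreeH C ∘ₗ b.b) (K.perturbedN b)
    (K.cofreeG C ∘ₗ K.cofreeF C) ?_ (fun w x hx => ?_) (fun w x hx => ?_) k z hz ?_
  · obtain ⟨w, hw⟩ := C.exists_mem_weightLT x
    exact ⟨w, C.weightLT_mono w.le_succ hw⟩
  · rw [cofreeN, perturbedN, LinearMap.add_comp, LinearMap.comp_add]
    abel
  · exact K.weightLT_le_span C w hx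
  · exact Submodule.add_mem _ (b.mem_weightLT w _ (hH _ _ hx)) (hH _ _ (b.mem_weightLT w _ hx))
  · rw [PiTensorProduct.map_comp, LinearMap.lTensor_comp_apply, hf, map_zero]

end

end Contraction

/-! ### The transferred structure and the two `∞`-quasi-isomorphisms -/

theorem mainTheorem4 (C : DGCooperad.{u}) (hC : C.Connected) (A : DGModule.{v}) (B : DGModule.{w})
    (K : Contraction A B) (b : C.PInfty A) :
    ∃ (b' : C.PInfty B) (F : DGCooperad.InftyMorphism b b') (G : DGCooperad.InftyMorphism b' b),
      F.linearPart hC = K.f ∧ G.linearPart hC = K.g ∧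
        F.IsInftyQuasiIso hC ∧ G.IsInftyQuasiIso hC := by
  obtain ⟨P, H, hPdeg⟩ := K.exists_perturbationData C b
  obtain ⟨S, hS, hS', hSU⟩ := H.exists_inverse
  obtain ⟨F, hF⟩ : ∃ F : C.Cofree A →ₗ[ℚ] C.Cofree B, ∀ x, F x = K.cofreeF C (S x) :=
    ⟨K.cofreeF C ∘ₗ S, fun _ => rfl⟩
  obtain ⟨G, hG⟩ : ∃ G : C.Cofree B →ₗ[ℚ] C.Cofree A, ∀ y, G y = K.cofreeG C y +
      K.cofreeH C (P (S (b.b (K.cofreeG C y)))) :=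
    ⟨K.cofreeG C + K.cofreeH C ∘ₗ P ∘ₗ S ∘ₗ b.b ∘ₗ K.cofreeG C, fun _ => rfl⟩
  obtain ⟨β, hβ⟩ : ∃ β : C.Cofree B →ₗ[ℚ] C.Cofree B, ∀ y, β y =
      K.cofreeF C (S (b.b (K.cofreeG C y))) :=
    ⟨K.cofreeF C ∘ₗ S ∘ₗ b.b ∘ₗ K.cofreeG C, fun _ => rfl⟩
  -- degrees and weights
  have hSdeg : ∀ (j : ℤ) x, x ∈ C.cofreeDeg A j → S x ∈ C.cofreeDeg A j := by
    intro j
    -- `bhP` has degree `-1 + 1 + 0 = 0`, so every `cofreeDeg A j` is invariant under it and hence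
    -- under `S`.
    refine hSU _ fun x hx => ?_
    have := b.b_mem _ _ (K.cofreeH_mem j _ (hPdeg j x hx))
    rwa [add_sub_cancel_right] at this
  have hFdeg : ∀ (j : ℤ) x, x ∈ C.cofreeDeg A j → F x ∈ C.cofreeDeg B j := fun j x hx =>
    (hF x).symm ▸ C.cofreeMap_mem _ _ K.f_mem (hSdeg j x hx)
  have hGdeg : ∀ (j : ℤ) x, x ∈ C.cofreeDeg B j → G x ∈ C.cofreeDeg A j := by
    intro j x hx
    have hi : K.cofreeG C x ∈ C.cofreeDeg A j := C.cofreeMap_mem _ _ K.g_mem hx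
    have := K.cofreeH_mem _ _ (hPdeg _ _ (hSdeg _ _ (b.b_mem _ _ hi)))
    rw [sub_add_cancel] at this
    exact (hG x).symm ▸ Submodule.add_mem _ hi this
  have hβdeg : ∀ (j : ℤ) x, x ∈ C.cofreeDeg B j → β x ∈ C.cofreeDeg B (j - 1) := fun j x hx =>
    (hβ x).symm ▸ C.cofreeMap_mem _ _ K.f_mem
      (hSdeg _ _ (b.b_mem _ _ (C.cofreeMap_mem _ _ K.g_mem hx)))
  have hSwt : ∀ w, ∀ x ∈ C.weightLT A w, S x ∈ C.weightLT A w := fun w =>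
    hSU _ fun x hx => H.b_mem w _ (H.h_mem _ _ (H.P_mem _ _ (C.weightLT_mono w.le_succ hx)))
  have hβwt : ∀ w, ∀ x ∈ C.weightLT B (w + 1), β x ∈ C.weightLT B w := fun w x hx =>
    (hβ x).symm ▸ C.cofreeMap_mem_weightLT _ _
      (hSwt w _ (H.b_mem w _ (C.cofreeMap_mem_weightLT _ _ hx)))
  -- identities of the perturbation lemma
  have hFi : F ∘ₗ K.cofreeG C = LinearMap.id := LinearMap.ext fun y => (hF _).trans (H.F_i hS y)
  have hFL : F ∘ₗ K.perturbedN b = 0 := LinearMap.ext fun x => (hF _).trans (H.F_L hS x)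
  have hpG : K.cofreeF C ∘ₗ G = LinearMap.id :=
    LinearMap.ext fun y => (congrArg _ (hG y)).trans (H.p_G y)
  have hLG : K.perturbedN b ∘ₗ G = 0 := LinearMap.ext fun y => H.L_G hS' y _ (hG y)
  have hFD : F ∘ₗ (C.cofreeD A + b.b) = (C.cofreeD B + β) ∘ₗ F := by
    refine LinearMap.ext fun x => ?_
    simp only [LinearMap.comp_apply, LinearMap.add_apply, hF, hβ]
    exact H.F_comm hS x
  have hGD : G ∘ₗ (C.cofreeD B + β) = (C.cofreeD A + b.b) ∘ₗ G := by
    refine LinearMap.ext fun y => ?_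
    simp only [LinearMap.comp_apply, LinearMap.add_apply, hβ]
    exact H.G_comm hS hS' G hG y
  -- compatibility with the structure maps
  have hΔF : ∀ k, C.coaction B k ∘ₗ F = LinearMap.lTensor (C.obj k)
      (PiTensorProduct.map fun _ => F) ∘ₗ C.coaction A k := fun k =>
    DGCooperad.coaction_comp_of_comp_eq_zero k F (K.cofreeG C) (K.perturbedN b) hFi hFL
      (H.exists_eq_add _ (K.perturbedN_apply b)) (C.coaction_cofreeMap K.g K.g_par k)
      (K.coaction_perturbedN b k)
  have hΔG : ∀ k, C.coaction A k ∘ₗ G = LinearMap.lTensor (C.obj k)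
      (PiTensorProduct.map fun _ => G) ∘ₗ C.coaction B k := fun k =>
    DGCooperad.coaction_comp_of_section k G (K.cofreeF C) (K.perturbedN b) hpG hLG
      (C.coaction_cofreeMap K.f K.f_par k) (K.coaction_perturbedN b k)
      (K.eq_zero_of_perturbedN b k)
  let b' : C.PInfty B :=
    { b := β
      b_mem := hβdeg
      coderivation := fun k => DGCooperad.coaction_perturbation_of_comm k F (K.cofreeG C)
        (C.cofreeD A + b.b) β hFi hFD (C.cofreeEps_even F hFdeg) (hΔF k)
        (Contraction.coaction_cofreeD_add b k)
      perturbation := LinearMap.ext fun y => by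
        simp only [LinearMap.comp_apply, LinearMap.add_apply, hβ]
        exact H.sq_perturbed hS y
      decreases_weight := fun w x v hv => hβwt w _ (C.lof_mem_weightLT w x) v hv }
  let Φ : DGCooperad.InftyMorphism b b' :=
    { toFun := F
      mem_deg := hFdeg
      comm_d := hFD
      coaction := fun k => LinearMap.congr_fun (hΔF k) }
  let Γ : DGCooperad.InftyMorphism b' b :=
    { toFun := G
      mem_deg := hGdeg
      comm_d := hGD
      coaction := fun k => LinearMap.congr_fun (hΔG k) }
  -- In weight at most one `b` vanishes, so the correction terms of `F` and `G` disappear there and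
  -- the linear parts are those of `C(f)` and `C(g)`.
  have hb1 : ∀ x ∈ C.weightLT A 2, b.b x = 0 := fun x hx =>
    DGCooperad.eq_zero_of_mem_weightLT_one hC (H.b_mem 1 x hx)
  have hΦ : Φ.linearPart hC = K.f := by
    refine LinearMap.ext fun a => ?_
    have ha := DGCooperad.weightOneIncl_mem hC a
    have h1 : F (C.weightOneIncl A hC a) = C.weightOneIncl B hC (K.f a) := by
      rw [hF, hS, hb1 _ (H.h_mem _ _ (H.P_mem _ _ ha)), map_zero, add_zero]
      exact DGCooperad.cofreeMap_weightOneIncl hC K.f K.f_par a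
    exact (congrArg _ h1).trans (DGCooperad.weightOneProj_incl hC _)
  have hΓ : Γ.linearPart hC = K.g := by
    refine LinearMap.ext fun a => ?_
    have ha := DGCooperad.weightOneIncl_mem hC a
    have h1 : G (C.weightOneIncl B hC a) = C.weightOneIncl A hC (K.g a) := by
      have hi : K.cofreeG C (C.weightOneIncl B hC a) ∈ C.weightLT A 2 :=
        C.cofreeMap_mem_weightLT _ _ ha
      rw [hG, hb1 _ hi, map_zero, map_zero, map_zero, add_zero]
      exact DGCooperad.cofreeMap_weightOneIncl hC K.g K.g_par a
    exact (congrArg _ h1).trans (DGCooperad.weightOneProj_incl hC _)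
  refine ⟨b', Φ, Γ, hΦ, hΓ, ?_, ?_⟩
  · rw [DGCooperad.InftyMorphism.IsInftyQuasiIso, hΦ]
    exact K.f_isQuasiIso
  · rw [DGCooperad.InftyMorphism.IsInftyQuasiIso, hΓ]
    exact K.g_isQuasiIso
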